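/- **Theorem 4.1.** For $f:\mathbb C\to\mathbb C$ let $$\mathcal C[f](z)=\frac1\pi\int_{\mathbb C}\frac{f(\zeta)}{z-\zeta}\,dm(\zeta),\qquad \overline{\mathcal C}[f](z)=\frac1\pi\int_{\mathbb C}\frac{f(\zeta)}{\bar z-\bar\zeta}\,dm(\zeta),$$ and put $e_k(z)=\exp\big(i(kz+\bar k\bar z)\big)$, $\rho(z)=(1+|z|^2)^{1/2}$, and $$S_{k,u}h=-\tfrac14\,\mathcal C\big(u\,e_{-k}\,\overline{\mathcal C}(e_k\bar u\,h)\big).$$ Fix $2<p<\infty$, $k_0\in\mathbb C$ and $\varphi\in C_0^\infty(\mathbb C)$. Let $u_0=2e_{k_0}\rho^{-2}$ be the one-soliton potential, set $\chi=e_{-k_0}\varphi$, and $$\alpha=\frac1{2\pi}\int_{\mathbb C}\big(\chi+|z|^2\bar\chi\big)\rho^{-4}\,dm(z),\qquad \beta=-\frac1{2\pi}\int_{\mathbb C}\big(\chi-\bar\chi\big)\,z\,\rho^{-4}\,dm(z).$$ For $\kappa\in\mathbb C$ and $\varepsilon\in\mathbb R$ the operator $T(\kappa,\varepsilon)=S_{k_0+\kappa,\,u_0+\varepsilon\varphi}$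 is bounded on $L^p(\mathbb C)$, and the following hold. (i) There is $r>0$ such that the closed disc $|\lambda-1|\le r$ contains no point of the spectrum of $T(0,0)$ other than $1$. For every such $r$ let $$P(\kappa,\varepsilon)=\frac1{2\pi i}\oint_{|\lambda-1|=r}\big(\lambda I-T(\kappa,\varepsilon)\big)^{-1}d\lambda .$$ For all sufficiently small $(\kappa,\varepsilon)$ the projection $P=P(\kappa,\varepsilon)$ has rank two, and the determinant of the reduced operator $P(I-T(\kappa,\varepsilon))P$, acting on the range of $P$, satisfies $$\det\Big(P\big(I-T(\kappa,\varepsilon)\big)P\big|_{\operatorname{Ran}P}\Big)=4\Big(\big|i\bar\kappa+\varepsilon\beta\big|^2+\varepsilon^2|\alpha|^2\Big)+o\big(\varepsilon^2+|\varepsilon||\kappa|+|\kappa|^2\big)\qquad\text{as }(\kappa,\varepsilon)\to(0,0).$$ Moreover, if $\alpha\ne0$, then for every $C>0$ there is $\varepsilon_0>0$ such that $I-T(\kappa,\varepsilon)$ is invertible in $\mathcal B(L^p)$ (in particular, has trivial kernel) whenever $0<|\varepsilon|<\varepsilon_0$ and $|\kappa|<C|\varepsilon|$. (ii) There are $C>0$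 and $\varepsilon_0>0$ such that $I-T(\kappa,\varepsilon)$ is invertible in $\mathcal B(L^p)$ for all $0<\varepsilon<\varepsilon_0$ and all $\kappa\in\mathbb C$ with $|\kappa|>C\varepsilon$. -/

import Mathlib

open MeasureTheory Filter Topology Asymptotics
open scoped ENNReal ContDiff ComplexConjugate

namespace DSSoliton

noncomputable section

/-- The unimodular exponential `e_k(z) = exp(i(kz + k̄ z̄))`. -/
def expo (k z : ℂ) : ℂ := Complex.exp (Complex.I * (k * z + conj k * conj z))

/-- The solid Cauchy transform `C[f](z) = π⁻¹ ∫ f(ζ)/(z - ζ) dm(ζ)`. -/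
def cauchy (f : ℂ → ℂ) (z : ℂ) : ℂ :=
  (Real.pi : ℂ)⁻¹ * ∫ ζ : ℂ, (z - ζ)⁻¹ * f ζ

/-- The conjugate Cauchy transform `C̄[f](z) = π⁻¹ ∫ f(ζ)/(z̄ - ζ̄) dm(ζ)`. -/
def cauchyBar (f : ℂ → ℂ) (z : ℂ) : ℂ :=
  (Real.pi : ℂ)⁻¹ * ∫ ζ : ℂ, (conj z - conj ζ)⁻¹ * f ζ

/-- The scattering operator `h ↦ -(1/4) C(u e_{-k} C̄(e_k ū h))` on functions. The sign is the one
for which the Jost function solves `m₁ = 1 + S m₁`, that is, for which the exceptional points are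
the `k` with `ker (I - S)` nontrivial. -/
def scatFun (k : ℂ) (u h : ℂ → ℂ) : ℂ → ℂ :=
  fun z => -(1 / 4 : ℂ) *
    cauchy (fun ζ => u ζ * expo (-k) ζ *
      cauchyBar (fun w => expo k w * conj (u w) * h w) ζ) z

/-- The space `L^p(ℂ)` of complex-valued functions, for Lebesgue measure. -/
abbrev LpC (p : ℝ≥0∞) : Type := Lp ℂ p (volume : Measure ℂ)

/-- `S` is the bounded operator on `L^p(ℂ)` given by `h ↦ -(1/4) C(u e_{-k} C̄(e_k ū h))`.
There is at most one such `S`. -/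
def IsScatOp (p : ℝ≥0∞) [Fact (1 ≤ p)] (k : ℂ) (u : ℂ → ℂ) (S : LpC p →L[ℂ] LpC p) : Prop :=
  ∀ h : LpC p, (S h : ℂ → ℂ) =ᵐ[volume] scatFun k u h

/-- `ρ(z)² = 1 + |z|²`. -/
def rhoSq (z : ℂ) : ℝ := 1 + ‖z‖ ^ 2

/-- The one-soliton potential `u₀ = 2 e_{k₀} ρ⁻²`. -/
def soliton (k₀ z : ℂ) : ℂ := 2 * expo k₀ z / (rhoSq z : ℂ)

/-- `χ = e_{-k₀} φ`. -/
def chi (k₀ : ℂ) (φ : ℂ → ℂ) (z : ℂ) : ℂ := expo (-k₀) z * φ z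

/-- `α = (2π)⁻¹ ∫ (χ + |z|² χ̄) ρ⁻⁴ dm`. -/
def alpha (k₀ : ℂ) (φ : ℂ → ℂ) : ℂ :=
  (2 * Real.pi : ℂ)⁻¹ *
    ∫ z : ℂ, (chi k₀ φ z + (‖z‖ : ℂ) ^ 2 * conj (chi k₀ φ z)) / (rhoSq z : ℂ) ^ 2

/-- `β = -(2π)⁻¹ ∫ (χ - χ̄) z ρ⁻⁴ dm`. -/
def beta (k₀ : ℂ) (φ : ℂ → ℂ) : ℂ :=
  -(2 * Real.pi : ℂ)⁻¹ *
    ∫ z : ℂ, (chi k₀ φ z - conj (chi k₀ φ z)) * z / (rhoSq z : ℂ) ^ 2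

section Spectral

variable {X : Type*} [NormedAddCommGroup X] [NormedSpace ℂ X]

/-- The circle `|λ - 1| = r` separates the point `1` from the rest of the spectrum of `A`. -/
def Isolates (r : ℝ) (A : X →L[ℂ] X) : Prop :=
  0 < r ∧ ∀ μ ∈ spectrum ℂ A, ‖μ - 1‖ ≤ r → μ = 1

/-- The Riesz projection `(2πi)⁻¹ ∮_{|λ - 1| = r} (λ - A)⁻¹ dλ`. -/
def rieszProj (r : ℝ) (A : X →L[ℂ] X) : X →L[ℂ] X :=
  (2 * Real.pi * Complex.I : ℂ)⁻¹ • ∮ μ in C(1, r), resolvent A μ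

/-- The range of the Riesz projection. -/
def rieszRange (r : ℝ) (A : X →L[ℂ] X) : Submodule ℂ X :=
  LinearMap.range (rieszProj r A : X →ₗ[ℂ] X)

/-- The reduced operator `P (I - A) P`, with `P` the Riesz projection, as an endomorphism of the
range of `P`. -/
def reduced (r : ℝ) (A : X →L[ℂ] X) : rieszRange r A →ₗ[ℂ] rieszRange r A :=
  (rieszProj r A : X →ₗ[ℂ] X).rangeRestrict ∘ₗ
    ((1 - A : X →L[ℂ] X) : X →ₗ[ℂ] X) ∘ₗ (rieszRange r A).subtype

end Spectral

end

end DSSoliton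

/-! At `k = k₀ + κ` the soliton phase cancels against `e_k`, and `T(κ, ε)` becomes `-(1/4)(2C₀ +
εC₁)(2B₀(κ) + εB₁(κ))`. Here `C₀`, `C₁` are `g ↦ C[w g]` from `L^∞` to `L^p` with `w = ρ⁻², χ`, and
`B₀`, `B₁` are `h ↦ e_{-κ} C̄[e_κ w h]` from `L^p` to `L^∞` with `w = ρ⁻², χ̄`. The first two have
kernels in `L^p(L¹)`, hence are compact. The last two are Lipschitz in `κ` in operator norm, because
the difference of two phases `e_κ(x - ζ)` cancels the Cauchy singularity. So `T` is compact and
norm-continuous, and by the Fredholm alternative `I - T` is invertible as soon as `T` has no nonzero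
fixed vector.

Fixed vectors of `T(κ, 0)`. Put `G = C̄[e_κ ρ⁻² h]`. Then `h = T(κ, 0) h` gives, weakly, `∂̄h = -ρ⁻²
e_{-κ} G` and `∂G = e_κ ρ⁻² h`. Eliminating `G` gives `∂̄(∂h + (iκ + z̄ρ⁻²)h) = 0`, because
`∂̄(z̄ρ⁻²) = ρ⁻⁴` is exactly the potential term. Cutoff arguments of Liouville type first remove the
outer `∂̄` (`integral_mul_darboux_eq_zero`), so that `ρ² e_κ h` is antiholomorphic, and then make it
affine in `z̄` (`exists_affine_of_weakly_holomorphic`). Thus `h = e_{-κ} ρ⁻² (c₀ + c₁ z̄)`. Inserted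
in the first equation this leaves `iκ̄h = 0`: there is no fixed vector for `κ ≠ 0`, and for `κ = 0`
the eigenspace is spanned by `ρ⁻²` and `z̄ρ⁻²`. The densities `(2/π)ρ⁻⁴` and `(2/π)zρ⁻⁴` are fixed
by the transpose and biorthogonal to these, so the eigenvalue `1` is semisimple and its Riesz
projection is the explicit `∑ ψⱼ ⊗ lⱼ`.

Determinant. For small `(κ, ε)` the vectors `Pψⱼ` form a basis of `Ran P`. Since `lᵢ ∘ T(0,0) = lᵢ`,
the reduced determinant is `det lᵢ((T(0,0) - T)Pψⱼ)` divided by a Gram determinant tending to `1`,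
and to leading order `Pψⱼ` may be replaced by `ψⱼ` (`SemisimpleAtOne.det_reduced_isLittleO`). The
entries are `kappaPart + ε epsPart + o(|ε| + |κ|)`. The `κ` part comes from `(e_κ(y) - 1)/ȳ ≈ iκ y/ȳ
+ iκ̄` paired with explicit densities, most pairings vanishing by symmetry; the `ε` part is made of
`α` and `β`.

Invertibility. A fixed vector lies in `Ran P`, so a nonzero determinant excludes it; this settles
small `κ` in both regimes. For `κ` in a compact set away from `0`, invertibility of `I - T(κ, 0)`
persists under small `ε`. For large `κ`, oscillation gives `‖C₀B₀(κ)‖ → 0` and a Neumann series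
finishes. -/

/-! ### Circle integrals under bounded maps and Fubini. -/

theorem ContinuousLinearMap.map_circleIntegral {E F : Type*} [NormedAddCommGroup E]
    [NormedSpace ℂ E] [CompleteSpace E] [NormedAddCommGroup F] [NormedSpace ℂ F] [CompleteSpace F]
    (L : E →L[ℂ] F) {f : ℂ → E} {c : ℂ} {r : ℝ} (hf : CircleIntegrable f c r) :
    L (∮ z in C(c, r), f z) = ∮ z in C(c, r), L (f z) := by
  simp only [circleIntegral]
  rw [← L.intervalIntegral_comp_comm hf.out]
  simp only [map_smul]

theorem circleIntegral_swap {E : Type*} [NormedAddCommGroup E] [NormedSpace ℂ E]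
    {f : ℂ → ℂ → E} {c : ℂ} {r s : ℝ} (hr : 0 ≤ r) (hs : 0 ≤ s)
    (hf : ContinuousOn (Function.uncurry f) (Metric.sphere c r ×ˢ Metric.sphere c s)) :
    (∮ z in C(c, r), ∮ w in C(c, s), f z w) = ∮ w in C(c, s), ∮ z in C(c, r), f z w := by
  have hfc : Continuous fun x : ℝ × ℝ => f (circleMap c r x.1) (circleMap c s x.2) := by
    refine ContinuousOn.comp_continuous (f := fun x : ℝ × ℝ => (circleMap c r x.1, circleMap c s x.2))
      hf (by fun_prop) fun x => ⟨circleMap_mem_sphere c hr _, circleMap_mem_sphere c hs _⟩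
  simp only [circleIntegral, ← intervalIntegral.integral_smul, deriv_circleMap]
  rw [intervalIntegral_intervalIntegral_swap]
  · simp only [smul_smul, mul_comm]
  · refine (Continuous.integrableOn_Icc (f := Function.uncurry _) ?_ (a := (0, 0))
      (b := (2 * Real.pi, 2 * Real.pi))).mono_set ?_
    · simp only [Function.uncurry_def]
      have h1 : Continuous fun x : ℝ × ℝ => circleMap 0 r x.1 * Complex.I := by fun_prop
      have h2 : Continuous fun x : ℝ × ℝ => circleMap 0 s x.2 * Complex.I := by fun_prop
      exact h1.smul (h2.smul hfc)
    · rw [Set.uIoc_of_le Real.two_pi_pos.le, ← Set.Icc_prod_Icc]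
      exact Set.prod_mono Set.Ioc_subset_Icc_self Set.Ioc_subset_Icc_self

namespace DSSoliton

/-! ### Resolvents and Riesz projections. -/

section Spectral

variable {X : Type*} [NormedAddCommGroup X] [NormedSpace ℂ X]

/-- If `Q` is idempotent and `T Q = Q T = Q`, then `(μ - 1)⁻¹ Q + (μ - T - c Q)⁻¹ (1 - Q)` inverts
`μ - T`. -/
theorem resolvent_of_eigenprojection {T Q : X →L[ℂ] X} (hQ : Q * Q = Q) (hTQ : T * Q = Q)
    (hQT : Q * T = Q) {c μ : ℂ} (hμ : μ ∈ resolventSet ℂ (T + c • Q)) (h1 : μ ≠ 1) :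
    μ ∈ resolventSet ℂ T ∧
      resolvent T μ = (μ - 1)⁻¹ • Q + resolvent (T + c • Q) μ * (1 - Q) := by
  have h1' : μ - 1 ≠ 0 := sub_ne_zero.mpr h1
  set N := resolvent (T + c • Q) μ with hN
  set A : X →L[ℂ] X := algebraMap ℂ _ μ - (T + c • Q) with hA
  have hAu : IsUnit A := hμ
  have hAN : A * N = 1 := Ring.mul_inverse_cancel _ hAu
  have hNA : N * A = 1 := Ring.inverse_mul_cancel _ hAu
  have e1 : algebraMap ℂ (X →L[ℂ] X) μ = μ • 1 := Algebra.algebraMap_eq_smul_one μ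
  have hQA : Q * A = (μ - 1 - c) • Q := by
    simp only [hA, e1, mul_sub, mul_add, mul_smul_comm, mul_one, hQT, hQ]; module
  have hAQ : A * Q = (μ - 1 - c) • Q := by
    simp only [hA, e1, sub_mul, add_mul, smul_mul_assoc, one_mul, hTQ, hQ]; module
  have hcomm : N * Q = Q * N := by
    calc N * Q = N * Q * (A * N) := by rw [hAN, mul_one]
      _ = N * (Q * A) * N := by simp only [mul_assoc]
      _ = N * (A * Q) * N := by rw [hQA, hAQ]
      _ = (N * A) * Q * N := by simp only [mul_assoc]
      _ = Q * N := by rw [hNA, one_mul]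
  set B : X →L[ℂ] X := algebraMap ℂ _ μ - T with hB
  have hBA : B = A + c • Q := by rw [hB, hA]; abel
  have hBQ : B * Q = (μ - 1) • Q := by
    simp only [hB, e1, sub_mul, smul_mul_assoc, one_mul, hTQ]; module
  have hQB : Q * B = (μ - 1) • Q := by
    simp only [hB, e1, mul_sub, mul_smul_comm, mul_one, hQT]; module
  have hQQ : Q * (1 - Q) = 0 := by rw [mul_sub, mul_one, hQ, sub_self]
  have hQQ' : (1 - Q) * Q = 0 := by rw [sub_mul, one_mul, hQ, sub_self]
  have hr : B * ((μ - 1)⁻¹ • Q + N * (1 - Q)) = 1 := by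
    rw [mul_add, mul_smul_comm, hBQ, smul_smul, inv_mul_cancel₀ h1', one_smul, hBA, add_mul,
      ← mul_assoc, hAN, one_mul, smul_mul_assoc, ← mul_assoc Q, ← hcomm, mul_assoc, hQQ, mul_zero,
      smul_zero]
    abel
  have hl : ((μ - 1)⁻¹ • Q + N * (1 - Q)) * B = 1 := by
    have h2 : (1 - Q) * B = A * (1 - Q) := by
      rw [sub_mul, one_mul, hQB, mul_sub, mul_one, hAQ, hBA]; module
    rw [add_mul, smul_mul_assoc, hQB, smul_smul, inv_mul_cancel₀ h1', one_smul, mul_assoc, h2,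
      ← mul_assoc, hNA, one_mul]
    abel
  have hBu : IsUnit B := ⟨⟨B, _, hr, hl⟩, rfl⟩
  refine ⟨hBu, ?_⟩
  calc resolvent T μ = Ring.inverse B * (B * ((μ - 1)⁻¹ • Q + N * (1 - Q))) := by
        rw [hr, mul_one]; rfl
    _ = _ := by rw [← mul_assoc, Ring.inverse_mul_cancel _ hBu, one_mul]

/-- Adding `c Q` moves the eigenvalue `1` to `1 + c` and leaves the rest of the resolvent set. -/
theorem mem_resolventSet_add_smul_eigenprojection {T Q : X →L[ℂ] X} (hQ : Q * Q = Q)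
    (hTQ : T * Q = Q) (hQT : Q * T = Q) {c μ : ℂ} (hμ : μ ∈ resolventSet ℂ T) (h1 : μ ≠ 1 + c) :
    μ ∈ resolventSet ℂ (T + c • Q) := by
  by_cases hμ1 : μ = 1
  · -- then `Q = 0`
    have hz : Q = 0 := by
      have h : (algebraMap ℂ (X →L[ℂ] X) μ - T) * Q = 0 := by
        rw [hμ1, map_one, sub_mul, one_mul, hTQ, sub_self]
      exact (IsUnit.mul_right_eq_zero hμ).mp h
    simpa [hz] using hμ
  have hc : μ - 1 - c ≠ 0 := by
    intro h; apply h1; linear_combination h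
  set R := resolvent T μ with hR
  set B : X →L[ℂ] X := algebraMap ℂ _ μ - T with hB
  have hBR : B * R = 1 := Ring.mul_inverse_cancel _ hμ
  have hRB : R * B = 1 := Ring.inverse_mul_cancel _ hμ
  have e1 : algebraMap ℂ (X →L[ℂ] X) μ = μ • 1 := Algebra.algebraMap_eq_smul_one μ
  have hBQ : B * Q = (μ - 1) • Q := by
    simp only [hB, e1, sub_mul, smul_mul_assoc, one_mul, hTQ]; module
  have hQB : Q * B = (μ - 1) • Q := by
    simp only [hB, e1, mul_sub, mul_smul_comm, mul_one, hQT]; module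
  have hcomm : R * Q = Q * R := by
    calc R * Q = R * Q * (B * R) := by rw [hBR, mul_one]
      _ = R * (Q * B) * R := by simp only [mul_assoc]
      _ = R * (B * Q) * R := by rw [hQB, hBQ]
      _ = (R * B) * Q * R := by simp only [mul_assoc]
      _ = Q * R := by rw [hRB, one_mul]
  have hQQ : Q * (1 - Q) = 0 := by rw [mul_sub, mul_one, hQ, sub_self]
  have hA : algebraMap ℂ _ μ - (T + c • Q) = B - c • Q := by simp [hB, sub_sub]
  have hAQ : (B - c • Q) * Q = (μ - 1 - c) • Q := by
    rw [sub_mul, hBQ, smul_mul_assoc, hQ]; module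
  have hQA : Q * (B - c • Q) = (μ - 1 - c) • Q := by
    rw [mul_sub, hQB, mul_smul_comm, hQ]; module
  have hr : (B - c • Q) * ((μ - 1 - c)⁻¹ • Q + R * (1 - Q)) = 1 := by
    rw [mul_add, mul_smul_comm, hAQ, smul_smul, inv_mul_cancel₀ hc, one_smul, sub_mul,
      ← mul_assoc, hBR, one_mul, smul_mul_assoc, ← mul_assoc Q, ← hcomm, mul_assoc, hQQ, mul_zero,
      smul_zero]
    abel
  have hl : ((μ - 1 - c)⁻¹ • Q + R * (1 - Q)) * (B - c • Q) = 1 := by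
    have h2 : (1 - Q) * (B - c • Q) = B * (1 - Q) := by
      rw [sub_mul, one_mul, hQA, mul_sub, mul_one, hBQ]; module
    rw [add_mul, smul_mul_assoc, hQA, smul_smul, inv_mul_cancel₀ hc, one_smul, mul_assoc, h2,
      ← mul_assoc, hRB, one_mul]
    abel
  rw [spectrum.mem_resolventSet_iff, hA]
  exact ⟨⟨_, _, hr, hl⟩, rfl⟩


theorem continuousOn_resolvent [CompleteSpace X] (T : X →L[ℂ] X) :
    ContinuousOn (resolvent T) (resolventSet ℂ T) := fun _ hμ =>
  (spectrum.hasDerivAt_resolvent_const_left hμ).continuousAt.continuousWithinAt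

/-- The Riesz projection of an isolated semisimple eigenvalue `1` is the eigenprojection. -/
theorem rieszProj_eq_eigenprojection [CompleteSpace X] {T Q : X →L[ℂ] X} (hQ : Q * Q = Q) (hTQ : T * Q = Q)
    (hQT : Q * T = Q) (h1 : ∀ c : ℂ, c ≠ 0 → (1 : ℂ) ∈ resolventSet ℂ (T + c • Q)) {r : ℝ}
    (hr : Isolates r T) : rieszProj r T = Q := by
  obtain ⟨hr0, hiso⟩ := hr
  -- Adding `c Q` moves the eigenvalue `1` to `1 + c`, at distance `r + 1` from `1`; the closed disc
  -- of radius `r` is then free of spectrum, and the regular part of the resolvent integrates to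
  -- zero by Cauchy's theorem.
  set c : ℂ := ((r + 1 : ℝ) : ℂ) with hc
  have hcn : ‖c‖ = r + 1 := by rw [hc, Complex.norm_real, Real.norm_of_nonneg (by positivity)]
  have hc0 : c ≠ 0 := by rw [← norm_pos_iff, hcn]; positivity
  have hball : Metric.closedBall (1 : ℂ) r ⊆ resolventSet ℂ (T + c • Q) := by
    intro μ hμ
    rw [Metric.mem_closedBall, dist_eq_norm] at hμ
    by_cases hμ1 : μ = 1
    · rw [hμ1]; exact h1 c hc0
    · apply mem_resolventSet_add_smul_eigenprojection hQ hTQ hQT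
      · by_contra hcon
        exact hμ1 (hiso μ hcon hμ)
      · rintro rfl
        rw [add_sub_cancel_left, hcn] at hμ
        linarith
  have hsph : Set.EqOn (resolvent T)
      (fun μ : ℂ => (μ - 1)⁻¹ • Q + resolvent (T + c • Q) μ * (1 - Q)) (Metric.sphere 1 r) := by
    intro μ hμ
    refine (resolvent_of_eigenprojection hQ hTQ hQT (hball (Metric.sphere_subset_closedBall hμ))
      ?_).2
    rintro rfl
    rw [Metric.mem_sphere, dist_self] at hμ
    exact hr0.ne hμ
  have hcont : ContinuousOn (fun μ : ℂ => resolvent (T + c • Q) μ * (1 - Q))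
      (Metric.closedBall 1 r) := by
    have := (continuousOn_resolvent (T + c • Q)).mono hball
    fun_prop
  have hzero : (∮ μ in C(1, r), resolvent (T + c • Q) μ * (1 - Q)) = 0 := by
    apply Complex.circleIntegral_eq_zero_of_differentiable_on_off_countable hr0.le
      Set.countable_empty hcont
    intro μ hμ
    exact (spectrum.hasDerivAt_resolvent_const_left
      (hball (Metric.ball_subset_closedBall hμ.1))).differentiableAt.mul_const _
  have hci : CircleIntegrable (fun μ : ℂ => (μ - 1)⁻¹ • Q) 1 r := by
    apply ContinuousOn.circleIntegrable hr0.le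
    refine ContinuousOn.smul (ContinuousOn.inv₀ (continuousOn_id.sub continuousOn_const) ?_)
      continuousOn_const
    intro μ hμ h
    rw [show μ = 1 from sub_eq_zero.mp h, Metric.mem_sphere, dist_self] at hμ
    exact hr0.ne hμ
  unfold rieszProj
  rw [circleIntegral.integral_congr hr0.le hsph, circleIntegral.integral_add hci
    ((hcont.mono Metric.sphere_subset_closedBall).circleIntegrable hr0.le), hzero, add_zero,
    circleIntegral.integral_smul_const, circleIntegral.integral_sub_center_inv _ hr0.ne',
    smul_smul, inv_mul_cancel₀ Complex.two_pi_I_ne_zero, one_smul]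

/-- First resolvent identity. -/
theorem resolvent_mul_resolvent {T : X →L[ℂ] X} {μ ν : ℂ} (hμ : μ ∈ resolventSet ℂ T)
    (hν : ν ∈ resolventSet ℂ T) (h : μ ≠ ν) :
    resolvent T μ * resolvent T ν = (μ - ν)⁻¹ • (resolvent T ν - resolvent T μ) := by
  have h1 : resolvent T μ * (algebraMap ℂ _ μ - T) = 1 := Ring.inverse_mul_cancel _ hμ
  have h2 : (algebraMap ℂ _ ν - T) * resolvent T ν = 1 := Ring.mul_inverse_cancel _ hν
  have h3 : resolvent T ν - resolvent T μ = (μ - ν) • (resolvent T μ * resolvent T ν) := by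
    calc resolvent T ν - resolvent T μ
        = resolvent T μ * (algebraMap ℂ _ μ - T) * resolvent T ν
          - resolvent T μ * ((algebraMap ℂ _ ν - T) * resolvent T ν) := by
          rw [h1, h2, one_mul, mul_one]
      _ = resolvent T μ * (algebraMap ℂ _ μ - algebraMap ℂ _ ν) * resolvent T ν := by noncomm_ring
      _ = _ := by
        rw [← map_sub, Algebra.algebraMap_eq_smul_one, mul_smul_comm, mul_one, smul_mul_assoc]
  rw [h3, smul_smul, inv_mul_cancel₀ (sub_ne_zero.mpr h), one_smul]

theorem rieszProj_comm [CompleteSpace X] {T : X →L[ℂ] X} {r : ℝ} (hr : 0 < r)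
    (hs : Metric.sphere (1 : ℂ) r ⊆ resolventSet ℂ T) :
    rieszProj r T * T = T * rieszProj r T := by
  have hci : CircleIntegrable (resolvent T) 1 r :=
    ((continuousOn_resolvent T).mono hs).circleIntegrable hr.le
  have hL : (∮ μ in C(1, r), resolvent T μ) * T = ∮ μ in C(1, r), resolvent T μ * T :=
    ((ContinuousLinearMap.mul ℂ (X →L[ℂ] X)).flip T).map_circleIntegral hci
  have hR : T * (∮ μ in C(1, r), resolvent T μ) = ∮ μ in C(1, r), T * resolvent T μ :=
    (ContinuousLinearMap.mul ℂ (X →L[ℂ] X) T).map_circleIntegral hci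
  rw [rieszProj, smul_mul_assoc, mul_smul_comm, hL, hR]
  congr 1
  refine circleIntegral.integral_congr hr.le fun μ hμ => ?_
  have h1 : resolvent T μ * (algebraMap ℂ _ μ - T) = 1 := Ring.inverse_mul_cancel _ (hs hμ)
  have h2 : (algebraMap ℂ _ μ - T) * resolvent T μ = 1 := Ring.mul_inverse_cancel _ (hs hμ)
  have h3 := Algebra.commutes μ (resolvent T μ)
  rw [mul_sub] at h1
  rw [sub_mul] at h2
  have h4 := h1.trans h2.symm
  rw [h3] at h4
  exact sub_right_injective h4

end Spectral

section Spectral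

variable {X : Type*} [NormedAddCommGroup X] [NormedSpace ℂ X] [CompleteSpace X]

theorem circleIntegral_inv_sub_eq_zero {c w : ℂ} {r : ℝ} (hr : 0 ≤ r) (hw : r < ‖w - c‖) :
    (∮ z in C(c, r), (w - z)⁻¹) = 0 := by
  have hne : ∀ z ∈ Metric.closedBall c r, w - z ≠ 0 := by
    intro z hz h
    rw [Metric.mem_closedBall, dist_eq_norm, ← sub_eq_zero.mp h] at hz
    linarith
  apply Complex.circleIntegral_eq_zero_of_differentiable_on_off_countable hr Set.countable_empty
  · exact ContinuousOn.inv₀ (by fun_prop) hne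
  · intro z hz
    exact DifferentiableAt.inv (by fun_prop) (hne z (Metric.ball_subset_closedBall hz.1))

/-- The circle around `1` may be shrunk a little without changing the Riesz projection. -/
theorem exists_smaller_radius {T : X →L[ℂ] X} {r : ℝ} (hr : 0 < r)
    (hs : Metric.sphere (1 : ℂ) r ⊆ resolventSet ℂ T) :
    ∃ s, 0 < s ∧ s < r ∧ Metric.sphere (1 : ℂ) s ⊆ resolventSet ℂ T ∧
      rieszProj s T = rieszProj r T := by
  obtain ⟨δ, hδ, hsub⟩ := (isCompact_sphere (1 : ℂ) r).exists_cthickening_subset_open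
    (spectrum.isOpen_resolventSet T) hs
  -- `r / 2` keeps the radius positive, `r - δ` keeps the annulus inside the `δ`-thickening of the
  -- circle.
  set s := max (r / 2) (r - δ) with hsdef
  have hs0 : 0 < s := lt_max_of_lt_left (by positivity)
  have hsr : s < r := max_lt (by linarith) (by linarith)
  have hann : ∀ μ : ℂ, s ≤ ‖μ - 1‖ → ‖μ - 1‖ ≤ r → μ ∈ resolventSet ℂ T := by
    intro μ h1 h2
    apply hsub
    have hpos : 0 < ‖μ - 1‖ := hs0.trans_le h1
    -- The witness is the radial projection of `μ` onto the circle, at distance `r - ‖μ - 1‖`.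
    refine Metric.mem_cthickening_of_dist_le μ (1 + ((r / ‖μ - 1‖ : ℝ) : ℂ) * (μ - 1)) δ _ ?_ ?_
    · rw [Metric.mem_sphere, dist_eq_norm, add_sub_cancel_left, norm_mul, Complex.norm_real,
        Real.norm_of_nonneg (by positivity), div_mul_cancel₀ _ hpos.ne']
    · rw [dist_eq_norm]
      have : μ - (1 + ((r / ‖μ - 1‖ : ℝ) : ℂ) * (μ - 1))
          = ((1 - r / ‖μ - 1‖ : ℝ) : ℂ) * (μ - 1) := by push_cast; ring
      rw [this, norm_mul, Complex.norm_real, Real.norm_of_nonpos, neg_mul, sub_mul,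
        div_mul_cancel₀ _ hpos.ne', one_mul]
      · linarith [le_max_right (r / 2) (r - δ)]
      · rw [sub_nonpos, one_le_div hpos]; exact h2
  refine ⟨s, hs0, hsr, fun μ hμ => ?_, ?_⟩
  · rw [Metric.mem_sphere, dist_eq_norm] at hμ
    exact hann μ hμ.ge (hμ.le.trans hsr.le)
  · rw [rieszProj, rieszProj]
    congr 1
    symm
    apply Complex.circleIntegral_eq_of_differentiable_on_annulus_off_countable hs0 hsr.le
      Set.countable_empty
    · refine (continuousOn_resolvent T).mono fun μ hμ => ?_
      have h1 := hμ.1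
      have h2 := hμ.2
      rw [Metric.mem_closedBall, dist_eq_norm] at h1
      rw [Metric.mem_ball, dist_eq_norm, not_lt] at h2
      exact hann μ h2 h1
    · intro μ hμ
      have h1 := hμ.1.1
      have h2 := hμ.1.2
      rw [Metric.mem_ball, dist_eq_norm] at h1
      rw [Metric.mem_closedBall, dist_eq_norm, not_le] at h2
      exact (spectrum.hasDerivAt_resolvent_const_left (hann μ h2.le h1.le)).differentiableAt

/-- If `R` satisfies the resolvent identity then its integral over a circle, times its integral
over a smaller concentric circle, is `2πi` times the latter. -/
theorem circleIntegral_mul_circleIntegral {A : Type*} [NormedRing A] [NormedAlgebra ℂ A]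
    [CompleteSpace A] {R : ℂ → A} {c : ℂ} {r s : ℝ} (hs : 0 < s) (hsr : s < r)
    (hcr : ContinuousOn R (Metric.sphere c r)) (hcs : ContinuousOn R (Metric.sphere c s))
    (hR : ∀ z ∈ Metric.sphere c r, ∀ w ∈ Metric.sphere c s,
      R z * R w = (z - w)⁻¹ • (R w - R z)) :
    (∮ z in C(c, r), R z) * (∮ w in C(c, s), R w)
      = (2 * Real.pi * Complex.I : ℂ) • ∮ w in C(c, s), R w := by
  have hr : 0 < r := hs.trans hsr
  have hir : CircleIntegrable R c r := hcr.circleIntegrable hr.le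
  have his : CircleIntegrable R c s := hcs.circleIntegrable hs.le
  have hne : ∀ z ∈ Metric.sphere c r, ∀ w ∈ Metric.sphere c s, z - w ≠ 0 := by
    intro z hz w hw h
    rw [Metric.mem_sphere] at hz hw
    rw [sub_eq_zero.mp h] at hz
    linarith
  have e1 : (∮ z in C(c, r), R z) * (∮ w in C(c, s), R w)
      = ∮ z in C(c, r), R z * ∮ w in C(c, s), R w :=
    ((ContinuousLinearMap.mul ℂ A).flip _).map_circleIntegral hir
  have hcw : ∀ z ∈ Metric.sphere c r, ContinuousOn (fun w => (z - w)⁻¹) (Metric.sphere c s) :=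
    fun z hz => ContinuousOn.inv₀ (by fun_prop) (hne z hz)
  have e2 : ∀ z ∈ Metric.sphere c r, R z * (∮ w in C(c, s), R w)
      = ∮ w in C(c, s), (z - w)⁻¹ • R w := by
    intro z hz
    have hz' : s < ‖z - c‖ := by
      rw [Metric.mem_sphere, dist_eq_norm] at hz; rw [hz]; exact hsr
    have h3 : R z * (∮ w in C(c, s), R w) = ∮ w in C(c, s), R z * R w :=
      (ContinuousLinearMap.mul ℂ A (R z)).map_circleIntegral his
    have h4 : Set.EqOn (fun w => R z * R w) (fun w => (z - w)⁻¹ • R w - (z - w)⁻¹ • R z)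
        (Metric.sphere c s) := fun w hw => by
      dsimp only
      rw [hR z hz w hw, smul_sub]
    have i1 : CircleIntegrable (fun w => (z - w)⁻¹ • R w) c s :=
      ((hcw z hz).smul hcs).circleIntegrable hs.le
    have i2 : CircleIntegrable (fun w => (z - w)⁻¹ • R z) c s :=
      ((hcw z hz).smul continuousOn_const).circleIntegrable hs.le
    rw [h3, circleIntegral.integral_congr hs.le h4, circleIntegral.integral_sub i1 i2,
      circleIntegral.integral_smul_const, circleIntegral_inv_sub_eq_zero hs.le hz', zero_smul,
      sub_zero]
  have e3 : (∮ z in C(c, r), ∮ w in C(c, s), (z - w)⁻¹ • R w)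
      = ∮ w in C(c, s), ∮ z in C(c, r), (z - w)⁻¹ • R w := by
    refine circleIntegral_swap hr.le hs.le ?_
    have h1 : ContinuousOn (fun x : ℂ × ℂ => (x.1 - x.2)⁻¹)
        (Metric.sphere c r ×ˢ Metric.sphere c s) :=
      ContinuousOn.inv₀ (by fun_prop) fun x hx => hne _ hx.1 _ hx.2
    have h2 : ContinuousOn (fun x : ℂ × ℂ => R x.2) (Metric.sphere c r ×ˢ Metric.sphere c s) :=
      hcs.comp continuousOn_snd fun x hx => hx.2
    exact h1.smul h2
  have e4 : ∀ w ∈ Metric.sphere c s, (∮ z in C(c, r), (z - w)⁻¹ • R w)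
      = (2 * Real.pi * Complex.I : ℂ) • R w := by
    intro w hw
    have hw' : w ∈ Metric.ball c r := by
      rw [Metric.mem_sphere] at hw; rw [Metric.mem_ball, hw]; exact hsr
    rw [circleIntegral.integral_smul_const, circleIntegral.integral_sub_inv_of_mem_ball hw']
  rw [e1, circleIntegral.integral_congr hr.le e2, e3, circleIntegral.integral_congr hs.le e4,
    circleIntegral.integral_smul]

/-- On a single circle the factor `(μ - ν)⁻¹` of the resolvent identity is singular, so one copy of
the projection is computed on a slightly smaller circle. -/
theorem rieszProj_mul_self {T : X →L[ℂ] X} {r : ℝ} (hr : 0 < r)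
    (hs : Metric.sphere (1 : ℂ) r ⊆ resolventSet ℂ T) :
    rieszProj r T * rieszProj r T = rieszProj r T := by
  obtain ⟨s, hs0, hsr, hss, heq⟩ := exists_smaller_radius hr hs
  have key := circleIntegral_mul_circleIntegral hs0 hsr ((continuousOn_resolvent T).mono hs)
    ((continuousOn_resolvent T).mono hss) fun z hz w hw => by
      refine resolvent_mul_resolvent (hs hz) (hss hw) ?_
      rintro rfl
      rw [Metric.mem_sphere] at hz hw
      linarith
  have h2 : rieszProj r T * rieszProj s T = rieszProj s T := by
    simp only [rieszProj]
    rw [smul_mul_assoc, mul_smul_comm, key, smul_smul (2 * Real.pi * Complex.I : ℂ)⁻¹ (2 * _ * _),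
      inv_mul_cancel₀ Complex.two_pi_I_ne_zero, one_smul]
  rwa [heq] at h2

/-- The Riesz projection depends continuously on the operator. -/
theorem tendsto_rieszProj {ι : Type*} {l : Filter ι} [l.IsCountablyGenerated]
    {A : ι → X →L[ℂ] X} {T : X →L[ℂ] X} {r : ℝ} (hr : 0 < r)
    (hs : Metric.sphere (1 : ℂ) r ⊆ resolventSet ℂ T) (hA : Tendsto A l (𝓝 T)) :
    (∀ᶠ i in l, Metric.sphere (1 : ℂ) r ⊆ resolventSet ℂ (A i)) ∧
      Tendsto (fun i => rieszProj r (A i)) l (𝓝 (rieszProj r T)) := by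
  set U : Set ((X →L[ℂ] X) × ℂ) := {q | IsUnit (algebraMap ℂ (X →L[ℂ] X) q.2 - q.1)} with hU
  have hcont : Continuous fun q : (X →L[ℂ] X) × ℂ => algebraMap ℂ (X →L[ℂ] X) q.2 - q.1 := by
    have := continuous_algebraMap ℂ (X →L[ℂ] X)
    fun_prop
  have hUo : IsOpen U := Units.isOpen.preimage hcont
  have hres : ∀ q ∈ U, ContinuousAt (fun q : (X →L[ℂ] X) × ℂ => resolvent q.1 q.2) q := by
    intro q hq
    have h := NormedRing.inverse_continuousAt (IsUnit.unit hq)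
    exact ContinuousAt.comp (f := fun q : (X →L[ℂ] X) × ℂ => algebraMap ℂ (X →L[ℂ] X) q.2 - q.1)
      (g := Ring.inverse) h hcont.continuousAt
  have hloc : ∀ μ ∈ Metric.sphere (1 : ℂ) r, ∀ᶠ q in 𝓝 (T, μ), q ∈ U := fun μ hμ =>
    hUo.mem_nhds (hs hμ)
  -- Compactness of the circle makes the neighbourhood of `T` independent of `μ`; the same argument
  -- below gives uniform convergence of the resolvents.
  have hev : ∀ᶠ S in 𝓝 T, ∀ μ ∈ Metric.sphere (1 : ℂ) r, (S, μ) ∈ U :=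
    (isCompact_sphere (1 : ℂ) r).eventually_forall_of_forall_eventually hloc
  have hev' : ∀ᶠ i in l, Metric.sphere (1 : ℂ) r ⊆ resolventSet ℂ (A i) := hA.eventually hev
  refine ⟨hev', ?_⟩
  refine (TendstoUniformlyOn.tendsto_circleIntegral_of_continuousOn hr.le
    (hev'.mono fun i hi => (continuousOn_resolvent (A i)).mono hi) ?_).const_smul _
  rw [Metric.tendstoUniformlyOn_iff]
  intro ε hε
  have h2 : ∀ μ ∈ Metric.sphere (1 : ℂ) r, ∀ᶠ q in 𝓝 (T, μ),
      dist (resolvent T q.2) (resolvent q.1 q.2) < ε := by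
    intro μ hμ
    have hq : (T, μ) ∈ U := hs hμ
    have c1 := hres _ hq
    have c2 : ContinuousAt (fun q : (X →L[ℂ] X) × ℂ => resolvent T q.2) (T, μ) :=
      ContinuousAt.comp (f := fun q : (X →L[ℂ] X) × ℂ => (T, q.2)) (x := (T, μ)) c1
        (by fun_prop)
    have c3 := (c2.dist c1)
    have h0 : dist (resolvent T μ) (resolvent T μ) < ε := by simpa using hε
    exact c3.eventually (gt_mem_nhds h0)
  have h3 : ∀ᶠ S in 𝓝 T, ∀ μ ∈ Metric.sphere (1 : ℂ) r,
      dist (resolvent T μ) (resolvent S μ) < ε :=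
    (isCompact_sphere (1 : ℂ) r).eventually_forall_of_forall_eventually h2
  exact hA.eventually h3

end Spectral

/-! ### Semisimple eigenvalues of compact operators and the reduced operator. -/

section Spectral

variable {X : Type*} [NormedAddCommGroup X] [NormedSpace ℂ X]

/-- The operator `x ↦ ∑ⱼ ℓⱼ(x) ψⱼ`. -/
noncomputable def finiteRank {n : ℕ} (ψ : Fin n → X) (l : Fin n → X →L[ℂ] ℂ) : X →L[ℂ] X :=
  ∑ j, (l j).smulRight (ψ j)

theorem finiteRank_apply {n : ℕ} (ψ : Fin n → X) (l : Fin n → X →L[ℂ] ℂ) (x : X) :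
    finiteRank ψ l x = ∑ j, l j x • ψ j := by
  simp [finiteRank]

theorem isCompactOperator_finiteRank {n : ℕ} (ψ : Fin n → X) (l : Fin n → X →L[ℂ] ℂ) :
    IsCompactOperator (finiteRank ψ l) := by
  have h : ∀ s : Finset (Fin n), IsCompactOperator (∑ j ∈ s, (l j).smulRight (ψ j) : X →L[ℂ] X) := by
    intro s
    induction s using Finset.induction_on with
    | empty => simpa using isCompactOperator_zero
    | insert a s ha ih =>
      rw [Finset.sum_insert ha]
      refine IsCompactOperator.add ?_ ih
      have h1 : IsCompactOperator (ContinuousLinearMap.toSpanSingleton ℂ (ψ a)) :=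
        isCompactOperator_of_locallyCompactSpace_rng _
      exact h1.comp_clm (l a)
  exact h _


/-- Fredholm alternative: if `A` is compact and `1 - A` is injective, `1 - A` is invertible. -/
theorem isUnit_one_sub_of_isCompactOperator [CompleteSpace X] {A : X →L[ℂ] X} (hA : IsCompactOperator A)
    (hinj : ∀ x, A x = x → x = 0) : IsUnit (1 - A) := by
  rcases hA.hasEigenvalue_or_mem_resolventSet (one_ne_zero (α := ℂ)) with h | h
  · obtain ⟨x, hx⟩ := h.exists_hasEigenvector
    exact absurd (hinj x (by simpa using hx.apply_eq_smul)) hx.2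
  · simpa [spectrum.mem_resolventSet_iff] using h

/-- `T` is a compact operator for which `1` is a semisimple eigenvalue with eigenvectors `ψ` and
dual eigenvectors `l`. -/
structure SemisimpleAtOne {n : ℕ} (T : X →L[ℂ] X) (ψ : Fin n → X) (l : Fin n → X →L[ℂ] ℂ) :
    Prop where
  compact : IsCompactOperator T
  apply_vec : ∀ j, T (ψ j) = ψ j
  dual_apply : ∀ i x, l i (T x) = l i x
  biorth : ∀ i j, l i (ψ j) = if i = j then 1 else 0
  ker_le : ∀ x, T x = x → x ∈ Submodule.span ℂ (Set.range ψ)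

namespace SemisimpleAtOne

variable {n : ℕ} {T : X →L[ℂ] X} {ψ : Fin n → X} {l : Fin n → X →L[ℂ] ℂ}

theorem finiteRank_vec (h : SemisimpleAtOne T ψ l) (j : Fin n) : finiteRank ψ l (ψ j) = ψ j := by
  simp [finiteRank_apply, h.biorth]

theorem finiteRank_of_fixed (h : SemisimpleAtOne T ψ l) {x : X} (hx : T x = x) :
    finiteRank ψ l x = x := by
  have h1 : Submodule.span ℂ (Set.range ψ)
      ≤ LinearMap.eqLocus (finiteRank ψ l : X →ₗ[ℂ] X) LinearMap.id := by
    rw [Submodule.span_le]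
    rintro _ ⟨j, rfl⟩
    exact h.finiteRank_vec j
  exact h1 (h.ker_le x hx)

theorem finiteRank_mul_self (h : SemisimpleAtOne T ψ l) :
    finiteRank ψ l * finiteRank ψ l = finiteRank ψ l := by
  ext x
  simp only [mul_apply_eq_comp]
  conv_lhs => rw [finiteRank_apply ψ l x, map_sum]
  simp only [map_smul, h.finiteRank_vec]
  rw [← finiteRank_apply]

theorem mul_finiteRank (h : SemisimpleAtOne T ψ l) : T * finiteRank ψ l = finiteRank ψ l := by
  ext x
  simp [finiteRank_apply, h.apply_vec]

theorem finiteRank_mul (h : SemisimpleAtOne T ψ l) : finiteRank ψ l * T = finiteRank ψ l := by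
  ext x
  simp [finiteRank_apply, h.dual_apply]

/-- Apply `Q = ∑ ψⱼ ⊗ lⱼ` to `Tx + cQx = x`: since `QT = Q` this forces `Qx = 0`, so `Tx = x`, and
`Q` fixes every fixed vector, whence `x = Qx = 0`. The Fredholm alternative does the rest. -/
theorem one_mem_resolventSet [CompleteSpace X] (h : SemisimpleAtOne T ψ l) {c : ℂ} (hc : c ≠ 0) :
    (1 : ℂ) ∈ resolventSet ℂ (T + c • finiteRank ψ l) := by
  rw [spectrum.mem_resolventSet_iff, map_one]
  apply isUnit_one_sub_of_isCompactOperator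
  · exact h.compact.add ((isCompactOperator_finiteRank ψ l).smul c)
  · intro x hx
    set Q := finiteRank ψ l with hQ
    have h1 : Q (T x) = Q x := DFunLike.congr_fun h.finiteRank_mul x
    have h2 : Q (Q x) = Q x := DFunLike.congr_fun h.finiteRank_mul_self x
    simp only [add_apply, smul_apply] at hx
    have h3 : Q x + c • Q x = Q x := by
      conv_rhs => rw [← hx]
      rw [map_add, map_smul, h1, h2]
    have h4 : Q x = 0 := by
      have : c • Q x = 0 := by simpa using h3
      exact (smul_eq_zero.mp this).resolve_left hc
    rw [h4, smul_zero, add_zero] at hx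
    rw [← h.finiteRank_of_fixed hx, ← hQ, h4]

theorem exists_isolates [CompleteSpace X] (h : SemisimpleAtOne T ψ l) : ∃ r, Isolates r T := by
  obtain ⟨r, hr, hsub⟩ := Metric.nhds_basis_closedBall.mem_iff.mp
    ((spectrum.isOpen_resolventSet (𝕜 := ℂ) (T + (1 : ℂ) • finiteRank ψ l)).mem_nhds
      (h.one_mem_resolventSet one_ne_zero))
  refine ⟨r, hr, fun μ hμ hμr => ?_⟩
  by_contra hne
  refine hμ (resolvent_of_eigenprojection h.finiteRank_mul_self h.mul_finiteRank h.finiteRank_mul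
    (hsub ?_) hne).1
  rwa [Metric.mem_closedBall, dist_eq_norm]

theorem rieszProj_eq [CompleteSpace X] (h : SemisimpleAtOne T ψ l) {r : ℝ} (hr : Isolates r T) :
    rieszProj r T = finiteRank ψ l :=
  rieszProj_eq_eigenprojection h.finiteRank_mul_self h.mul_finiteRank h.finiteRank_mul
    (fun _ hc => h.one_mem_resolventSet hc) hr

end SemisimpleAtOne

theorem Isolates.sphere_subset {r : ℝ} {T : X →L[ℂ] X} (h : Isolates r T) :
    Metric.sphere (1 : ℂ) r ⊆ resolventSet ℂ T := by
  intro μ hμ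
  by_contra hcon
  rw [Metric.mem_sphere, dist_eq_norm] at hμ
  have := h.2 μ hcon hμ.le
  rw [this, sub_self, norm_zero] at hμ
  exact h.1.ne hμ

/-- Vectors in the range of an idempotent close to `Q` are not annihilated by `Q`. -/
theorem eq_zero_of_idempotent_of_norm_sub_lt {P Q : X →L[ℂ] X} (hPQ : ‖P - Q‖ < 1) {x : X}
    (hx : P x = x) (hQ : Q x = 0) : x = 0 := by
  by_contra hne
  have h1 : ‖x‖ ≤ ‖P - Q‖ * ‖x‖ := by
    have := (P - Q).le_opNorm x
    rwa [sub_apply, hx, hQ, sub_zero] at this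
  have h2 : 0 < ‖x‖ := norm_pos_iff.mpr hne
  nlinarith

variable {n : ℕ}

/-- If `P` is an idempotent close to `∑ ψⱼ ⊗ lⱼ`, then the vectors `P ψⱼ` form a basis of its
range. -/
theorem exists_basis_range [CompleteSpace X] {P : X →L[ℂ] X} {ψ : Fin n → X} {l : Fin n → X →L[ℂ] ℂ}
    (hP : P * P = P) (hbi : ∀ i j, l i (ψ j) = if i = j then 1 else 0)
    (hPQ : ‖P - finiteRank ψ l‖ < 1) :
    ∃ b : Module.Basis (Fin n) ℂ (LinearMap.range (P : X →ₗ[ℂ] X)),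
      ∀ j, (b j : X) = P (ψ j) := by
  set V := LinearMap.range (P : X →ₗ[ℂ] X) with hV
  have hPV : ∀ x ∈ V, P x = x := by
    rintro _ ⟨y, rfl⟩
    exact DFunLike.congr_fun hP y
  -- Closeness is used twice: the `lᵢ` separate points of the range, which bounds its dimension by
  -- `n`, and the vectors `P ψⱼ` are independent, which gives at least `n`.
  let Λ : V →ₗ[ℂ] (Fin n → ℂ) := LinearMap.pi fun i => (l i : X →ₗ[ℂ] ℂ) ∘ₗ V.subtype
  have hΛ : Function.Injective Λ := by
    rw [← LinearMap.ker_eq_bot, LinearMap.ker_eq_bot']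
    intro x hx
    have h1 : ∀ i, l i x = 0 := fun i => congr_fun hx i
    have h2 : finiteRank ψ l x = 0 := by simp [finiteRank_apply, h1]
    exact Subtype.ext (eq_zero_of_idempotent_of_norm_sub_lt hPQ (hPV x x.2) h2)
  have : FiniteDimensional ℂ V := Module.Finite.of_injective Λ hΛ
  have hle : Module.finrank ℂ V ≤ n := by
    simpa using LinearMap.finrank_le_finrank_of_injective hΛ
  let v : Fin n → V := fun j => ⟨P (ψ j), ψ j, rfl⟩
  have hli : LinearIndependent ℂ v := by
    rw [Fintype.linearIndependent_iff]
    intro g hg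
    set y := ∑ j, g j • ψ j with hy
    have hPy : P y = 0 := by
      have := congr_arg (fun x : V => (x : X)) hg
      simpa [v, hy, map_sum] using this
    have hQy : finiteRank ψ l y = y := by
      simp [hy, finiteRank_apply, hbi]
    have hy0 : y = 0 :=
      eq_zero_of_idempotent_of_norm_sub_lt (P := finiteRank ψ l) (Q := P)
        (by rwa [norm_sub_rev]) hQy hPy
    intro i
    have : l i y = 0 := by rw [hy0, map_zero]
    simpa [hy, hbi] using this
  have hge : n ≤ Module.finrank ℂ V := by simpa using hli.fintype_card_le_finrank
  exact ⟨basisOfLinearIndependentOfCardEqFinrank' v hli (by simpa using le_antisymm hge hle),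
    fun j => by simp [v]⟩

/-- The matrix `lᵢ(R bⱼ)` is the Gram matrix `lᵢ(bₖ)` times the matrix of `R`. This gives `det R`
without a dual basis of the range, which varies with the parameters. -/
theorem det_mul_det_of_basis {V : Type*} [AddCommGroup V] [Module ℂ V]
    (b : Module.Basis (Fin n) ℂ V) (l : Fin n → V →ₗ[ℂ] ℂ) (R : V →ₗ[ℂ] V) :
    (Matrix.of fun i j => l i (b j)).det * LinearMap.det R
      = (Matrix.of fun i j => l i (R (b j))).det := by
  rw [← LinearMap.det_toMatrix b R, ← Matrix.det_mul]
  congr 1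
  ext i j
  rw [Matrix.mul_apply]
  conv_rhs => rw [Matrix.of_apply, ← b.sum_repr (R (b j)), map_sum]
  refine Finset.sum_congr rfl fun k _ => ?_
  rw [Matrix.of_apply, LinearMap.toMatrix_apply, map_smul, smul_eq_mul, mul_comm]

/-- The Riesz projection commutes with `A`, so the outer `P` in `P(I - A)P` acts trivially. -/
theorem reduced_apply [CompleteSpace X] {r : ℝ} {A : X →L[ℂ] X} (hr : 0 < r)
    (hs : Metric.sphere (1 : ℂ) r ⊆ resolventSet ℂ A) (x : rieszRange r A) :
    (reduced r A x : X) = x - A x := by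
  obtain ⟨_, y, rfl⟩ := x
  have h1 : rieszProj r A (A (rieszProj r A y)) = A (rieszProj r A y) := by
    have e1 := DFunLike.congr_fun (rieszProj_comm hr hs) (rieszProj r A y)
    have e2 := DFunLike.congr_fun (rieszProj_mul_self hr hs) y
    simp only [mul_apply_eq_comp] at e1 e2
    rw [e1, e2]
  have h2 : rieszProj r A (rieszProj r A y) = rieszProj r A y :=
    DFunLike.congr_fun (rieszProj_mul_self hr hs) y
  change rieszProj r A ((1 - A) (rieszProj r A y)) = rieszProj r A y - A (rieszProj r A y)
  rw [sub_apply, one_apply_eq_self, map_sub, h1, h2]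

/-- Fixed vectors of `A` lie in the range of the Riesz projection. -/
theorem rieszProj_of_fixed [CompleteSpace X] {r : ℝ} {A : X →L[ℂ] X} (hr : 0 < r)
    (hs : Metric.sphere (1 : ℂ) r ⊆ resolventSet ℂ A) {x : X} (hx : A x = x) :
    rieszProj r A x = x := by
  have hci : CircleIntegrable (resolvent A) 1 r :=
    ((continuousOn_resolvent A).mono hs).circleIntegrable hr.le
  have e1 : (∮ μ in C(1, r), resolvent A μ) x = ∮ μ in C(1, r), resolvent A μ x :=
    (ContinuousLinearMap.apply ℂ X x).map_circleIntegral hci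
  have e2 : ∀ μ ∈ Metric.sphere (1 : ℂ) r, resolvent A μ x = (μ - 1)⁻¹ • x := by
    intro μ hμ
    have h1 : resolvent A μ * (algebraMap ℂ _ μ - A) = 1 := Ring.inverse_mul_cancel _ (hs hμ)
    have h2 := DFunLike.congr_fun h1 x
    have hμ1 : μ - 1 ≠ 0 := by
      intro h
      rw [sub_eq_zero.mp h, Metric.mem_sphere, dist_self] at hμ
      exact hr.ne hμ
    have h3 : (algebraMap ℂ (X →L[ℂ] X) μ - A) x = (μ - 1) • x := by
      rw [sub_apply, hx, Algebra.algebraMap_eq_smul_one, sub_smul, one_smul]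
      rfl
    rw [mul_apply_eq_comp, h3, map_smul, one_apply_eq_self] at h2
    conv_rhs => rw [← h2]
    rw [smul_smul, inv_mul_cancel₀ hμ1, one_smul]
  rw [rieszProj, smul_apply, e1, circleIntegral.integral_congr hr.le e2,
    circleIntegral.integral_smul_const, circleIntegral.integral_sub_center_inv _ hr.ne',
    smul_smul, inv_mul_cancel₀ Complex.two_pi_I_ne_zero, one_smul]

/-- If the reduced determinant does not vanish then `1 - A` is invertible. -/
theorem isUnit_of_det_reduced_ne_zero [CompleteSpace X] {r : ℝ} {A : X →L[ℂ] X} (hA : IsCompactOperator A)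
    (hr : 0 < r) (hs : Metric.sphere (1 : ℂ) r ⊆ resolventSet ℂ A)
    (hfin : 0 < Module.finrank ℂ (rieszRange r A)) (hdet : LinearMap.det (reduced r A) ≠ 0) : IsUnit (1 - A) := by
  have : FiniteDimensional ℂ (rieszRange r A) := Module.finite_of_finrank_pos hfin
  refine isUnit_one_sub_of_isCompactOperator hA fun x hx => ?_
  have h1 := rieszProj_of_fixed hr hs hx
  -- A fixed vector lies in the range of `P` and is killed by the reduced operator, which a nonzero
  -- determinant makes injective.
  have hmem : x ∈ rieszRange r A := ⟨x, h1⟩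
  have h2 : reduced r A ⟨x, hmem⟩ = 0 := Subtype.ext (by
    rw [reduced_apply hr hs]; simp [hx])
  have h3 : IsUnit (LinearMap.det (reduced r A)) := isUnit_iff_ne_zero.mpr hdet
  have h4 := LinearMap.ker_eq_bot'.mp (LinearMap.ker_eq_bot_of_injective
    ((LinearMap.equivOfDetNeZero _ hdet).injective)) ⟨x, hmem⟩ h2
  exact congr_arg Subtype.val h4

end Spectral

/-! ### Perturbation expansion of the reduced determinant. -/

section Spectral

variable {X : Type*} [NormedAddCommGroup X] [NormedSpace ℂ X] [CompleteSpace X]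

/-- The Riesz projections of a perturbation of `T` eventually have rank `n`, and the determinant of
the reduced operator is a quotient of two `n × n` determinants. -/
theorem SemisimpleAtOne.eventually_det_reduced {n : ℕ} {T : X →L[ℂ] X} {ψ : Fin n → X}
    {l : Fin n → X →L[ℂ] ℂ} (h : SemisimpleAtOne T ψ l) {ι : Type*} {f : Filter ι}
    [f.IsCountablyGenerated] {A : ι → X →L[ℂ] X} (hA : Tendsto A f (𝓝 T)) {r : ℝ}
    (hr : Isolates r T) :
    (∀ᶠ x in f, Metric.sphere (1 : ℂ) r ⊆ resolventSet ℂ (A x)) ∧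
    (∀ᶠ x in f, Module.finrank ℂ (rieszRange r (A x)) = n) ∧
    (∀ᶠ x in f, (Matrix.of fun i j => l i (rieszProj r (A x) (ψ j))).det *
        LinearMap.det (reduced r (A x))
      = (Matrix.of fun i j => l i ((T - A x) (rieszProj r (A x) (ψ j)))).det) := by
  obtain ⟨hs, hP⟩ := tendsto_rieszProj hr.1 hr.sphere_subset hA
  rw [h.rieszProj_eq hr] at hP
  have hclose : ∀ᶠ x in f, ‖rieszProj r (A x) - finiteRank ψ l‖ < 1 := by
    have := hP.sub_const (finiteRank ψ l)
    rw [sub_self] at this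
    exact this.norm.eventually (gt_mem_nhds (by simp))
  have hb : ∀ᶠ x in f, Metric.sphere (1 : ℂ) r ⊆ resolventSet ℂ (A x) ∧
      ∃ b : Module.Basis (Fin n) ℂ (rieszRange r (A x)),
        ∀ j, (b j : X) = rieszProj r (A x) (ψ j) := by
    filter_upwards [hs, hclose] with x h1 h2
    exact ⟨h1, exists_basis_range (rieszProj_mul_self hr.1 h1) h.biorth h2⟩
  refine ⟨hs, hb.mono fun x hx => ?_, hb.mono fun x hx => ?_⟩
  · obtain ⟨-, b, -⟩ := hx
    simpa using Module.finrank_eq_card_basis b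
  · obtain ⟨h1, b, hbj⟩ := hx
    have := det_mul_det_of_basis b
      (fun i => (l i : X →ₗ[ℂ] ℂ) ∘ₗ (rieszRange r (A x)).subtype) (reduced r (A x))
    have e1 : ∀ i j, ((l i : X →ₗ[ℂ] ℂ) ∘ₗ (rieszRange r (A x)).subtype) (b j)
        = l i (rieszProj r (A x) (ψ j)) := fun i j => by simp [hbj]
    -- Since `lᵢ ∘ T = lᵢ`, the functional `lᵢ ∘ (1 - A)` equals `lᵢ ∘ (T - A)`, which is small with
    -- the perturbation.
    have e2 : ∀ i j, ((l i : X →ₗ[ℂ] ℂ) ∘ₗ (rieszRange r (A x)).subtype) (reduced r (A x) (b j))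
        = l i ((T - A x) (rieszProj r (A x) (ψ j))) := fun i j => by
      simp only [LinearMap.comp_apply, Submodule.subtype_apply, ContinuousLinearMap.coe_coe,
        reduced_apply hr.1 h1, hbj, map_sub, sub_apply, h.dual_apply]
    simp only [e1, e2] at this
    exact this

/-- Second-order expansion of the reduced determinant for a two-dimensional eigenspace. -/
theorem SemisimpleAtOne.det_reduced_isLittleO {T : X →L[ℂ] X} {ψ : Fin 2 → X}
    {l : Fin 2 → X →L[ℂ] ℂ} (h : SemisimpleAtOne T ψ l) {ι : Type*} {f : Filter ι}
    [f.IsCountablyGenerated] {A : ι → X →L[ℂ] X} {N : ι → ℝ} (hN : Tendsto N f (𝓝 0))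
    (hA : (fun x => A x - T) =O[f] N) {M : Fin 2 → Fin 2 → ι → ℂ}
    (hM : ∀ i j, (fun x => l i ((T - A x) (ψ j)) - M i j x) =o[f] N)
    {r : ℝ} (hr : Isolates r T) :
    (fun x => LinearMap.det (reduced r (A x)) - (M 0 0 x * M 1 1 x - M 0 1 x * M 1 0 x))
      =o[f] fun x => N x * N x := by
  have hA0 : Tendsto A f (𝓝 T) := by
    rw [← tendsto_sub_nhds_zero_iff]
    exact hA.trans_tendsto hN
  obtain ⟨-, -, hdet⟩ := h.eventually_det_reduced hA0 hr
  have hP := (tendsto_rieszProj hr.1 hr.sphere_subset hA0).2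
  rw [h.rieszProj_eq hr] at hP
  have hPψ : ∀ j, Tendsto (fun x => rieszProj r (A x) (ψ j)) f (𝓝 (ψ j)) := by
    intro j
    have := ((ContinuousLinearMap.apply ℂ X (ψ j)).continuous.tendsto _).comp hP
    simpa [h.finiteRank_vec, Function.comp_def] using this
  set a : Fin 2 → Fin 2 → ι → ℂ := fun i j x => l i ((T - A x) (rieszProj r (A x) (ψ j))) with ha
  set g : Fin 2 → Fin 2 → ι → ℂ := fun i j x => l i (rieszProj r (A x) (ψ j)) with hg
  have hTA : (fun x => T - A x) =O[f] N := by
    simpa using hA.neg_left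
  have haM : ∀ i j, (fun x => a i j x - M i j x) =o[f] N := by
    intro i j
    -- Replacing `P ψⱼ` by `ψⱼ` costs a product of `T - A = O(N)` and `P ψⱼ - ψⱼ = o(1)`, so no
    -- expansion of `P` itself is needed.
    have h1 : (fun x => l i ((T - A x) (rieszProj r (A x) (ψ j) - ψ j))) =o[f] N := by
      have h2 : (fun x => rieszProj r (A x) (ψ j) - ψ j) =o[f] fun _ => (1 : ℝ) := by
        rw [isLittleO_one_iff]
        simpa using (hPψ j).sub_const (ψ j)
      have h3 : (fun x => ‖T - A x‖ * ‖rieszProj r (A x) (ψ j) - ψ j‖) =o[f] fun x => N x * 1 :=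
        hTA.norm_left.mul_isLittleO h2.norm_left
      simp only [mul_one] at h3
      refine IsBigO.trans_isLittleO (IsBigO.of_bound ‖l i‖ (Eventually.of_forall fun x => ?_)) h3
      rw [Real.norm_of_nonneg (by positivity)]
      exact ((l i).le_opNorm _).trans
        (mul_le_mul_of_nonneg_left ((T - A x).le_opNorm _) (norm_nonneg _))
    refine (h1.add (hM i j)).congr_left fun x => ?_
    simp only [ha, map_sub]
    ring
  have haO : ∀ i j, (fun x => a i j x) =O[f] N := by
    intro i j
    refine IsBigO.trans (IsBigO.of_bound (‖l i‖ * (‖ψ j‖ + 1)) ?_) hTA.norm_left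
    have h1 : ∀ᶠ x in f, ‖rieszProj r (A x) (ψ j)‖ < ‖ψ j‖ + 1 :=
      (hPψ j).norm.eventually (gt_mem_nhds (by linarith))
    filter_upwards [h1] with x hx
    rw [norm_norm]
    calc ‖a i j x‖ ≤ ‖l i‖ * (‖T - A x‖ * ‖rieszProj r (A x) (ψ j)‖) :=
          ((l i).le_opNorm _).trans
            (mul_le_mul_of_nonneg_left ((T - A x).le_opNorm _) (norm_nonneg _))
      _ ≤ ‖l i‖ * (‖T - A x‖ * (‖ψ j‖ + 1)) := by gcongr
      _ = _ := by ring
  have hMO : ∀ i j, M i j =O[f] N := by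
    intro i j
    refine ((haO i j).sub (haM i j).isBigO).congr_left fun x => by ring
  have hgt : ∀ i j, Tendsto (g i j) f (𝓝 (if i = j then 1 else 0)) := by
    intro i j
    have := ((l i).continuous.tendsto _).comp (hPψ j)
    rwa [h.biorth] at this
  -- The Gram determinant tends to `1` by biorthogonality. The numerator is `O(N²)`, so dividing by
  -- it changes the determinant only by `o(N²)`.
  set G : ι → ℂ := fun x => g 0 0 x * g 1 1 x - g 0 1 x * g 1 0 x with hG
  have hGt : Tendsto G f (𝓝 1) := by
    have := ((hgt 0 0).mul (hgt 1 1)).sub ((hgt 0 1).mul (hgt 1 0))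
    simpa using this
  have hd : ∀ᶠ x in f, LinearMap.det (reduced r (A x))
      = (a 0 0 x * a 1 1 x - a 0 1 x * a 1 0 x) * (G x)⁻¹ := by
    have hG0 : ∀ᶠ x in f, G x ≠ 0 := hGt.eventually_ne one_ne_zero
    filter_upwards [hdet, hG0] with x h1 h2
    rw [Matrix.det_fin_two, Matrix.det_fin_two] at h1
    simp only [Matrix.of_apply] at h1
    rw [eq_mul_inv_iff_mul_eq₀ h2, mul_comm]
    exact h1
  have hprod : ∀ i j i' j', (fun x => a i j x * a i' j' x - M i j x * M i' j' x)
      =o[f] fun x => N x * N x := by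
    intro i j i' j'
    refine (((haM i j).mul_isBigO (haO i' j')).add
      ((hMO i j).mul_isLittleO (haM i' j'))).congr_left fun x => by ring
  have hGi : (fun x => (G x)⁻¹ - 1) =o[f] fun _ => (1 : ℝ) := by
    rw [isLittleO_one_iff]
    have := (hGt.inv₀ one_ne_zero).sub_const 1
    simpa using this
  have hDO : (fun x => a 0 0 x * a 1 1 x - a 0 1 x * a 1 0 x) =O[f] fun x => N x * N x :=
    ((haO 0 0).mul (haO 1 1)).sub ((haO 0 1).mul (haO 1 0))
  have h1 := hDO.mul_isLittleO hGi
  simp only [mul_one] at h1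
  have h2 := (hprod 0 0 1 1).sub (hprod 0 1 1 0)
  refine (h1.add h2).congr' ?_ EventuallyEq.rfl
  filter_upwards [hd] with x hx
  rw [hx]
  ring

end Spectral

/-! ### Weights and potential estimates. -/

/-- The weight `ρ(z)^(-s)`. -/
noncomputable def wt (s : ℝ) (z : ℂ) : ℝ := rhoSq z ^ (-(s / 2))

theorem one_le_rhoSq (z : ℂ) : 1 ≤ rhoSq z := by
  unfold rhoSq; nlinarith [sq_nonneg ‖z‖]

theorem rhoSq_pos (z : ℂ) : 0 < rhoSq z := one_pos.trans_le (one_le_rhoSq z)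

theorem continuous_rhoSq : Continuous rhoSq := by unfold rhoSq; fun_prop

theorem wt_pos (s : ℝ) (z : ℂ) : 0 < wt s z := Real.rpow_pos_of_pos (rhoSq_pos z) _

theorem wt_nonneg (s : ℝ) (z : ℂ) : 0 ≤ wt s z := (wt_pos s z).le

theorem wt_zero (z : ℂ) : wt 0 z = 1 := by simp [wt]

theorem wt_add (s t : ℝ) (z : ℂ) : wt (s + t) z = wt s z * wt t z := by
  rw [wt, wt, wt, ← Real.rpow_add (rhoSq_pos z)]; ring_nf

theorem wt_anti {s t : ℝ} (h : s ≤ t) (z : ℂ) : wt t z ≤ wt s z :=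
  Real.rpow_le_rpow_of_exponent_le (one_le_rhoSq z) (by linarith)

theorem wt_le_one {s : ℝ} (h : 0 ≤ s) (z : ℂ) : wt s z ≤ 1 := (wt_anti h z).trans (wt_zero z).le

theorem wt_two (z : ℂ) : wt 2 z = (rhoSq z)⁻¹ := by
  rw [wt, show -((2 : ℝ) / 2) = -1 by norm_num, Real.rpow_neg_one]

theorem wt_le_wt {s : ℝ} (hs : 0 ≤ s) {z w : ℂ} (h : rhoSq w ≤ rhoSq z) : wt s z ≤ wt s w :=
  Real.rpow_le_rpow_of_nonpos (rhoSq_pos w) h (by linarith)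

theorem continuous_wt (s : ℝ) : Continuous (wt s) :=
  continuous_rhoSq.rpow_const fun z => Or.inl (rhoSq_pos z).ne'

theorem integrable_wt {s : ℝ} (hs : 2 < s) : Integrable (wt s) := by
  have := integrable_rpow_neg_one_add_norm_sq (E := ℂ) (μ := volume) (r := s)
    (by simpa [Complex.finrank_real_complex] using hs)
  refine this.congr (Eventually.of_forall fun z => ?_)
  simp only [wt, rhoSq, neg_div]

theorem norm_mul_wt_le (s : ℝ) (z : ℂ) : ‖z‖ * wt s z ≤ wt (s - 1) z := by
  have h1 : ‖z‖ * wt 1 z ≤ 1 := by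
    have : ‖z‖ ≤ rhoSq z ^ ((1 : ℝ) / 2) := by
      rw [← Real.sqrt_eq_rpow]
      apply Real.le_sqrt_of_sq_le
      unfold rhoSq; linarith
    rw [wt, Real.rpow_neg (rhoSq_pos z).le, ← div_eq_mul_inv,
      div_le_one (Real.rpow_pos_of_pos (rhoSq_pos z) _)]
    exact this
  calc ‖z‖ * wt s z = ‖z‖ * wt 1 z * wt (s - 1) z := by
        rw [mul_assoc, ← wt_add]; ring_nf
    _ ≤ 1 * wt (s - 1) z := by gcongr; exact wt_nonneg _ _
    _ = _ := one_mul _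

/-- The weight at the point farther from the origin is dominated by the same power at the nearer
one, so the product is at most the full weight at the nearer point. -/
theorem wt_mul_wt_le {a b : ℝ} (ha : 0 ≤ a) (hb : 0 ≤ b) (y z : ℂ) :
    wt a y * wt b z ≤ wt (a + b) y + wt (a + b) z := by
  rcases le_total (rhoSq y) (rhoSq z) with h | h
  · have := mul_le_mul_of_nonneg_left (wt_le_wt hb h) (wt_nonneg a y)
    rw [← wt_add] at this
    linarith [wt_nonneg (a + b) z]
  · have := mul_le_mul_of_nonneg_right (wt_le_wt ha h) (wt_nonneg b z)
    rw [← wt_add] at this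
    linarith [wt_nonneg (a + b) y]

theorem norm_rpow_neg_le {a : ℝ} (ha : 0 ≤ a) (ha2 : a ≤ 2) {y : ℂ} (hy : 1 ≤ ‖y‖) :
    ‖y‖ ^ (-a) ≤ 2 * wt a y := by
  have hpos : 0 < ‖y‖ := one_pos.trans_le hy
  have h1 : (2 * ‖y‖ ^ 2) ^ (-(a / 2)) ≤ wt a y := by
    apply Real.rpow_le_rpow_of_nonpos (rhoSq_pos y) _ (by linarith)
    unfold rhoSq; nlinarith
  have h2 : (2 * ‖y‖ ^ 2) ^ (-(a / 2)) = 2 ^ (-(a / 2)) * ‖y‖ ^ (-a) := by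
    rw [Real.mul_rpow (by norm_num) (by positivity), ← Real.rpow_natCast ‖y‖ 2,
      ← Real.rpow_mul hpos.le]
    congr 2; push_cast; ring
  have h3 : (2 : ℝ)⁻¹ ≤ 2 ^ (-(a / 2)) := by
    rw [← Real.rpow_neg_one]
    exact Real.rpow_le_rpow_of_exponent_le (by norm_num) (by linarith)
  have h4 : 0 ≤ ‖y‖ ^ (-a) := by positivity
  nlinarith

/-- The uniform bound for potentials of weights. -/
theorem exists_potential_bound {a b : ℝ} (ha : 0 ≤ a) (ha2 : a < 2) (hb : 0 ≤ b)
    (hab : 2 < a + b) :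
    ∃ C : ℝ, 0 ≤ C ∧ ∀ z : ℂ, Integrable (fun ζ : ℂ => ‖z - ζ‖ ^ (-a) * wt b ζ) ∧
      ∫ ζ : ℂ, ‖z - ζ‖ ^ (-a) * wt b ζ ≤ C := by
  set N : ℂ → ℝ := (Metric.ball (0 : ℂ) 1).indicator fun y => ‖y‖ ^ (-a) with hN
  have hmeas : Measurable fun y : ℂ => ‖y‖ ^ (-a) := by fun_prop
  have hNi : Integrable N := by
    rw [hN, integrable_indicator_iff Metric.isOpen_ball.measurableSet]
    refine integrableOn_ball_of_norm_le_rpow (C := 1) (α := a) (by simp)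
      (by simpa using ha2) (Eventually.of_forall fun x => ?_) hmeas.aestronglyMeasurable
    rw [one_mul, Real.norm_of_nonneg (by positivity)]
  have hJ := integrable_wt hab
  -- Within distance `1` of `z` the weight is at most `1` and the singularity is integrable because
  -- `a < 2`. Farther away the kernel is comparable with a weight, and `wt_mul_wt_le` splits the
  -- product into integrable pieces whose integrals do not depend on `z`.
  have hptw : ∀ z ζ : ℂ, ‖z - ζ‖ ^ (-a) * wt b ζ
      ≤ N (z - ζ) + 2 * (wt (a + b) (z - ζ) + wt (a + b) ζ) := by
    intro z ζ
    by_cases h : ‖z - ζ‖ < 1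
    · have e : N (z - ζ) = ‖z - ζ‖ ^ (-a) := by
        rw [hN, Set.indicator_of_mem]; simpa using h
      have h1 : ‖z - ζ‖ ^ (-a) * wt b ζ ≤ ‖z - ζ‖ ^ (-a) * 1 := by
        gcongr; exact wt_le_one hb ζ
      rw [e]
      have := wt_nonneg (a + b) (z - ζ)
      have := wt_nonneg (a + b) ζ
      linarith
    · have e : N (z - ζ) = 0 := by
        rw [hN, Set.indicator_of_notMem]; simpa using h
      have h1 := mul_le_mul_of_nonneg_right (norm_rpow_neg_le ha ha2.le (not_lt.mp h))
        (wt_nonneg b ζ)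
      have h2 := wt_mul_wt_le ha hb (z - ζ) ζ
      rw [e]
      linarith
  have hint : ∀ z : ℂ,
      Integrable fun ζ : ℂ => N (z - ζ) + 2 * (wt (a + b) (z - ζ) + wt (a + b) ζ) := fun z =>
    (hNi.comp_sub_left z).add (((hJ.comp_sub_left z).add hJ).const_mul 2)
  have hwm := (continuous_wt b).measurable
  refine ⟨(∫ y, N y) + 2 * ((∫ y, wt (a + b) y) + ∫ y, wt (a + b) y), ?_, fun z => ⟨?_, ?_⟩⟩
  · have h1 : 0 ≤ ∫ y, N y := integral_nonneg fun y => Set.indicator_nonneg (fun _ _ => by positivity) y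
    have h2 : 0 ≤ ∫ y, wt (a + b) y := integral_nonneg (wt_nonneg _)
    positivity
  · refine (hint z).mono' (by fun_prop) (Eventually.of_forall fun ζ => ?_)
    rw [Real.norm_of_nonneg (mul_nonneg (by positivity) (wt_nonneg b ζ))]
    exact hptw z ζ
  · calc ∫ ζ : ℂ, ‖z - ζ‖ ^ (-a) * wt b ζ
        ≤ ∫ ζ : ℂ, N (z - ζ) + 2 * (wt (a + b) (z - ζ) + wt (a + b) ζ) :=
          integral_mono_of_nonneg (Eventually.of_forall fun ζ =>
            mul_nonneg (by positivity) (wt_nonneg b ζ)) (hint z)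
            (Eventually.of_forall fun ζ => hptw z ζ)
      _ = _ := by
          have i1 : Integrable fun ζ => wt (a + b) (z - ζ) := hJ.comp_sub_left z
          have i2 : Integrable fun ζ => 2 * (wt (a + b) (z - ζ) + wt (a + b) ζ) :=
            (i1.add hJ).const_mul 2
          rw [integral_add (hNi.comp_sub_left z) i2, integral_const_mul, integral_add i1 hJ,
            integral_sub_left_eq_self N,
            integral_sub_left_eq_self (fun y => wt (a + b) y)]

/-- This is `ρ(z) ≤ |z - ζ| + ρ(ζ)` combined with subadditivity of `t ↦ t^s`, which holds for `s ≤
1`. -/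
theorem rhoSq_rpow_le {s : ℝ} (hs : 0 ≤ s) (hs1 : s ≤ 1) (z ζ : ℂ) :
    rhoSq z ^ (s / 2) ≤ ‖z - ζ‖ ^ s + rhoSq ζ ^ (s / 2) := by
  have hsq : ∀ z : ℂ, rhoSq z ^ (s / 2) = √(rhoSq z) ^ s := fun z => by
    rw [Real.sqrt_eq_rpow, ← Real.rpow_mul (rhoSq_pos z).le]; ring_nf
  have h1 : √(rhoSq z) ≤ ‖z - ζ‖ + √(rhoSq ζ) := by
    apply Real.sqrt_le_iff.mpr ⟨by positivity, ?_⟩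
    have h2 : ‖z‖ ≤ ‖z - ζ‖ + ‖ζ‖ := by simpa using norm_add_le (z - ζ) ζ
    have h3 : ‖ζ‖ ≤ √(rhoSq ζ) := Real.le_sqrt_of_sq_le (by unfold rhoSq; linarith)
    have h4 := Real.sq_sqrt (rhoSq_pos ζ).le
    have h5 : rhoSq ζ = 1 + ‖ζ‖ ^ 2 := rfl
    unfold rhoSq at *
    nlinarith [norm_nonneg (z - ζ), norm_nonneg ζ, norm_nonneg z]
  rw [hsq, hsq]
  exact (Real.rpow_le_rpow (by positivity) h1 hs).trans
    (Real.rpow_add_le_add_rpow (by positivity) (by positivity) hs hs1)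

/-- The Cauchy potential of `ρ^(-b)` decays like `ρ^(-s)` for `s ≤ 1`, `s < b - 1`. -/
theorem exists_cauchy_potential_decay {b s : ℝ} (hs : 0 ≤ s) (hs1 : s ≤ 1) (hsb : s + 1 < b) :
    ∃ C : ℝ, 0 ≤ C ∧ ∀ z : ℂ, Integrable (fun ζ : ℂ => ‖z - ζ‖⁻¹ * wt b ζ) ∧
      ∫ ζ : ℂ, ‖z - ζ‖⁻¹ * wt b ζ ≤ C * wt s z := by
  -- After multiplication by `ρ(z)^s` and `rhoSq_rpow_le`, the factor either weakens the kernel to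
  -- exponent `1 - s` or the weight to `b - s`. In both cases the exponents sum to more than `2`
  -- because `s + 1 < b`. The third potential only supplies integrability.
  obtain ⟨C₁, hC₁, h₁⟩ := exists_potential_bound (a := 1 - s) (b := b) (by linarith) (by linarith)
    (by linarith) (by linarith)
  obtain ⟨C₂, hC₂, h₂⟩ := exists_potential_bound (a := 1) (b := b - s) (by linarith) (by linarith)
    (by linarith) (by linarith)
  obtain ⟨C₃, hC₃, h₃⟩ := exists_potential_bound (a := 1) (b := b) (by linarith) (by linarith)
    (by linarith) (by linarith)
  simp only [Real.rpow_neg_one] at h₂ h₃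
  refine ⟨C₁ + C₂, by positivity, fun z => ⟨(h₃ z).1, ?_⟩⟩
  have hpos : 0 < rhoSq z ^ (s / 2) := Real.rpow_pos_of_pos (rhoSq_pos z) _
  have hw : wt s z = (rhoSq z ^ (s / 2))⁻¹ := by rw [wt, Real.rpow_neg (rhoSq_pos z).le]
  rw [hw, ← div_eq_mul_inv, le_div_iff₀ hpos, mul_comm, ← integral_const_mul]
  calc ∫ ζ : ℂ, rhoSq z ^ (s / 2) * (‖z - ζ‖⁻¹ * wt b ζ)
      ≤ ∫ ζ : ℂ, (‖z - ζ‖ ^ (-(1 - s)) * wt b ζ + ‖z - ζ‖⁻¹ * wt (b - s) ζ) := by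
        refine integral_mono ((h₃ z).1.const_mul _) ((h₁ z).1.add (h₂ z).1) fun ζ => ?_
        have e1 : wt (b - s) ζ = rhoSq ζ ^ (s / 2) * wt b ζ := by
          rw [wt, wt, ← Real.rpow_add (rhoSq_pos ζ)]; ring_nf
        have e2 : ‖z - ζ‖ ^ s * ‖z - ζ‖⁻¹ ≤ ‖z - ζ‖ ^ (-(1 - s)) := by
          rcases eq_or_lt_of_le (norm_nonneg (z - ζ)) with h | h
          · rw [← h, inv_zero, mul_zero]; positivity
          · rw [← Real.rpow_neg_one, ← Real.rpow_add h]
            apply le_of_eq; ring_nf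
        have e3 := mul_le_mul_of_nonneg_right (rhoSq_rpow_le hs hs1 z ζ)
          (mul_nonneg (inv_nonneg.mpr (norm_nonneg (z - ζ))) (wt_nonneg b ζ))
        have e4 := mul_le_mul_of_nonneg_right e2 (wt_nonneg b ζ)
        dsimp only
        rw [e1]
        nlinarith
    _ = (∫ ζ : ℂ, ‖z - ζ‖ ^ (-(1 - s)) * wt b ζ) + ∫ ζ : ℂ, ‖z - ζ‖⁻¹ * wt (b - s) ζ :=
        integral_add (h₁ z).1 (h₂ z).1
    _ ≤ C₁ + C₂ := add_le_add (h₁ z).2 (h₂ z).2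

/-- Differences of the Cauchy kernel. -/
theorem norm_inv_sub_inv_le (a b : ℂ) :
    ‖a⁻¹ - b⁻¹‖ ≤ 2 * ‖a - b‖ ^ ((1 : ℝ) / 2) *
      (‖a‖ ^ (-((3 : ℝ) / 2)) + ‖b‖ ^ (-((3 : ℝ) / 2))) := by
  have hsingle : ∀ c : ℂ, ‖c‖⁻¹ = ‖c‖ ^ ((1 : ℝ) / 2) * ‖c‖ ^ (-((3 : ℝ) / 2)) := by
    intro c
    rcases eq_or_lt_of_le (norm_nonneg c) with h | h
    · rw [← h, inv_zero, Real.zero_rpow (by norm_num), zero_mul]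
    · rw [← Real.rpow_add h, ← Real.rpow_neg_one]; norm_num
  have hcube : ∀ x : ℝ, 0 < x → x ^ (-((3 : ℝ) / 2)) = (√x)⁻¹ ^ 3 ∧ x⁻¹ = (√x)⁻¹ ^ 2 := by
    intro x hx
    refine ⟨?_, by rw [inv_pow, Real.sq_sqrt hx.le]⟩
    rw [Real.rpow_neg hx.le, inv_pow, Real.sqrt_eq_rpow, ← Real.rpow_natCast, ← Real.rpow_mul hx.le]
    norm_num
  rcases eq_or_ne a 0 with rfl | ha
  · have := hsingle b
    have h0 : 0 ≤ ‖b‖ ^ ((1 : ℝ) / 2) * ‖b‖ ^ (-((3 : ℝ) / 2)) := by positivity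
    rw [inv_zero, zero_sub, norm_neg, norm_inv, zero_sub, norm_neg, norm_zero,
      Real.zero_rpow (by norm_num), zero_add, this]
    linarith
  rcases eq_or_ne b 0 with rfl | hb
  · have := hsingle a
    have h0 : 0 ≤ ‖a‖ ^ ((1 : ℝ) / 2) * ‖a‖ ^ (-((3 : ℝ) / 2)) := by positivity
    rw [inv_zero, sub_zero, norm_inv, sub_zero, norm_zero, Real.zero_rpow (by norm_num), add_zero,
      this]
    linarith
  have hx : 0 < ‖a‖ := norm_pos_iff.mpr ha
  have hy : 0 < ‖b‖ := norm_pos_iff.mpr hb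
  obtain ⟨x3, x1⟩ := hcube _ hx
  obtain ⟨y3, y1⟩ := hcube _ hy
  have hd : ‖a⁻¹ - b⁻¹‖ = ‖a - b‖ * (‖a‖⁻¹ * ‖b‖⁻¹) := by
    rw [inv_sub_inv ha hb, norm_div, norm_mul, norm_sub_rev, div_eq_mul_inv, mul_inv]
  rw [hd, x3, y3, x1, y1, ← Real.sqrt_eq_rpow]
  have hX : 0 < (√‖a‖)⁻¹ := by positivity
  have hY : 0 < (√‖b‖)⁻¹ := by positivity
  -- One half power of `‖a - b‖` is kept; the other is spent here to balance the exponents of `‖a‖`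
  -- and `‖b‖`.
  have hs1 : √‖a - b‖ ≤ √‖a‖ + √‖b‖ :=
    (Real.sqrt_le_sqrt (norm_sub_le a b)).trans (Real.sqrt_le_iff.mpr ⟨by positivity, by
      nlinarith [Real.sq_sqrt hx.le, Real.sq_sqrt hy.le,
        mul_nonneg (Real.sqrt_nonneg ‖a‖) (Real.sqrt_nonneg ‖b‖)]⟩)
  have hXa : √‖a‖ * (√‖a‖)⁻¹ = 1 := mul_inv_cancel₀ (by positivity)
  have hYb : √‖b‖ * (√‖b‖)⁻¹ = 1 := mul_inv_cancel₀ (by positivity)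
  generalize (√‖a‖)⁻¹ = X at *
  generalize (√‖b‖)⁻¹ = Y at *
  have hds : ‖a - b‖ = √‖a - b‖ * √‖a - b‖ := (Real.mul_self_sqrt (norm_nonneg _)).symm
  have hD : 0 ≤ √‖a - b‖ := Real.sqrt_nonneg _
  have h2 : √‖a - b‖ * (X ^ 2 * Y ^ 2) ≤ 2 * (X ^ 3 + Y ^ 3) := by
    calc √‖a - b‖ * (X ^ 2 * Y ^ 2) ≤ (√‖a‖ + √‖b‖) * (X ^ 2 * Y ^ 2) := by gcongr
      _ = (√‖a‖ * X) * X * Y ^ 2 + (√‖b‖ * Y) * X ^ 2 * Y := by ring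
      _ = X * Y ^ 2 + X ^ 2 * Y := by rw [hXa, hYb]; ring
      _ ≤ 2 * (X ^ 3 + Y ^ 3) := by
        nlinarith [mul_nonneg (add_pos hX hY).le (sq_nonneg (X - Y)), pow_pos hX 3, pow_pos hY 3]
  calc ‖a - b‖ * (X ^ 2 * Y ^ 2) = √‖a - b‖ * (√‖a - b‖ * (X ^ 2 * Y ^ 2)) := by
        conv_lhs => rw [hds]
        ring
    _ ≤ √‖a - b‖ * (2 * (X ^ 3 + Y ^ 3)) := by gcongr
    _ = _ := by ring

/-! ### The Cauchy–Pompeiu formula. -/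

/-- The Wirtinger derivative `∂̄`. -/
noncomputable def dbar (v : ℂ → ℂ) (z : ℂ) : ℂ :=
  (fderiv ℝ v z 1 + Complex.I * fderiv ℝ v z Complex.I) / 2

/-- The Wirtinger derivative `∂`. -/
noncomputable def dz (v : ℂ → ℂ) (z : ℂ) : ℂ :=
  (fderiv ℝ v z 1 - Complex.I * fderiv ℝ v z Complex.I) / 2

theorem hasDerivAt_circleMap_radius (z : ℂ) (r θ : ℝ) :
    HasDerivAt (fun r : ℝ => circleMap z r θ) (Complex.exp (θ * Complex.I)) r := by
  have h1 : HasDerivAt (fun r : ℝ => (r : ℂ)) 1 r := Complex.ofRealCLM.hasDerivAt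
  have := (h1.mul_const (Complex.exp (θ * Complex.I))).const_add z
  simpa [circleMap] using this

theorem fderiv_clm_apply_eq (D : ℂ →L[ℝ] ℂ) (w : ℂ) :
    D w = w.re * D 1 + w.im * D Complex.I := by
  have h : w = w.re • (1 : ℂ) + w.im • Complex.I := by simp [Complex.re_add_im]
  conv_lhs => rw [h, map_add, map_smul, map_smul]
  simp

/-- The integrand of the Cauchy–Pompeiu formula in polar coordinates. -/
theorem polar_dbar {v : ℂ → ℂ} (z : ℂ) {r : ℝ} (hr : 0 < r) (θ : ℝ) :
    r * ((z - circleMap z r θ)⁻¹ * dbar v (circleMap z r θ)) =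
      -(1 / 2 : ℂ) * (fderiv ℝ v (circleMap z r θ) (Complex.exp (θ * Complex.I)) +
        Complex.I / r * fderiv ℝ v (circleMap z r θ) (circleMap 0 r θ * Complex.I)) := by
  set D := fderiv ℝ v (circleMap z r θ) with hD
  have hr' : (r : ℂ) ≠ 0 := Complex.ofReal_ne_zero.mpr hr.ne'
  have he : Complex.exp (θ * Complex.I) ≠ 0 := Complex.exp_ne_zero _
  have e1 : z - circleMap z r θ = -(r * Complex.exp (θ * Complex.I)) := by simp [circleMap]
  have e2 : D (circleMap 0 r θ * Complex.I) = r * D (Complex.exp (θ * Complex.I) * Complex.I) := by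
    have : circleMap 0 r θ * Complex.I = r • (Complex.exp (θ * Complex.I) * Complex.I) := by
      simp [circleMap, mul_assoc]
    rw [this, map_smul, Complex.real_smul]
  have e3 : Complex.exp (θ * Complex.I) = Real.cos θ + Real.sin θ * Complex.I := by
    rw [Complex.exp_mul_I, Complex.ofReal_cos, Complex.ofReal_sin]
  have e4 : (Complex.exp (θ * Complex.I))⁻¹ = Real.cos θ - Real.sin θ * Complex.I := by
    rw [← Complex.exp_neg, ← neg_mul, Complex.exp_mul_I, Complex.cos_neg, Complex.sin_neg,
      Complex.ofReal_cos, Complex.ofReal_sin]; ring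
  have e5 : (Complex.exp (θ * Complex.I)).re = Real.cos θ ∧
      (Complex.exp (θ * Complex.I)).im = Real.sin θ := by
    constructor <;> rw [e3] <;> simp [-Complex.ofReal_cos, -Complex.ofReal_sin]
  rw [e2, e1, fderiv_clm_apply_eq D (Complex.exp (θ * Complex.I)),
    fderiv_clm_apply_eq D (Complex.exp (θ * Complex.I) * Complex.I), dbar, ← hD]
  have e6 : (Complex.exp (θ * Complex.I) * Complex.I).re = -Real.sin θ ∧
      (Complex.exp (θ * Complex.I) * Complex.I).im = Real.cos θ := by
    constructor <;> simp [e5.1, e5.2]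
  rw [e5.1, e5.2, e6.1, e6.2, inv_neg, mul_inv, e4]
  field_simp
  push_cast
  ring_nf
  simp only [Complex.I_sq]
  ring

theorem hasDerivAt_circleMean {v : ℂ → ℂ} (hv : ContDiff ℝ 1 v) (z : ℂ) (r : ℝ) :
    HasDerivAt (fun r : ℝ => ∫ θ in (-Real.pi)..Real.pi, v (circleMap z r θ))
      (∫ θ in (-Real.pi)..Real.pi,
        fderiv ℝ v (circleMap z r θ) (Complex.exp (θ * Complex.I))) r := by
  have hcf : Continuous (fderiv ℝ v) := hv.continuous_fderiv one_ne_zero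
  have hcv : Continuous v := hv.continuous
  obtain ⟨C, hC⟩ := (isCompact_closedBall z (|r| + 1)).exists_bound_of_continuousOn
    hcf.continuousOn
  have hF' : ∀ s : ℝ, Continuous fun θ : ℝ =>
      fderiv ℝ v (circleMap z s θ) (Complex.exp (θ * Complex.I)) := fun s => by
    have h1 : Continuous fun θ : ℝ => fderiv ℝ v (circleMap z s θ) := by fun_prop
    exact h1.clm_apply (by fun_prop)
  refine (intervalIntegral.hasDerivAt_integral_of_dominated_loc_of_deriv_le
    (F' := fun s θ => fderiv ℝ v (circleMap z s θ) (Complex.exp (θ * Complex.I)))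
    (bound := fun _ => C) (Metric.ball_mem_nhds r one_pos) ?_ ?_ ?_ ?_ ?_ ?_).2
  · exact Eventually.of_forall fun s =>
      (hcv.comp (continuous_circleMap z s)).aestronglyMeasurable
  · exact (hcv.comp (continuous_circleMap z r)).intervalIntegrable _ _
  · exact (hF' r).aestronglyMeasurable
  · refine Eventually.of_forall fun θ _ s hs => ?_
    have hs' : |s| ≤ |r| + 1 := by
      rw [Metric.mem_ball, Real.dist_eq] at hs
      have := abs_sub_abs_le_abs_sub s r
      linarith
    have hmem : circleMap z s θ ∈ Metric.closedBall z (|r| + 1) := by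
      rw [Metric.mem_closedBall, dist_eq_norm, circleMap_sub_center, norm_circleMap_zero]
      exact hs'
    refine ((fderiv ℝ v (circleMap z s θ)).le_opNorm _).trans ?_
    rw [Complex.norm_exp_ofReal_mul_I, mul_one]
    exact hC _ hmem
  · exact intervalIntegrable_const
  · refine Eventually.of_forall fun θ _ s _ => ?_
    have h1 := (hv.differentiable one_ne_zero (circleMap z s θ)).hasFDerivAt
    exact h1.comp_hasDerivAt s (hasDerivAt_circleMap_radius z s θ)

theorem integral_angular_derivative {v : ℂ → ℂ} (hv : ContDiff ℝ 1 v) (z : ℂ) (r : ℝ) :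
    ∫ θ in (-Real.pi)..Real.pi, fderiv ℝ v (circleMap z r θ) (circleMap 0 r θ * Complex.I) = 0 := by
  have hcf : Continuous (fderiv ℝ v) := hv.continuous_fderiv one_ne_zero
  have h1 : ∀ θ : ℝ, HasDerivAt (fun θ => v (circleMap z r θ))
      (fderiv ℝ v (circleMap z r θ) (circleMap 0 r θ * Complex.I)) θ := fun θ =>
    (hv.differentiable one_ne_zero (circleMap z r θ)).hasFDerivAt.comp_hasDerivAt θ
      (hasDerivAt_circleMap z r θ)
  have hc : Continuous fun θ : ℝ =>
      fderiv ℝ v (circleMap z r θ) (circleMap 0 r θ * Complex.I) := by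
    have h1 : Continuous fun θ : ℝ => fderiv ℝ v (circleMap z r θ) := by fun_prop
    exact h1.clm_apply (by fun_prop)
  rw [intervalIntegral.integral_eq_sub_of_hasDerivAt (fun θ _ => h1 θ) (hc.intervalIntegrable _ _)]
  have : circleMap z r Real.pi = circleMap z r (-Real.pi) := by
    simp [circleMap, Complex.exp_neg, Complex.exp_pi_mul_I]
  rw [this, sub_self]

theorem tendsto_circleMean {v : ℂ → ℂ} (h0 : Tendsto v (cocompact ℂ) (𝓝 0)) (z : ℂ) :
    Tendsto (fun r : ℝ => ∫ θ in (-Real.pi)..Real.pi, v (circleMap z r θ)) atTop (𝓝 0) := by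
  rw [Metric.tendsto_atTop]
  intro ε hε
  have h1 : ∀ᶠ w in cocompact ℂ, ‖v w‖ < ε / (2 * Real.pi + 1) := by
    have := h0.norm
    rw [norm_zero] at this
    exact this.eventually (gt_mem_nhds (by positivity))
  obtain ⟨R, hR⟩ := (Metric.hasBasis_cobounded_compl_closedBall z).eventually_iff.mp
    (Metric.cobounded_eq_cocompact (α := ℂ) ▸ h1)
  refine ⟨|R| + 1, fun r hr => ?_⟩
  rw [dist_zero_right]
  have h2 := intervalIntegral.norm_integral_le_of_norm_le_const (a := -Real.pi) (b := Real.pi)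
    (f := fun θ => v (circleMap z r θ)) (C := ε / (2 * Real.pi + 1)) fun θ _ => by
      refine (hR.2 ?_).le
      rw [Set.mem_compl_iff, Metric.mem_closedBall, dist_eq_norm, circleMap_sub_center,
        norm_circleMap_zero, not_le]
      linarith [le_abs_self R, le_abs_self r]
  have hpi := Real.pi_pos
  rw [sub_neg_eq_add, abs_of_pos (by positivity)] at h2
  refine h2.trans_lt ?_
  rw [div_mul_eq_mul_div, div_lt_iff₀ (by positivity)]
  nlinarith

/-- The Cauchy–Pompeiu formula for a `C¹` function vanishing at infinity. -/
theorem cauchy_dbar {v : ℂ → ℂ} (hv : ContDiff ℝ 1 v) (h0 : Tendsto v (cocompact ℂ) (𝓝 0)) (z : ℂ)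
    (hi : Integrable fun ζ => (z - ζ)⁻¹ * dbar v ζ) : cauchy (dbar v) z = v z := by
  set f : ℂ → ℂ := fun ζ => (z - ζ)⁻¹ * dbar v ζ with hf
  have hcirc : ∀ q : ℝ × ℝ, z + Complex.polarCoord.symm q = circleMap z q.1 q.2 := fun q => by
    rw [Complex.polarCoord_symm_apply, circleMap, Complex.exp_mul_I, Complex.ofReal_cos,
      Complex.ofReal_sin]
  have hfi : Integrable fun ζ => f (z + ζ) := hi.comp_add_left z
  have hpolar : ∫ ζ, f ζ = ∫ q in polarCoord.target, q.1 • f (circleMap z q.1 q.2) := by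
    rw [← integral_add_left_eq_self f z, ← Complex.integral_comp_polarCoord_symm]
    simp only [hcirc]
  have hpi : IntegrableOn (fun q : ℝ × ℝ => q.1 • f (circleMap z q.1 q.2)) polarCoord.target := by
    have hmeas : Measurable f := by
      have : Measurable (dbar v) := by
        unfold dbar
        have := measurable_fderiv_apply_const ℝ v 1
        have := measurable_fderiv_apply_const ℝ v Complex.I
        fun_prop
      fun_prop
    have hmeas' : Measurable fun q : ℝ × ℝ => q.1 • f (circleMap z q.1 q.2) := by
      have : Measurable fun q : ℝ × ℝ => circleMap z q.1 q.2 := by unfold circleMap; fun_prop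
      fun_prop
    refine ⟨hmeas'.aestronglyMeasurable, ?_⟩
    have h1 := Complex.lintegral_comp_polarCoord_symm fun ζ => ‖f (z + ζ)‖ₑ
    rw [HasFiniteIntegral, setLIntegral_congr_fun (g := fun q : ℝ × ℝ =>
      ENNReal.ofReal q.1 • ‖f (z + Complex.polarCoord.symm q)‖ₑ)
      polarCoord.open_target.measurableSet, h1]
    · exact hfi.2
    · intro q hq
      have hq1 : 0 < q.1 := hq.1
      simp only
      rw [hcirc, enorm_smul, Real.enorm_of_nonneg hq1.le, smul_eq_mul]
  have htarget : polarCoord.target = Set.Ioi (0 : ℝ) ×ˢ Set.Ioo (-Real.pi) Real.pi := rfl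
  rw [htarget] at hpolar hpi
  rw [Measure.volume_eq_prod] at hpolar hpi
  -- In polar coordinates about `z` the Jacobian cancels the singularity, the angular derivative
  -- integrates to zero, and `M'` is the derivative of the unnormalised circle mean. Its integral
  -- over `(0, ∞)` is `0 - 2π v(z)`, and the factor `-1/2` turns this into `π v(z)`.
  set M' : ℝ → ℂ := fun r => ∫ θ in (-Real.pi)..Real.pi,
        fderiv ℝ v (circleMap z r θ) (Complex.exp (θ * Complex.I)) with hM'
  have hcf : Continuous (fderiv ℝ v) := hv.continuous_fderiv one_ne_zero
  have hinner : ∀ r ∈ Set.Ioi (0 : ℝ), ∫ θ in Set.Ioo (-Real.pi) Real.pi,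
      r • f (circleMap z r θ) = -(1 / 2 : ℂ) * M' r := by
    intro r hr
    have hc1 : Continuous fun θ : ℝ =>
        fderiv ℝ v (circleMap z r θ) (circleMap 0 r θ * Complex.I) := by
      have h1 : Continuous fun θ : ℝ => fderiv ℝ v (circleMap z r θ) := by fun_prop
      exact h1.clm_apply (by fun_prop)
    have hc2 : Continuous fun θ : ℝ =>
        fderiv ℝ v (circleMap z r θ) (Complex.exp (θ * Complex.I)) := by
      have h1 : Continuous fun θ : ℝ => fderiv ℝ v (circleMap z r θ) := by fun_prop
      exact h1.clm_apply (by fun_prop)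
    rw [← integral_Ioc_eq_integral_Ioo, ← intervalIntegral.integral_of_le (by linarith [Real.pi_pos])]
    have hpt : (fun θ : ℝ => r • f (circleMap z r θ)) = fun θ : ℝ => -(1 / 2 : ℂ) *
        (fderiv ℝ v (circleMap z r θ) (Complex.exp (θ * Complex.I)) +
        Complex.I / r * fderiv ℝ v (circleMap z r θ) (circleMap 0 r θ * Complex.I)) :=
      funext fun θ => by rw [Complex.real_smul]; exact polar_dbar z hr θ
    rw [hpt, intervalIntegral.integral_const_mul, intervalIntegral.integral_add
      (hc2.intervalIntegrable _ _) ((hc1.const_mul _).intervalIntegrable _ _),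
      intervalIntegral.integral_const_mul, integral_angular_derivative hv, mul_zero, add_zero]
  have hM'i : IntegrableOn M' (Set.Ioi 0) := by
    rw [IntegrableOn, ← Measure.prod_restrict] at hpi
    have h1 := hpi.integral_prod_left.const_mul (-2 : ℂ)
    refine h1.congr ?_
    filter_upwards [ae_restrict_mem measurableSet_Ioi] with r hr
    change -2 * (∫ θ in Set.Ioo (-Real.pi) Real.pi, r • f (circleMap z r θ)) = M' r
    rw [hinner r hr]; ring
  have hFTC := integral_Ioi_of_hasDerivAt_of_tendsto
    (hasDerivAt_circleMean hv z 0).continuousAt.continuousWithinAt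
    (fun r _ => hasDerivAt_circleMean hv z r) hM'i (tendsto_circleMean h0 z)
  rw [cauchy, hpolar, setIntegral_prod _ hpi, setIntegral_congr_fun measurableSet_Ioi hinner,
    integral_const_mul, hFTC]
  have hpi0 : (Real.pi : ℂ) ≠ 0 := Complex.ofReal_ne_zero.mpr Real.pi_ne_zero
  simp [circleMap_zero_radius]
  field_simp
  ring

/-! ### Wirtinger calculus for the explicit functions. -/

/-- The real-linear map `w ↦ a w + b w̄`. -/
noncomputable def wirtinger (a b : ℂ) : ℂ →L[ℝ] ℂ :=
  a • ContinuousLinearMap.id ℝ ℂ + b • (Complex.conjCLE : ℂ →L[ℝ] ℂ)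

theorem wirtinger_apply (a b w : ℂ) : wirtinger a b w = a * w + b * conj w := by
  simp [wirtinger]

/-- `v` has real derivative `w ↦ a w + b w̄` at `z`. -/
def HasW (v : ℂ → ℂ) (a b z : ℂ) : Prop := HasFDerivAt v (wirtinger a b) z

theorem clm_eq_wirtinger (D : ℂ →L[ℝ] ℂ) :
    D = wirtinger ((D 1 - Complex.I * D Complex.I) / 2) ((D 1 + Complex.I * D Complex.I) / 2) := by
  ext w
  rw [fderiv_clm_apply_eq D w, wirtinger_apply]
  have h1 : w = w.re + w.im * Complex.I := (Complex.re_add_im w).symm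
  have h2 : conj w = w.re - w.im * Complex.I := by
    apply Complex.ext <;> simp
  rw [h2]
  conv_rhs => enter [1, 2]; rw [h1]
  linear_combination (w.im * D Complex.I) * Complex.I_sq

namespace HasW

variable {u v : ℂ → ℂ} {a b c d z : ℂ}

theorem dz_eq (h : HasW v a b z) : dz v z = a := by
  unfold dz
  rw [HasFDerivAt.fderiv h, wirtinger_apply, wirtinger_apply, Complex.conj_I, map_one]
  linear_combination (-(a - b) / 2) * Complex.I_sq

theorem dbar_eq (h : HasW v a b z) : dbar v z = b := by
  unfold dbar
  rw [HasFDerivAt.fderiv h, wirtinger_apply, wirtinger_apply, Complex.conj_I, map_one]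
  linear_combination ((a - b) / 2) * Complex.I_sq

theorem of_differentiableAt (h : DifferentiableAt ℝ v z) : HasW v (dz v z) (dbar v z) z := by
  have := h.hasFDerivAt
  rwa [clm_eq_wirtinger (fderiv ℝ v z)] at this

theorem congr (h : HasW v a b z) (ha : a = c) (hb : b = d) : HasW v c d z := by
  rwa [ha, hb] at h

theorem const (c z : ℂ) : HasW (fun _ => c) 0 0 z := by
  have := hasFDerivAt_const (𝕜 := ℝ) c z
  exact HasFDerivAt.congr_fderiv this (ContinuousLinearMap.ext fun w => by simp [wirtinger_apply])

theorem id (z : ℂ) : HasW (fun w => w) 1 0 z := by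
  have := hasFDerivAt_id (𝕜 := ℝ) z
  exact HasFDerivAt.congr_fderiv this (ContinuousLinearMap.ext fun w => by simp [wirtinger_apply])

theorem conj_id (z : ℂ) : HasW (fun w => conj w) 0 1 z := by
  have := (Complex.conjCLE : ℂ →L[ℝ] ℂ).hasFDerivAt (x := z)
  exact HasFDerivAt.congr_fderiv this (ContinuousLinearMap.ext fun w => by simp [wirtinger_apply])

theorem add (hu : HasW u a b z) (hv : HasW v c d z) :
    HasW (fun w => u w + v w) (a + c) (b + d) z := by
  have := HasFDerivAt.add hu hv
  exact HasFDerivAt.congr_fderiv this (ContinuousLinearMap.ext fun w => by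
    simp [wirtinger_apply]; ring)

theorem neg (hu : HasW u a b z) : HasW (fun w => -u w) (-a) (-b) z := by
  have := HasFDerivAt.neg hu
  exact HasFDerivAt.congr_fderiv this (ContinuousLinearMap.ext fun w => by
    simp [wirtinger_apply]; ring)

theorem mul (hu : HasW u a b z) (hv : HasW v c d z) :
    HasW (fun w => u w * v w) (a * v z + u z * c) (b * v z + u z * d) z := by
  have := HasFDerivAt.mul hu hv
  exact HasFDerivAt.congr_fderiv this (ContinuousLinearMap.ext fun w => by
    simp [wirtinger_apply]; ring)

theorem comp_deriv {f : ℂ → ℂ} {f' : ℂ} (hf : HasDerivAt f f' (u z)) (hu : HasW u a b z) :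
    HasW (fun w => f (u w)) (f' * a) (f' * b) z := by
  have := (hf.hasFDerivAt.restrictScalars ℝ).comp z hu
  exact HasFDerivAt.congr_fderiv this (ContinuousLinearMap.ext fun w => by
    simp [wirtinger_apply]; ring)

theorem star (hu : HasW u a b z) :
    HasW (fun w => (starRingEnd ℂ) (u w)) ((starRingEnd ℂ) b) ((starRingEnd ℂ) a) z := by
  have := (Complex.conjCLE : ℂ →L[ℝ] ℂ).hasFDerivAt.comp z hu
  exact HasFDerivAt.congr_fderiv this (ContinuousLinearMap.ext fun w => by
    simp [wirtinger_apply]; ring)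

theorem rhoSq (z : ℂ) : HasW (fun w => (rhoSq w : ℂ)) ((starRingEnd ℂ) z) z z := by
  have h : (fun w : ℂ => (DSSoliton.rhoSq w : ℂ)) = fun w => 1 + w * (starRingEnd ℂ) w := by
    ext w
    rw [Complex.mul_conj, Complex.normSq_eq_norm_sq, DSSoliton.rhoSq]
    push_cast; ring
  rw [h]
  exact ((const 1 z).add ((id z).mul (conj_id z))).congr (by ring) (by ring)

theorem inv_rhoSq (z : ℂ) : HasW (fun w => (DSSoliton.rhoSq w : ℂ)⁻¹)
    (-(starRingEnd ℂ) z / (DSSoliton.rhoSq z : ℂ) ^ 2) (-z / (DSSoliton.rhoSq z : ℂ) ^ 2) z := by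
  have h0 : (DSSoliton.rhoSq z : ℂ) ≠ 0 := Complex.ofReal_ne_zero.mpr (rhoSq_pos z).ne'
  exact (comp_deriv (f := fun w => w⁻¹) (hasDerivAt_inv h0) (HasW.rhoSq z)).congr (by ring) (by ring)

theorem expo (k z : ℂ) : HasW (expo k) (Complex.I * k * expo k z)
    (Complex.I * (starRingEnd ℂ) k * DSSoliton.expo k z) z := by
  have h1 : HasW (fun z => Complex.I * (k * z + (starRingEnd ℂ) k * (starRingEnd ℂ) z))
      (Complex.I * k) (Complex.I * (starRingEnd ℂ) k) z :=
    ((const Complex.I z).mul (((const k z).mul (id z)).add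
      ((const ((starRingEnd ℂ) k) z).mul (conj_id z)))).congr (by ring) (by ring)
  exact (comp_deriv (Complex.hasDerivAt_exp _) h1).congr
    (by rw [DSSoliton.expo]; ring) (by rw [DSSoliton.expo]; ring)

end HasW

theorem ofReal_rhoSq (z : ℂ) : (rhoSq z : ℂ) = 1 + z * conj z := by
  rw [Complex.mul_conj, Complex.normSq_eq_norm_sq, rhoSq]
  push_cast; ring

theorem rhoSq_ne_zero (z : ℂ) : (rhoSq z : ℂ) ≠ 0 := Complex.ofReal_ne_zero.mpr (rhoSq_pos z).ne'

theorem norm_expo (k z : ℂ) : ‖expo k z‖ = 1 := by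
  have : Complex.I * (k * z + conj k * conj z) = ((2 * (k * z).re : ℝ) : ℂ) * Complex.I := by
    rw [← map_mul, Complex.add_conj, mul_comm]
  rw [expo, this, Complex.norm_exp_ofReal_mul_I]

theorem expo_add (k l z : ℂ) : expo (k + l) z = expo k z * expo l z := by
  rw [expo, expo, expo, ← Complex.exp_add, map_add]; ring_nf

theorem expo_neg_mul_expo (k z : ℂ) : expo (-k) z * expo k z = 1 := by
  rw [← expo_add]; simp [expo]

theorem expo_sub_apply (k z w : ℂ) : expo k (z - w) = expo k z * expo (-k) w := by
  rw [expo, expo, expo, ← Complex.exp_add, map_neg, map_sub]; ring_nf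

theorem conj_expo (k z : ℂ) : conj (expo k z) = expo (-k) z := by
  rw [expo, expo, ← Complex.exp_conj]
  simp only [map_mul, map_add, Complex.conj_I, Complex.conj_conj, map_neg]
  ring_nf

theorem contDiff_expo (k : ℂ) {n : WithTop ℕ∞} : ContDiff ℝ n (expo k) := by
  have h1 : ContDiff ℝ n fun z : ℂ => conj z := (Complex.conjCLE : ℂ →L[ℝ] ℂ).contDiff
  have h2 : ContDiff ℝ n Complex.exp := Complex.contDiff_exp (𝕜 := ℂ) |>.restrict_scalars ℝ
  unfold expo
  exact h2.comp (by fun_prop)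

theorem contDiff_rhoSq {n : WithTop ℕ∞} : ContDiff ℝ n fun z => (rhoSq z : ℂ) := by
  have h1 : ContDiff ℝ n fun z : ℂ => conj z := (Complex.conjCLE : ℂ →L[ℝ] ℂ).contDiff
  simp only [ofReal_rhoSq]
  fun_prop

theorem contDiff_inv_rhoSq {n : WithTop ℕ∞} : ContDiff ℝ n fun z => (rhoSq z : ℂ)⁻¹ :=
  contDiff_rhoSq.inv fun z => rhoSq_ne_zero z

theorem contDiff_conj {n : WithTop ℕ∞} : ContDiff ℝ n fun z : ℂ => conj z :=
  (Complex.conjCLE : ℂ →L[ℝ] ℂ).contDiff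

theorem cauchyBar_eq (f : ℂ → ℂ) (z : ℂ) :
    cauchyBar f z = conj (cauchy (fun w => conj (f w)) z) := by
  rw [cauchyBar, cauchy, map_mul, ← integral_conj]
  simp

theorem tendsto_wt {s : ℝ} (hs : 0 < s) : Tendsto (wt s) (cocompact ℂ) (𝓝 0) := by
  have h1 : Tendsto rhoSq (cocompact ℂ) atTop := by
    refine tendsto_atTop_mono (f := fun z : ℂ => ‖z‖) (fun z => ?_) tendsto_norm_cocompact_atTop
    unfold rhoSq
    nlinarith [sq_nonneg (‖z‖ - 1)]
  exact (tendsto_rpow_neg_atTop (half_pos hs)).comp h1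

theorem norm_inv_rhoSq (z : ℂ) : ‖(rhoSq z : ℂ)⁻¹‖ = wt 2 z := by
  rw [wt_two, norm_inv, Complex.norm_real, Real.norm_of_nonneg (rhoSq_pos z).le]

theorem measurable_dbar (v : ℂ → ℂ) : Measurable (dbar v) := by
  unfold dbar
  have := measurable_fderiv_apply_const ℝ v 1
  have := measurable_fderiv_apply_const ℝ v Complex.I
  fun_prop

/-! ### Explicit Cauchy transforms, decay and duality. -/

/-- The Cauchy–Pompeiu formula for functions with power decay. -/
theorem cauchy_dbar_of_decay {v : ℂ → ℂ} (hv : ContDiff ℝ 1 v) {c s b : ℝ} (hs : 0 < s)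
    (hb : 1 < b) (hvb : ∀ z, ‖v z‖ ≤ c * wt s z) (hdb : ∀ z, ‖dbar v z‖ ≤ c * wt b z) (z : ℂ) :
    cauchy (dbar v) z = v z := by
  obtain ⟨C, -, hC⟩ := exists_cauchy_potential_decay (b := b) (s := 0) le_rfl zero_le_one
    (by linarith)
  refine cauchy_dbar hv ?_ z ?_
  · have := (tendsto_wt hs).const_mul c
    rw [mul_zero] at this
    exact squeeze_zero_norm hvb this
  · refine ((hC z).1.const_mul c).mono' ?_ (Eventually.of_forall fun ζ => ?_)
    · have := measurable_dbar v
      exact (by fun_prop : Measurable fun ζ => (z - ζ)⁻¹ * dbar v ζ).aestronglyMeasurable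
    · rw [norm_mul, norm_inv]
      calc ‖z - ζ‖⁻¹ * ‖dbar v ζ‖ ≤ ‖z - ζ‖⁻¹ * (c * wt b ζ) := by gcongr; exact hdb ζ
        _ = _ := by ring

theorem norm_inv_rhoSq_sq (z : ℂ) : ‖((rhoSq z : ℂ) ^ 2)⁻¹‖ = wt 4 z := by
  rw [← inv_pow, norm_pow, norm_inv_rhoSq, pow_two, ← wt_add]; norm_num

/-- `C[ρ⁻⁴] = z̄ ρ⁻²`. -/
theorem cauchy_inv_rhoSq_sq (z : ℂ) :
    cauchy (fun ζ => ((rhoSq ζ : ℂ) ^ 2)⁻¹) z = conj z * (rhoSq z : ℂ)⁻¹ := by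
  have hd : dbar (fun ζ => conj ζ * (rhoSq ζ : ℂ)⁻¹) = fun ζ => ((rhoSq ζ : ℂ) ^ 2)⁻¹ := by
    ext ζ
    rw [((HasW.conj_id ζ).mul (HasW.inv_rhoSq ζ)).dbar_eq]
    have := rhoSq_ne_zero ζ
    field_simp
    rw [ofReal_rhoSq]; ring
  have h := cauchy_dbar_of_decay (v := fun ζ => conj ζ * (rhoSq ζ : ℂ)⁻¹) (c := 1) (s := 1) (b := 4)
    (contDiff_conj.mul contDiff_inv_rhoSq) one_pos (by norm_num) (fun ζ => ?_) (fun ζ => ?_) z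
  · rwa [hd] at h
  · rw [norm_mul, RCLike.norm_conj, norm_inv_rhoSq, one_mul]
    have := norm_mul_wt_le 2 ζ
    norm_num at this
    exact this
  · rw [hd, norm_inv_rhoSq_sq, one_mul]

/-- `C[z ρ⁻⁴] = -ρ⁻²`. -/
theorem cauchy_mul_inv_rhoSq_sq (z : ℂ) :
    cauchy (fun ζ => ζ * ((rhoSq ζ : ℂ) ^ 2)⁻¹) z = -(rhoSq z : ℂ)⁻¹ := by
  have hd : dbar (fun ζ => -(rhoSq ζ : ℂ)⁻¹) = fun ζ => ζ * ((rhoSq ζ : ℂ) ^ 2)⁻¹ := by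
    ext ζ
    rw [(HasW.inv_rhoSq ζ).neg.dbar_eq]
    ring
  have h := cauchy_dbar_of_decay (v := fun ζ => -(rhoSq ζ : ℂ)⁻¹) (c := 1) (s := 2) (b := 3)
    contDiff_inv_rhoSq.neg two_pos (by norm_num) (fun ζ => ?_) (fun ζ => ?_) z
  · rwa [hd] at h
  · rw [norm_neg, norm_inv_rhoSq, one_mul]
  · rw [hd, norm_mul, norm_inv_rhoSq_sq, one_mul]
    have := norm_mul_wt_le 4 ζ
    norm_num at this
    exact this

/-- `C̄[ρ⁻⁴] = z ρ⁻²`. -/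
theorem cauchyBar_inv_rhoSq_sq (z : ℂ) :
    cauchyBar (fun ζ => ((rhoSq ζ : ℂ) ^ 2)⁻¹) z = z * (rhoSq z : ℂ)⁻¹ := by
  rw [cauchyBar_eq]
  simp [cauchy_inv_rhoSq_sq]

/-- `C̄[z̄ ρ⁻⁴] = -ρ⁻²`. -/
theorem cauchyBar_conj_mul_inv_rhoSq_sq (z : ℂ) :
    cauchyBar (fun ζ => conj ζ * ((rhoSq ζ : ℂ) ^ 2)⁻¹) z = -(rhoSq z : ℂ)⁻¹ := by
  rw [cauchyBar_eq]
  simp [cauchy_mul_inv_rhoSq_sq]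

theorem integrable_inv_sub_mul {F : ℂ → ℂ} (hF : AEStronglyMeasurable F volume) {c b : ℝ}
    (hb : 1 < b) (hFb : ∀ᵐ z, ‖F z‖ ≤ c * wt b z) (z : ℂ) :
    Integrable fun ζ => (z - ζ)⁻¹ * F ζ := by
  obtain ⟨C, -, hC⟩ := exists_cauchy_potential_decay (b := b) (s := 0) le_rfl zero_le_one
    (by linarith)
  refine ((hC z).1.const_mul c).mono' ?_ ?_
  · exact (by fun_prop : Measurable fun ζ : ℂ => (z - ζ)⁻¹).aestronglyMeasurable.mul hF
  · filter_upwards [hFb] with ζ hζ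
    rw [norm_mul, norm_inv]
    calc ‖z - ζ‖⁻¹ * ‖F ζ‖ ≤ ‖z - ζ‖⁻¹ * (c * wt b ζ) := by gcongr
      _ = _ := by ring

/-- Pointwise decay of Cauchy transforms. -/
theorem exists_norm_cauchy_le {b s : ℝ} (hs : 0 ≤ s) (hs1 : s ≤ 1) (hsb : s + 1 < b) :
    ∃ C : ℝ, 0 ≤ C ∧ ∀ (F : ℂ → ℂ) (c : ℝ), (∀ᵐ z, ‖F z‖ ≤ c * wt b z) →
      ∀ z, ‖∫ ζ, (z - ζ)⁻¹ * F ζ‖ ≤ C * c * wt s z := by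
  obtain ⟨C, hC0, hC⟩ := exists_cauchy_potential_decay (b := b) hs hs1 hsb
  refine ⟨C, hC0, fun F c hFb z => ?_⟩
  have hc : 0 ≤ c := by
    obtain ⟨w, hw⟩ := hFb.exists
    by_contra hneg
    have := mul_neg_of_neg_of_pos (not_le.mp hneg) (wt_pos b w)
    linarith [norm_nonneg (F w)]
  calc ‖∫ ζ, (z - ζ)⁻¹ * F ζ‖ ≤ ∫ ζ, c * (‖z - ζ‖⁻¹ * wt b ζ) := by
        refine norm_integral_le_of_norm_le ((hC z).1.const_mul c) ?_
        filter_upwards [hFb] with ζ hζ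
        rw [norm_mul, norm_inv]
        calc ‖z - ζ‖⁻¹ * ‖F ζ‖ ≤ ‖z - ζ‖⁻¹ * (c * wt b ζ) := by gcongr
          _ = _ := by ring
    _ = c * ∫ ζ, ‖z - ζ‖⁻¹ * wt b ζ := integral_const_mul _ _
    _ ≤ c * (C * wt s z) := by gcongr; exact (hC z).2
    _ = _ := by ring

theorem stronglyMeasurable_cauchy {F : ℂ → ℂ} (hF : AEStronglyMeasurable F volume) :
    StronglyMeasurable (cauchy F) := by
  have h1 : cauchy F = cauchy (hF.mk F) := by
    ext z
    rw [cauchy, cauchy]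
    congr 1
    refine integral_congr_ae ?_
    filter_upwards [hF.ae_eq_mk] with ζ hζ
    rw [hζ]
  rw [h1]
  have hm : Measurable (hF.mk F) := hF.stronglyMeasurable_mk.measurable
  have h2 : StronglyMeasurable fun z => ∫ ζ, (z - ζ)⁻¹ * hF.mk F ζ := by
    refine StronglyMeasurable.integral_prod_right (f := fun z ζ => (z - ζ)⁻¹ * hF.mk F ζ) ?_
    exact (by fun_prop : Measurable fun q : ℂ × ℂ => (q.1 - q.2)⁻¹ * hF.mk F q.2).stronglyMeasurable
  exact h2.const_mul _

/-- Absolute convergence of the double integral pairing `C[F]` with `v`. -/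
theorem integrable_prod_cauchy {F v : ℂ → ℂ} (hF : AEStronglyMeasurable F volume) {c b : ℝ}
    (hb : 1 < b) (hFb : ∀ᵐ z, ‖F z‖ ≤ c * wt b z) (hv : Integrable v) :
    Integrable (fun q : ℂ × ℂ => (q.1 - q.2)⁻¹ * F q.2 * v q.1) (volume.prod volume) := by
  have hmeas : AEStronglyMeasurable (fun q : ℂ × ℂ => (q.1 - q.2)⁻¹ * F q.2 * v q.1)
      (volume.prod volume) :=
    ((by fun_prop : Measurable fun q : ℂ × ℂ => (q.1 - q.2)⁻¹).aestronglyMeasurable.mul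
      hF.comp_snd).mul hv.aestronglyMeasurable.comp_fst
  obtain ⟨C, -, hC⟩ := exists_cauchy_potential_decay (b := b) (s := 0) le_rfl zero_le_one
    (by linarith)
  have hc : 0 ≤ c := by
    obtain ⟨w, hw⟩ := hFb.exists
    by_contra hneg
    have := mul_neg_of_neg_of_pos (not_le.mp hneg) (wt_pos b w)
    linarith [norm_nonneg (F w)]
  have hnorm : ∀ z, ∫ ζ, ‖(z - ζ)⁻¹ * F ζ * v z‖ ≤ c * C * ‖v z‖ := fun z => by
    simp only [norm_mul _ (v z)]
    rw [integral_mul_const]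
    refine mul_le_mul_of_nonneg_right ?_ (norm_nonneg _)
    calc ∫ ζ, ‖(z - ζ)⁻¹ * F ζ‖ ≤ ∫ ζ, c * (‖z - ζ‖⁻¹ * wt b ζ) := by
          refine integral_mono_ae (integrable_inv_sub_mul hF hb hFb z).norm
            ((hC z).1.const_mul c) ?_
          filter_upwards [hFb] with ζ hζ
          rw [norm_mul, norm_inv]
          calc ‖z - ζ‖⁻¹ * ‖F ζ‖ ≤ ‖z - ζ‖⁻¹ * (c * wt b ζ) := by gcongr
            _ = _ := by ring
      _ = c * ∫ ζ, ‖z - ζ‖⁻¹ * wt b ζ := integral_const_mul _ _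
      _ ≤ c * C := by
          have := (hC z).2
          rw [wt_zero, mul_one] at this
          gcongr
  rw [integrable_prod_iff hmeas]
  refine ⟨Eventually.of_forall fun z => (integrable_inv_sub_mul hF hb hFb z).mul_const (v z), ?_⟩
  refine Integrable.mono' (hv.norm.const_mul (c * C)) hmeas.norm.integral_prod_right'
    (Eventually.of_forall fun z => ?_)
  rw [Real.norm_of_nonneg (integral_nonneg fun _ => norm_nonneg _)]
  exact hnorm z

/-- The Cauchy transform is skew with respect to the bilinear pairing. -/
theorem cauchy_duality {F v : ℂ → ℂ} (hF : AEStronglyMeasurable F volume) {c b : ℝ}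
    (hb : 1 < b) (hFb : ∀ᵐ z, ‖F z‖ ≤ c * wt b z) (hv : Integrable v) :
    ∫ z, cauchy F z * v z = -∫ ζ, F ζ * cauchy v ζ := by
  have hint := integrable_prod_cauchy hF hb hFb hv
  have h1 : ∀ z, cauchy F z * v z = (Real.pi : ℂ)⁻¹ * ∫ ζ, (z - ζ)⁻¹ * F ζ * v z := fun z => by
    rw [integral_mul_const, cauchy]; ring
  have h2 : ∀ ζ, F ζ * cauchy v ζ = -((Real.pi : ℂ)⁻¹ * ∫ z, (z - ζ)⁻¹ * F ζ * v z) := fun ζ => by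
    rw [cauchy, ← mul_neg, ← integral_neg, mul_left_comm, ← integral_const_mul]
    congr 2
    ext z
    rw [← neg_sub z ζ, inv_neg]; ring
  simp only [h1, h2]
  rw [integral_neg, neg_neg, integral_const_mul, integral_const_mul]
  congr 1
  exact integral_integral_swap hint

/-- The conjugate Cauchy transform is skew with respect to the bilinear pairing. -/
theorem cauchyBar_duality {F v : ℂ → ℂ} (hF : AEStronglyMeasurable F volume) {c b : ℝ}
    (hb : 1 < b) (hFb : ∀ᵐ z, ‖F z‖ ≤ c * wt b z) (hv : Integrable v) :
    ∫ z, cauchyBar F z * v z = -∫ ζ, F ζ * cauchyBar v ζ := by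
  have h := cauchy_duality (F := fun z => conj (F z)) (v := fun z => conj (v z))
    (Complex.continuous_conj.comp_aestronglyMeasurable hF) hb (c := c)
    (by simpa only [RCLike.norm_conj] using hFb) ((Complex.conjLIE.integrable_comp_iff).mpr hv)
  have h' := congr_arg conj h
  rw [map_neg, ← integral_conj, ← integral_conj] at h'
  simpa only [map_mul, Complex.conj_conj, ← cauchyBar_eq] using h'

/-! ### Test functions and their Cauchy transforms. -/

/-- Smooth compactly supported functions. -/
def IsTest (v : ℂ → ℂ) : Prop := ContDiff ℝ ∞ v ∧ HasCompactSupport v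

namespace IsTest

variable {u v : ℂ → ℂ}

theorem differentiable (hv : IsTest v) : Differentiable ℝ v := hv.1.differentiable (by simp)

theorem hasW (hv : IsTest v) (z : ℂ) : HasW v (dz v z) (dbar v z) z :=
  HasW.of_differentiableAt (hv.differentiable z)

theorem fderiv_apply (hv : IsTest v) (e : ℂ) : IsTest fun z => fderiv ℝ v z e :=
  ⟨(hv.1.fderiv_right (m := ∞) (by simp)).clm_apply contDiff_const, hv.2.fderiv_apply ℝ e⟩

theorem add (hu : IsTest u) (hv : IsTest v) : IsTest fun z => u z + v z :=
  ⟨hu.1.add hv.1, hu.2.add hv.2⟩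

theorem smooth_mul (hu : ContDiff ℝ ∞ u) (hv : IsTest v) : IsTest fun z => u z * v z :=
  ⟨hu.mul hv.1, hv.2.mul_left⟩

theorem mul_smooth (hu : IsTest u) (hv : ContDiff ℝ ∞ v) : IsTest fun z => u z * v z :=
  ⟨hu.1.mul hv, hu.2.mul_right⟩

theorem const_mul (c : ℂ) (hv : IsTest v) : IsTest fun z => c * v z :=
  smooth_mul contDiff_const hv

theorem star (hv : IsTest v) : IsTest fun z => (starRingEnd ℂ) (v z) :=
  ⟨contDiff_conj.comp hv.1, hv.2.comp_left (map_zero _)⟩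

theorem dbar (hv : IsTest v) : IsTest (dbar v) := by
  have h := ((hv.fderiv_apply 1).add ((hv.fderiv_apply Complex.I).const_mul Complex.I)).const_mul
    (1 / 2)
  have e : DSSoliton.dbar v
      = fun z => 1 / 2 * (fderiv ℝ v z 1 + Complex.I * fderiv ℝ v z Complex.I) := by
    ext z; rw [DSSoliton.dbar]; ring
  rwa [e]

theorem dz (hv : IsTest v) : IsTest (dz v) := by
  have h := ((hv.fderiv_apply 1).add ((hv.fderiv_apply Complex.I).const_mul
    (-Complex.I))).const_mul (1 / 2)
  have e : DSSoliton.dz v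
      = fun z => 1 / 2 * (fderiv ℝ v z 1 + -Complex.I * fderiv ℝ v z Complex.I) := by
    ext z; rw [DSSoliton.dz]; ring
  rwa [e]

theorem continuous (hv : IsTest v) : Continuous v := hv.1.continuous

theorem integrable (hv : IsTest v) : Integrable v := hv.continuous.integrable_of_hasCompactSupport hv.2

theorem bound (hv : IsTest v) (s : ℝ) : ∃ C : ℝ, ∀ z, ‖v z‖ ≤ C * wt s z := by
  have hc : Continuous fun z => v z * ((wt s z)⁻¹ : ℝ) :=
    hv.continuous.mul (Complex.continuous_ofReal.comp
      ((continuous_wt s).inv₀ fun z => (wt_pos s z).ne'))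
  obtain ⟨C, hC⟩ := (HasCompactSupport.mul_right hv.2 (f' := fun z => (((wt s z)⁻¹ : ℝ) : ℂ))
    ).exists_bound_of_continuous hc
  refine ⟨C, fun z => ?_⟩
  have : ‖v z * (((wt s z)⁻¹ : ℝ) : ℂ)‖ ≤ C := hC z
  rw [norm_mul, Complex.norm_real, Real.norm_of_nonneg (inv_nonneg.mpr (wt_nonneg s z)),
    ← div_eq_mul_inv, div_le_iff₀ (wt_pos s z)] at this
  exact this

theorem dz_dbar (hv : IsTest v) (z : ℂ) :
    DSSoliton.dz (DSSoliton.dbar v) z = DSSoliton.dbar (DSSoliton.dz v) z := by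
  have hd : DifferentiableAt ℝ (fderiv ℝ v) z :=
    (hv.1.fderiv_right (m := ∞) (by simp)).differentiable (by simp) z
  have hsymm : fderiv ℝ (fderiv ℝ v) z 1 Complex.I = fderiv ℝ (fderiv ℝ v) z Complex.I 1 :=
    (hv.1.contDiffAt (x := z)).isSymmSndFDerivAt (by
      rw [minSmoothness_of_isRCLikeNormedField]; exact WithTop.coe_le_coe.mpr le_top) 1 Complex.I
  have h1 : ∀ e, HasFDerivAt (fun z => fderiv ℝ v z e)
      ((ContinuousLinearMap.apply ℝ ℂ e).comp (fderiv ℝ (fderiv ℝ v) z)) z := fun e =>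
    (ContinuousLinearMap.apply ℝ ℂ e).hasFDerivAt.comp z hd.hasFDerivAt
  have h2 : HasFDerivAt (DSSoliton.dbar v) _ z :=
    (((h1 1).add ((h1 Complex.I).const_mul Complex.I)).mul_const (2 : ℂ)⁻¹)
  have h3 : HasFDerivAt (DSSoliton.dz v) _ z :=
    (((h1 1).sub ((h1 Complex.I).const_mul Complex.I)).mul_const (2 : ℂ)⁻¹)
  rw [DSSoliton.dz, DSSoliton.dbar, h2.fderiv, h3.fderiv]
  simp [hsymm]
  ring

end IsTest

/-- As a convolution with the locally integrable `w⁻¹`, the transform of a test function is smooth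
and its derivatives fall on the test function. -/
theorem cauchy_eq_convolution (f : ℂ → ℂ) (z : ℂ) :
    cauchy f z = (Real.pi : ℂ)⁻¹ *
      convolution f (fun w => w⁻¹) (ContinuousLinearMap.mul ℝ ℂ) volume z := by
  simp only [cauchy, convolution, ContinuousLinearMap.mul_apply']
  congr 2
  ext ζ
  ring

theorem locallyIntegrable_inv : LocallyIntegrable (fun w : ℂ => w⁻¹) := by
  refine locallyIntegrable_of_norm_le_rpow (C := 1) (α := 1) (by simp) (by simp)
    (Eventually.of_forall fun x => ?_) (by fun_prop : Measurable fun w : ℂ => w⁻¹).aestronglyMeasurable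
  rw [norm_inv, Real.rpow_neg_one, one_mul]

namespace IsTest

variable {v : ℂ → ℂ}

theorem contDiff_cauchy (hv : IsTest v) : ContDiff ℝ ∞ (cauchy v) := by
  have : cauchy v = fun z => (Real.pi : ℂ)⁻¹ *
      convolution v (fun w => w⁻¹) (ContinuousLinearMap.mul ℝ ℂ) volume z :=
    funext (cauchy_eq_convolution v)
  rw [this]
  exact contDiff_const.mul (HasCompactSupport.contDiff_convolution_left _ hv.2 hv.1
    locallyIntegrable_inv)

theorem fderiv_cauchy (hv : IsTest v) (z e : ℂ) :
    fderiv ℝ (cauchy v) z e = cauchy (fun ζ => fderiv ℝ v ζ e) z := by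
  have h1 := HasCompactSupport.hasFDerivAt_convolution_left (𝕜 := ℝ) (μ := volume)
    (ContinuousLinearMap.mul ℝ ℂ) hv.2 (hv.1.of_le (by simp)) locallyIntegrable_inv z
  have h2 := h1.const_mul (Real.pi : ℂ)⁻¹
  have h3 : cauchy v = fun z => (Real.pi : ℂ)⁻¹ *
      convolution v (fun w => w⁻¹) (ContinuousLinearMap.mul ℝ ℂ) volume z :=
    funext (cauchy_eq_convolution v)
  rw [h3, h2.fderiv, cauchy_eq_convolution, smul_apply, smul_eq_mul]
  congr 1
  have hcf : Continuous (fderiv ℝ v) := hv.1.continuous_fderiv (by simp)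
  have hex : ConvolutionExists (fderiv ℝ v) (fun w : ℂ => w⁻¹)
      (ContinuousLinearMap.precompL ℂ (ContinuousLinearMap.mul ℝ ℂ)) volume :=
    HasCompactSupport.convolutionExists_left _ (hv.2.fderiv ℝ) hcf locallyIntegrable_inv
  rw [convolution, ContinuousLinearMap.integral_apply (hex z)]
  rfl

theorem dz_cauchy (hv : IsTest v) (z : ℂ) : DSSoliton.dz (cauchy v) z = cauchy (DSSoliton.dz v) z := by
  have hi : ∀ e, Integrable fun ζ => (z - ζ)⁻¹ * fderiv ℝ v ζ e := fun e => by
    obtain ⟨C, hC⟩ := (hv.fderiv_apply e).bound 3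
    exact integrable_inv_sub_mul (hv.fderiv_apply e).continuous.aestronglyMeasurable
      (by norm_num : (1 : ℝ) < 3) (Eventually.of_forall hC) z
  rw [DSSoliton.dz, hv.fderiv_cauchy, hv.fderiv_cauchy, cauchy, cauchy, cauchy]
  have : ∀ ζ, (z - ζ)⁻¹ * DSSoliton.dz v ζ = (1 / 2 : ℂ) * ((z - ζ)⁻¹ * fderiv ℝ v ζ 1
      - Complex.I * ((z - ζ)⁻¹ * fderiv ℝ v ζ Complex.I)) := fun ζ => by
    rw [DSSoliton.dz]; ring
  simp only [this]
  rw [integral_const_mul, integral_sub (hi 1) ((hi _).const_mul _), integral_const_mul]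
  ring

theorem cauchy_dbar (hv : IsTest v) (z : ℂ) : cauchy (DSSoliton.dbar v) z = v z := by
  obtain ⟨C₁, h₁⟩ := hv.bound 3
  obtain ⟨C₂, h₂⟩ := hv.dbar.bound 3
  refine cauchy_dbar_of_decay (c := max C₁ C₂) (s := 3) (b := 3) (hv.1.of_le (by simp))
    (by norm_num) (by norm_num) (fun w => (h₁ w).trans ?_) (fun w => (h₂ w).trans ?_) z
  · exact mul_le_mul_of_nonneg_right (le_max_left _ _) (wt_nonneg _ _)
  · exact mul_le_mul_of_nonneg_right (le_max_right _ _) (wt_nonneg _ _)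

theorem dbar_cauchy (hv : IsTest v) (z : ℂ) : DSSoliton.dbar (cauchy v) z = v z := by
  have hi : ∀ e, Integrable fun ζ => (z - ζ)⁻¹ * fderiv ℝ v ζ e := fun e => by
    obtain ⟨C, hC⟩ := (hv.fderiv_apply e).bound 3
    exact integrable_inv_sub_mul (hv.fderiv_apply e).continuous.aestronglyMeasurable
      (by norm_num : (1 : ℝ) < 3) (Eventually.of_forall hC) z
  rw [← hv.cauchy_dbar z]
  rw [DSSoliton.dbar, hv.fderiv_cauchy, hv.fderiv_cauchy, cauchy, cauchy, cauchy]
  have : ∀ ζ, (z - ζ)⁻¹ * DSSoliton.dbar v ζ = (1 / 2 : ℂ) * ((z - ζ)⁻¹ * fderiv ℝ v ζ 1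
      + Complex.I * ((z - ζ)⁻¹ * fderiv ℝ v ζ Complex.I)) := fun ζ => by
    rw [DSSoliton.dbar]; ring
  simp only [this]
  rw [integral_const_mul, integral_add (hi 1) ((hi _).const_mul _), integral_const_mul]
  ring

theorem exists_norm_cauchy_le (hv : IsTest v) : ∃ C : ℝ, ∀ z, ‖cauchy v z‖ ≤ C * wt 1 z := by
  obtain ⟨C, -, hC⟩ := DSSoliton.exists_norm_cauchy_le (b := 3) (s := 1) zero_le_one le_rfl
    (by norm_num)
  obtain ⟨c, hc⟩ := hv.bound 3
  refine ⟨Real.pi⁻¹ * (C * c), fun z => ?_⟩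
  rw [cauchy, norm_mul, norm_inv, Complex.norm_real, Real.norm_of_nonneg Real.pi_pos.le, mul_assoc]
  exact mul_le_mul_of_nonneg_left (hC v c (Eventually.of_forall hc) z)
    (inv_nonneg.mpr Real.pi_pos.le)

/-- The Cauchy transform of `ζ v(ζ)` when `v` has mean zero. -/
theorem mul_cauchy (hv : IsTest v) (h0 : ∫ ζ, v ζ = 0) (z : ℂ) :
    z * cauchy v z = cauchy (fun ζ => ζ * v ζ) z := by
  obtain ⟨C, hC⟩ := hv.bound 3
  have hi := integrable_inv_sub_mul hv.continuous.aestronglyMeasurable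
      (by norm_num : (1 : ℝ) < 3) (Eventually.of_forall hC) z
  have h1 : z * ∫ ζ, (z - ζ)⁻¹ * v ζ = ∫ ζ, ((z - ζ)⁻¹ * (ζ * v ζ) + v ζ) := by
    rw [← integral_const_mul]
    refine integral_congr_ae ?_
    have hne : ∀ᵐ ζ : ℂ, ζ ≠ z := by
      simp [ae_iff, measure_singleton]
    filter_upwards [hne] with ζ hζ
    have : z - ζ ≠ 0 := sub_ne_zero.mpr hζ.symm
    field_simp
    ring
  have hv2 : IsTest fun ζ => ζ * v ζ := smooth_mul contDiff_id hv
  obtain ⟨C2, hC2⟩ := hv2.bound 3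
  have hi2 := integrable_inv_sub_mul hv2.continuous.aestronglyMeasurable
      (by norm_num : (1 : ℝ) < 3) (Eventually.of_forall hC2) z
  rw [cauchy, mul_left_comm, h1, integral_add hi2 hv.integrable, h0, add_zero, cauchy]

/-- Integration by parts for `∂̄`. -/
theorem integral_mul_dbar {H : ℂ → ℂ} (hH : ContDiff ℝ 1 H) (hv : IsTest v) :
    ∫ z, H z * DSSoliton.dbar v z = -∫ z, DSSoliton.dbar H z * v z := by
  have hH' : ∀ e, Continuous fun z => fderiv ℝ H z e := fun e =>
    (hH.continuous_fderiv one_ne_zero).clm_apply continuous_const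
  have i1 : ∀ e, Integrable fun z => H z * fderiv ℝ v z e := fun e =>
    (hH.continuous.mul (hv.fderiv_apply e).continuous).integrable_of_hasCompactSupport
      (hv.fderiv_apply e).2.mul_left
  have i2 : ∀ e, Integrable fun z => fderiv ℝ H z e * v z := fun e =>
    ((hH' e).mul hv.continuous).integrable_of_hasCompactSupport hv.2.mul_left
  have i3 : Integrable fun z => H z * v z :=
    (hH.continuous.mul hv.continuous).integrable_of_hasCompactSupport hv.2.mul_left
  have key : ∀ e, ∫ z, H z * fderiv ℝ v z e = -∫ z, fderiv ℝ H z e * v z := fun e =>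
    integral_mul_fderiv_eq_neg_fderiv_mul_of_integrable (i2 e) (i1 e) i3
      (fun x _ => hH.differentiable one_ne_zero x) (fun x _ => hv.differentiable x)
  have e1 : ∀ z, H z * DSSoliton.dbar v z = (1 / 2 : ℂ) * (H z * fderiv ℝ v z 1
      + Complex.I * (H z * fderiv ℝ v z Complex.I)) := fun z => by rw [DSSoliton.dbar]; ring
  have e2 : ∀ z, DSSoliton.dbar H z * v z = (1 / 2 : ℂ) * (fderiv ℝ H z 1 * v z
      + Complex.I * (fderiv ℝ H z Complex.I * v z)) := fun z => by rw [DSSoliton.dbar]; ring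
  simp only [e1, e2]
  rw [integral_const_mul, integral_const_mul, integral_add (i1 1) ((i1 _).const_mul _),
    integral_add (i2 1) ((i2 _).const_mul _), integral_const_mul, integral_const_mul, key, key]
  ring

end IsTest

/-! ### Cutoffs and Liouville theorems for weak solutions. -/

theorem dbar_congr {u v : ℂ → ℂ} {z : ℂ} (h : u =ᶠ[𝓝 z] v) : dbar u =ᶠ[𝓝 z] dbar v := by
  filter_upwards [h.fderiv (𝕜 := ℝ)] with w hw
  rw [dbar, dbar, hw]

theorem dz_congr {u v : ℂ → ℂ} {z : ℂ} (h : u =ᶠ[𝓝 z] v) : dz u =ᶠ[𝓝 z] dz v := by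
  filter_upwards [h.fderiv (𝕜 := ℝ)] with w hw
  rw [dz, dz, hw]

theorem HasW.comp_const_mul {v : ℂ → ℂ} {a b z : ℂ} (t : ℝ) (h : HasW v a b (t * z)) :
    HasW (fun w => v (t * w)) (t * a) (t * b) z := by
  have h1 : HasFDerivAt (fun w : ℂ => (t : ℂ) * w) (t • ContinuousLinearMap.id ℝ ℂ) z := by
    have := (hasFDerivAt_id (𝕜 := ℝ) z).const_mul (t : ℂ)
    refine this.congr_fderiv (ContinuousLinearMap.ext fun w => by simp)
  have h2 := HasFDerivAt.comp z h h1
  exact HasFDerivAt.congr_fderiv h2 (ContinuousLinearMap.ext fun w => by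
    simp [wirtinger_apply]; ring)

/-- Each derivative of a dilated bump `z ↦ b(tz)` produces a factor `t`; this inequality trades it
for a decay `ρ⁻¹` uniform in `t`. -/
theorem wt_one_scale {t : ℝ} (ht : 0 < t) (ht1 : t ≤ 1) (z : ℂ) : t * wt 1 (t * z) ≤ wt 1 z := by
  have h1 : t ^ 2 * rhoSq z ≤ rhoSq (t * z) := by
    unfold rhoSq
    rw [norm_mul, Complex.norm_real, Real.norm_of_nonneg ht.le]
    nlinarith [sq_nonneg ‖z‖]
  have h2 : wt 1 (t * z) ≤ (t ^ 2 * rhoSq z) ^ (-((1 : ℝ) / 2)) :=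
    Real.rpow_le_rpow_of_nonpos (by have := rhoSq_pos z; positivity) h1 (by norm_num)
  rw [Real.mul_rpow (by positivity) (rhoSq_pos z).le, ← Real.rpow_natCast t 2,
    ← Real.rpow_mul ht.le] at h2
  have h3 : t ^ (((2 : ℕ) : ℝ) * -((1 : ℝ) / 2)) = t⁻¹ := by
    rw [← Real.rpow_neg_one]; norm_num
  rw [h3] at h2
  calc t * wt 1 (t * z) ≤ t * (t⁻¹ * wt 1 z) := by gcongr; exact h2
    _ = wt 1 z := by field_simp

/-- A smooth even bump function. -/
noncomputable def bump (z : ℂ) : ℂ :=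
  ((⟨1, 2, one_pos, one_lt_two⟩ : ContDiffBump (0 : ℂ)) z : ℝ)

theorem isTest_bump : IsTest bump := by
  refine ⟨?_, ?_⟩
  · exact Complex.ofRealCLM.contDiff.comp
      (⟨1, 2, one_pos, one_lt_two⟩ : ContDiffBump (0 : ℂ)).contDiff
  · exact (⟨1, 2, one_pos, one_lt_two⟩ : ContDiffBump (0 : ℂ)).hasCompactSupport.comp_left
      (g := fun x : ℝ => (x : ℂ)) Complex.ofReal_zero

theorem norm_bump_le_one (z : ℂ) : ‖bump z‖ ≤ 1 := by
  rw [bump, Complex.norm_real, Real.norm_of_nonneg (ContDiffBump.nonneg _)]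
  exact ContDiffBump.le_one _

theorem bump_neg (z : ℂ) : bump (-z) = bump z := by
  rw [bump, bump, ContDiffBump.neg]

theorem bump_eq_one {z : ℂ} (hz : ‖z‖ ≤ 1) : bump z = 1 := by
  rw [bump, ContDiffBump.one_of_mem_closedBall _ (by simpa using hz), Complex.ofReal_one]

/-- Cutoff functions with scale-invariant derivative bounds. -/
theorem exists_cutoff : ∃ (χ : ℕ → ℂ → ℂ) (B : ℝ), 0 ≤ B ∧ (∀ n, IsTest (χ n)) ∧
    (∀ n z, ‖χ n z‖ ≤ 1) ∧ (∀ n z, ‖dbar (χ n) z‖ ≤ B * wt 1 z) ∧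
    (∀ n z, ‖dz (χ n) z‖ ≤ B * wt 1 z) ∧ (∀ n z, ‖dz (dbar (χ n)) z‖ ≤ B * wt 1 z) ∧
    ∀ z, ∀ᶠ n in atTop, χ n =ᶠ[𝓝 z] fun _ => 1 := by
  obtain ⟨B₁, h₁⟩ := isTest_bump.dbar.bound 1
  obtain ⟨B₂, h₂⟩ := isTest_bump.dz.bound 1
  obtain ⟨B₃, h₃⟩ := isTest_bump.dbar.dz.bound 1
  set B := max (max B₁ B₂) (max B₃ 0) with hB
  have hB0 : 0 ≤ B := (le_max_right _ _).trans (le_max_right _ _)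
  have hle : ∀ {c z}, c ≤ B → c * wt 1 z ≤ B * wt 1 z := fun h =>
    mul_le_mul_of_nonneg_right h (wt_nonneg _ _)
  have hB1 : B₁ ≤ B := (le_max_left _ _).trans (le_max_left _ _)
  have hB2 : B₂ ≤ B := (le_max_right _ _).trans (le_max_left _ _)
  have hB3 : B₃ ≤ B := (le_max_left _ _).trans (le_max_right _ _)
  set t : ℕ → ℝ := fun n => ((n : ℝ) + 1)⁻¹ with ht
  have ht0 : ∀ n, 0 < t n := fun n => by positivity
  have ht1 : ∀ n, t n ≤ 1 := fun n => inv_le_one_of_one_le₀ (by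
    have : (0 : ℝ) ≤ n := n.cast_nonneg
    linarith)
  have hscale : ∀ n (z : ℂ) (w : ℂ), ‖w‖ ≤ B * wt 1 (t n * z) → ‖t n * w‖ ≤ B * wt 1 z := by
    intro n z w hw
    rw [norm_mul, Complex.norm_real, Real.norm_of_nonneg (ht0 n).le]
    calc t n * ‖w‖ ≤ t n * (B * wt 1 (t n * z)) := by have := ht0 n; gcongr
      _ = B * (t n * wt 1 (t n * z)) := by ring
      _ ≤ B * wt 1 z := by gcongr; exact wt_one_scale (ht0 n) (ht1 n) z
  have hdbar : ∀ n, dbar (fun z => bump (t n * z)) = fun z => t n * dbar bump (t n * z) := fun n => by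
    ext z
    exact (HasW.comp_const_mul (t n) (isTest_bump.hasW (t n * z))).dbar_eq
  refine ⟨fun n z => bump (t n * z), B, hB0, fun n => ⟨?_, ?_⟩, fun n z => norm_bump_le_one _,
    fun n z => ?_, fun n z => ?_, fun n z => ?_, fun z => ?_⟩
  · exact isTest_bump.1.comp (contDiff_const.mul contDiff_id)
  · have h0 : (t n : ℂ) ≠ 0 := Complex.ofReal_ne_zero.mpr (ht0 n).ne'
    exact isTest_bump.2.comp_homeomorph (Homeomorph.mulLeft₀ (t n : ℂ) h0)
  · rw [hdbar]
    exact hscale n z _ ((h₁ _).trans (hle hB1))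
  · rw [(HasW.comp_const_mul (t n) (isTest_bump.hasW (t n * z))).dz_eq]
    exact hscale n z _ ((h₂ _).trans (hle hB2))
  · rw [hdbar, ((HasW.const (t n : ℂ) z).mul
      (HasW.comp_const_mul (t n) (isTest_bump.dbar.hasW (t n * z)))).dz_eq, zero_mul, zero_add,
      norm_mul, Complex.norm_real, Real.norm_of_nonneg (ht0 n).le]
    calc t n * ‖t n * dz (dbar bump) (t n * z)‖ ≤ 1 * (B * wt 1 z) :=
          mul_le_mul (ht1 n) (hscale n z _ ((h₃ _).trans (hle hB3))) (norm_nonneg _) zero_le_one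
      _ = _ := one_mul _
  · filter_upwards [eventually_ge_atTop (Nat.ceil (‖z‖ + 1))] with n hn
    have hball : Metric.ball z 1 ∈ 𝓝 z := Metric.ball_mem_nhds z one_pos
    filter_upwards [hball] with w hw
    refine bump_eq_one ?_
    rw [norm_mul, Complex.norm_real, Real.norm_of_nonneg (ht0 n).le, ht]
    have h1 : ‖z‖ + 1 ≤ n := Nat.ceil_le.mp hn
    have h2 : ‖w‖ ≤ ‖z‖ + 1 := by
      rw [Metric.mem_ball, dist_eq_norm] at hw
      have := norm_add_le (w - z) z
      rw [sub_add_cancel] at this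
      linarith
    rw [inv_mul_le_iff₀ (by positivity)]
    linarith

/-- Dominated convergence along cutoffs. -/
theorem integral_eq_zero_of_cutoff {h G : ℂ → ℂ} {g : ℕ → ℂ → ℂ} {K s : ℝ}
    (hh : Integrable fun z => wt s z * h z) (hg : ∀ n, Continuous (g n))
    (hbound : ∀ n z, ‖g n z‖ ≤ K * wt s z) (hlim : ∀ z, ∀ᶠ n in atTop, g n z = G z)
    (hzero : ∀ n, ∫ z, h z * g n z = 0) : ∫ z, h z * G z = 0 := by
  have hhm : AEStronglyMeasurable h volume := by
    have h1 : Continuous fun z => (((wt s z)⁻¹ : ℝ) : ℂ) :=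
      Complex.continuous_ofReal.comp ((continuous_wt s).inv₀ fun z => (wt_pos s z).ne')
    have h2 := h1.aestronglyMeasurable.mul hh.aestronglyMeasurable (μ := volume)
    refine h2.congr (Eventually.of_forall fun z => ?_)
    have h0 : (wt s z : ℂ) ≠ 0 := Complex.ofReal_ne_zero.mpr (wt_pos s z).ne'
    change (((wt s z)⁻¹ : ℝ) : ℂ) * ((wt s z : ℂ) * h z) = h z
    rw [Complex.ofReal_inv, inv_mul_cancel_left₀ h0]
  have ht : Tendsto (fun n => ∫ z, h z * g n z) atTop (𝓝 (∫ z, h z * G z)) := by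
    refine tendsto_integral_of_dominated_convergence (fun z => K * ‖wt s z * h z‖)
      (fun n => hhm.mul (hg n).aestronglyMeasurable) (hh.norm.const_mul K)
      (fun n => Eventually.of_forall fun z => ?_) (Eventually.of_forall fun z => ?_)
    · rw [norm_mul, norm_mul, Complex.norm_real, Real.norm_of_nonneg (wt_nonneg s z)]
      calc ‖h z‖ * ‖g n z‖ ≤ ‖h z‖ * (K * wt s z) := by gcongr; exact hbound n z
        _ = _ := by ring
    · refine tendsto_const_nhds.congr' ?_
      filter_upwards [hlim z] with n hn
      rw [hn]
  simp only [hzero] at ht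
  exact tendsto_nhds_unique ht tendsto_const_nhds |>.symm ▸ rfl

/-- The first-order operator adjoint to the Darboux factor of the soliton system. -/
noncomputable def darboux (κ : ℂ) (ψ : ℂ → ℂ) (z : ℂ) : ℂ :=
  -dz ψ z + (Complex.I * κ + conj z * (rhoSq z : ℂ)⁻¹) * ψ z

theorem continuous_darboux (κ : ℂ) {ψ : ℂ → ℂ} (hψ : IsTest ψ) : Continuous (darboux κ ψ) := by
  have h1 := hψ.dz.continuous
  have h2 := hψ.continuous
  have h3 : Continuous fun z => (rhoSq z : ℂ)⁻¹ := (contDiff_inv_rhoSq (n := 0)).continuous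
  have h4 : Continuous fun z : ℂ => conj z := Complex.continuous_conj
  unfold darboux
  fun_prop

theorem norm_conj_mul_inv_rhoSq_le (z : ℂ) : ‖conj z * (rhoSq z : ℂ)⁻¹‖ ≤ wt 1 z := by
  rw [norm_mul, RCLike.norm_conj, norm_inv_rhoSq]
  have := norm_mul_wt_le 2 z
  norm_num at this
  exact this

theorem norm_darboux_le (κ : ℂ) {ψ : ℂ → ℂ} {z : ℂ} {A B : ℝ} (h1 : ‖dz ψ z‖ ≤ A)
    (h2 : ‖ψ z‖ ≤ B) : ‖darboux κ ψ z‖ ≤ A + (‖κ‖ + 1) * B := by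
  have h3 : ‖Complex.I * κ + conj z * (rhoSq z : ℂ)⁻¹‖ ≤ ‖κ‖ + 1 := by
    refine (norm_add_le _ _).trans (add_le_add ?_ ?_)
    · rw [norm_mul, Complex.norm_I, one_mul]
    · exact (norm_conj_mul_inv_rhoSq_le z).trans (wt_le_one zero_le_one z)
  refine (norm_add_le _ _).trans (add_le_add (by rwa [norm_neg]) ?_)
  rw [norm_mul]
  gcongr

/-- A function annihilating all `L(∂̄ v)` annihilates all `L ψ`. -/
theorem integral_mul_darboux_eq_zero {h : ℂ → ℂ} {κ : ℂ} (hh : Integrable fun z => wt 2 z * h z)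
    (hw : ∀ v, IsTest v → ∫ z, h z * darboux κ (dbar v) z = 0) {ψ : ℂ → ℂ} (hψ : IsTest ψ) :
    ∫ z, h z * darboux κ ψ z = 0 := by
  obtain ⟨χ, B, hB, hχ, hχ1, hχb, hχz, hχzb, hχlim⟩ := exists_cutoff
  obtain ⟨A₁, hA₁⟩ := hψ.exists_norm_cauchy_le
  obtain ⟨A₂, hA₂⟩ := hψ.dz.exists_norm_cauchy_le
  obtain ⟨D₁, hD₁⟩ := hψ.bound 2
  obtain ⟨D₂, hD₂⟩ := hψ.dz.bound 2
  -- `ψ = ∂̄v`, but `v` is not compactly supported. Both `v` and `∂v` are `O(ρ⁻¹)`, as are the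
  -- derivatives of the cutoffs, so the truncation errors are `O(ρ⁻²)` uniformly in `n`. That is
  -- just enough against `h`.
  set v := cauchy ψ with hv
  have hvs : ContDiff ℝ ∞ v := hψ.contDiff_cauchy
  have hvd : Differentiable ℝ v := hvs.differentiable (by simp)
  have hvdbar : dbar v = ψ := funext hψ.dbar_cauchy
  have htest : ∀ n, IsTest fun z => χ n z * v z := fun n => (hχ n).mul_smooth hvs
  have hd : ∀ n, dbar (fun z => χ n z * v z) = fun z => dbar (χ n) z * v z + χ n z * ψ z := fun n => by
    ext z
    have := ((hχ n).hasW z).mul (HasW.of_differentiableAt (hvd z))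
    rw [this.dbar_eq, hvdbar]
  have hww : ∀ z, wt 1 z * wt 1 z = wt 2 z := fun z => by rw [← wt_add]; norm_num
  have hD₁0 : ∀ z, ‖ψ z‖ ≤ |D₁| * wt 2 z := fun z =>
    (hD₁ z).trans (mul_le_mul_of_nonneg_right (le_abs_self _) (wt_nonneg _ _))
  have hvz : ∀ z, ‖dz v z‖ ≤ A₂ * wt 1 z := fun z => by rw [hv, hψ.dz_cauchy]; exact hA₂ z
  refine integral_eq_zero_of_cutoff hh (g := fun n => darboux κ (dbar fun z => χ n z * v z))
    (K := (B * A₁ + B * A₂ + B * |D₁| + D₂) + (‖κ‖ + 1) * (B * A₁ + |D₁|))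
    (fun n => continuous_darboux κ (htest n).dbar) (fun n z => ?_) (fun z => ?_)
    (fun n => hw _ (htest n))
  · have hb1 : ‖dbar (fun z => χ n z * v z) z‖ ≤ (B * A₁ + |D₁|) * wt 2 z := by
      rw [hd]
      calc ‖dbar (χ n) z * v z + χ n z * ψ z‖
          ≤ (B * wt 1 z) * (A₁ * wt 1 z) + 1 * (|D₁| * wt 2 z) := by
            refine (norm_add_le _ _).trans (add_le_add ?_ ?_)
            · rw [norm_mul]
              exact mul_le_mul (hχb n z) (hA₁ z) (norm_nonneg _) ((norm_nonneg _).trans (hχb n z))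
            · rw [norm_mul]
              exact mul_le_mul (hχ1 n z) (hD₁0 z) (norm_nonneg _) zero_le_one
        _ = _ := by rw [← hww]; ring
    have hb2 : ‖dz (dbar fun z => χ n z * v z) z‖
        ≤ (B * A₁ + B * A₂ + B * |D₁| + D₂) * wt 2 z := by
      rw [hd, (((hχ n).dbar.hasW z).mul (HasW.of_differentiableAt (hvd z))).add
        (((hχ n).hasW z).mul (hψ.hasW z)) |>.dz_eq]
      calc ‖dz (dbar (χ n)) z * v z + dbar (χ n) z * dz v z + (dz (χ n) z * ψ z + χ n z * dz ψ z)‖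
          ≤ (B * wt 1 z) * (A₁ * wt 1 z) + (B * wt 1 z) * (A₂ * wt 1 z)
            + ((B * 1) * (|D₁| * wt 2 z) + 1 * (D₂ * wt 2 z)) := by
            refine (norm_add_le _ _).trans (add_le_add ((norm_add_le _ _).trans (add_le_add ?_ ?_))
              ((norm_add_le _ _).trans (add_le_add ?_ ?_))) <;> rw [norm_mul]
            · exact mul_le_mul (hχzb n z) (hA₁ z) (norm_nonneg _) ((norm_nonneg _).trans (hχzb n z))
            · exact mul_le_mul (hχb n z) (hvz z) (norm_nonneg _) ((norm_nonneg _).trans (hχb n z))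
            · exact mul_le_mul ((hχz n z).trans (mul_le_mul_of_nonneg_left
                (wt_le_one zero_le_one z) hB)) (hD₁0 z) (norm_nonneg _) (by linarith)
            · exact mul_le_mul (hχ1 n z) (hD₂ z) (norm_nonneg _) zero_le_one
        _ = _ := by rw [← hww]; ring
    calc _ ≤ _ := norm_darboux_le κ hb2 hb1
      _ = _ := by ring
  · filter_upwards [hχlim z] with n hn
    have h1 : (fun z => χ n z * v z) =ᶠ[𝓝 z] v := by
      filter_upwards [hn] with w hw
      rw [hw, one_mul]
    have h2 : dbar (fun z => χ n z * v z) =ᶠ[𝓝 z] ψ := by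
      have := dbar_congr h1
      rwa [hvdbar] at this
    simp only [darboux]
    rw [(dz_congr h2).eq_of_nhds, h2.eq_of_nhds]

theorem integral_odd_eq_zero {f : ℂ → ℂ} (hf : ∀ z, f (-z) = -f z) : ∫ z, f z = 0 := by
  have h1 := integral_neg_eq_self f volume
  simp only [hf] at h1
  rw [integral_neg] at h1
  exact self_eq_neg.mp h1.symm

theorem integral_bump_ne_zero : ∫ z, bump z ≠ 0 ∧ ∫ z, z * (conj z * bump z) ≠ 0 := by
  set b : ContDiffBump (0 : ℂ) := ⟨1, 2, one_pos, one_lt_two⟩ with hb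
  have hb1 : b 1 = 1 := b.one_of_mem_closedBall (by simp [hb])
  constructor
  · have h : ∫ z, bump z = ((∫ z, b z : ℝ) : ℂ) := integral_ofReal
    rw [h, Complex.ofReal_ne_zero]
    exact (b.continuous.integral_pos_of_hasCompactSupport_nonneg_nonzero b.hasCompactSupport
      (fun z => b.nonneg) (x := 1) (by rw [hb1]; exact one_ne_zero)).ne'
  · have h : ∫ z, z * (conj z * bump z) = ((∫ z, ‖z‖ ^ 2 * b z : ℝ) : ℂ) := by
      refine Eq.trans ?_ (integral_ofReal (𝕜 := ℂ) (f := fun z : ℂ => ‖z‖ ^ 2 * b z))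
      refine integral_congr_ae (Eventually.of_forall fun z => ?_)
      change z * (conj z * ((b z : ℝ) : ℂ)) = ((‖z‖ ^ 2 * b z : ℝ) : ℂ)
      rw [← mul_assoc, Complex.mul_conj, Complex.normSq_eq_norm_sq, Complex.ofReal_mul]
    rw [h, Complex.ofReal_ne_zero]
    have hc : Continuous fun z : ℂ => ‖z‖ ^ 2 * b z := (continuous_norm.pow 2).mul b.continuous
    have hs : HasCompactSupport fun z : ℂ => ‖z‖ ^ 2 * b z := b.hasCompactSupport.mul_left
    have h1 : ‖(1 : ℂ)‖ ^ 2 * b 1 ≠ 0 := by rw [hb1, norm_one]; norm_num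
    have h2 : (0 : ℂ → ℝ) ≤ fun z : ℂ => ‖z‖ ^ 2 * b z := fun z =>
      mul_nonneg (sq_nonneg ‖z‖) b.nonneg
    exact (hc.integral_pos_of_hasCompactSupport_nonneg_nonzero hs h2 h1).ne'

/-- Each vanishing moment lets a factor `z` pass inside the Cauchy transform; two of them improve
the generic decay `ρ⁻¹` to `ρ⁻³`. -/
theorem IsTest.exists_norm_cauchy_le_three {v : ℂ → ℂ} (hv : IsTest v) (h0 : ∫ ζ, v ζ = 0)
    (h1 : ∫ ζ, ζ * v ζ = 0) : ∃ C : ℝ, 0 ≤ C ∧ ∀ z, ‖cauchy v z‖ ≤ C * wt 3 z := by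
  have hv1 : IsTest fun ζ => ζ * v ζ := IsTest.smooth_mul contDiff_id hv
  have hv2 : IsTest fun ζ => ζ * (ζ * v ζ) := IsTest.smooth_mul contDiff_id hv1
  obtain ⟨A, hA⟩ := hv.exists_norm_cauchy_le
  obtain ⟨B, hB⟩ := hv2.exists_norm_cauchy_le
  have key : ∀ z, ‖cauchy v z‖ ≤ (A + B) * wt 3 z := fun z => by
    have e : z * (z * cauchy v z) = cauchy (fun ζ => ζ * (ζ * v ζ)) z := by
      rw [hv.mul_cauchy h0, hv1.mul_cauchy h1]
    have h2 := hB z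
    rw [← e, norm_mul, norm_mul] at h2
    have h3 : rhoSq z * ‖cauchy v z‖ ≤ (A + B) * wt 1 z := by
      have := hA z
      unfold rhoSq
      nlinarith
    have h4 : wt 3 z = (rhoSq z)⁻¹ * wt 1 z := by
      rw [← wt_two, ← wt_add]; norm_num
    rw [h4, mul_left_comm]
    exact (le_inv_mul_iff₀ (rhoSq_pos z)).mpr h3
  refine ⟨A + B, ?_, key⟩
  have := (norm_nonneg _).trans (key 0)
  exact nonneg_of_mul_nonneg_left this (wt_pos _ _)

/-- Here `v = ∂̄η` with `η = C[v] = O(ρ⁻³)`, so truncating `η` leaves an error `O(ρ⁻⁴)`, the most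
that `y` allows. -/
theorem integral_mul_eq_zero_of_moments {y : ℂ → ℂ} (hy : Integrable fun z => wt 4 z * y z)
    (hw : ∀ v, IsTest v → ∫ z, y z * dbar v z = 0) {v : ℂ → ℂ} (hv : IsTest v)
    (h0 : ∫ ζ, v ζ = 0) (h1 : ∫ ζ, ζ * v ζ = 0) : ∫ z, y z * v z = 0 := by
  obtain ⟨χ, B, hB, hχ, hχ1, hχb, -, -, hχlim⟩ := exists_cutoff
  obtain ⟨C, hC, hCv⟩ := hv.exists_norm_cauchy_le_three h0 h1
  obtain ⟨D, hD⟩ := hv.bound 4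
  set η := cauchy v with hη
  have hηs : ContDiff ℝ ∞ η := hv.contDiff_cauchy
  have hηd : Differentiable ℝ η := hηs.differentiable (by simp)
  have htest : ∀ n, IsTest fun z => χ n z * η z := fun n => (hχ n).mul_smooth hηs
  have hd : ∀ n z, dbar (fun z => χ n z * η z) z = dbar (χ n) z * η z + χ n z * v z := fun n z => by
    have := ((hχ n).hasW z).mul (HasW.of_differentiableAt (hηd z))
    rw [this.dbar_eq, hη, hv.dbar_cauchy]
  refine integral_eq_zero_of_cutoff hy (g := fun n => dbar fun z => χ n z * η z) (K := B * C + D)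
    (fun n => (htest n).dbar.continuous) (fun n z => ?_) (fun z => ?_) (fun n => hw _ (htest n))
  · rw [hd]
    have hww : wt 1 z * wt 3 z = wt 4 z := by rw [← wt_add]; norm_num
    calc ‖dbar (χ n) z * η z + χ n z * v z‖
        ≤ (B * wt 1 z) * (C * wt 3 z) + 1 * (D * wt 4 z) := by
          refine (norm_add_le _ _).trans (add_le_add ?_ ?_) <;> rw [norm_mul]
          · exact mul_le_mul (hχb n z) (hCv z) (norm_nonneg _) ((norm_nonneg _).trans (hχb n z))
          · exact mul_le_mul (hχ1 n z) (hD z) (norm_nonneg _) zero_le_one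
      _ = _ := by rw [← hww]; ring
  · filter_upwards [hχlim z] with n hn
    have h2 : dbar (χ n) z = 0 := by
      rw [(dbar_congr hn).eq_of_nhds, (HasW.const 1 z).dbar_eq]
    rw [hd, h2, hn.eq_of_nhds, zero_mul, zero_add, one_mul]

theorem aestronglyMeasurable_of_wt_mul {s : ℝ} {h : ℂ → ℂ}
    (hh : AEStronglyMeasurable (fun z => wt s z * h z) volume) : AEStronglyMeasurable h volume := by
  have h1 : Continuous fun z => (((wt s z)⁻¹ : ℝ) : ℂ) :=
    Complex.continuous_ofReal.comp ((continuous_wt s).inv₀ fun z => (wt_pos s z).ne')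
  refine (h1.aestronglyMeasurable.mul hh (μ := volume)).congr (Eventually.of_forall fun z => ?_)
  have h0 : (wt s z : ℂ) ≠ 0 := Complex.ofReal_ne_zero.mpr (wt_pos s z).ne'
  change (((wt s z)⁻¹ : ℝ) : ℂ) * ((wt s z : ℂ) * h z) = h z
  rw [Complex.ofReal_inv, inv_mul_cancel_left₀ h0]

theorem integrable_mul_of_wt_mul {s K : ℝ} {h g : ℂ → ℂ} (hh : Integrable fun z => wt s z * h z)
    (hg : AEStronglyMeasurable g volume) (hb : ∀ᵐ z, ‖g z‖ ≤ K * wt s z) :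
    Integrable fun z => h z * g z := by
  refine (hh.norm.const_mul K).mono'
    ((aestronglyMeasurable_of_wt_mul hh.aestronglyMeasurable).mul hg) ?_
  filter_upwards [hb] with z hz
  rw [norm_mul, norm_mul, Complex.norm_real, Real.norm_of_nonneg (wt_nonneg s z)]
  calc ‖h z‖ * ‖g z‖ ≤ ‖h z‖ * (K * wt s z) := by gcongr
    _ = _ := by ring

theorem IsTest.integrable_mul {s : ℝ} {h v : ℂ → ℂ} (hv : IsTest v)
    (hh : Integrable fun z => wt s z * h z) : Integrable fun z => h z * v z := by
  obtain ⟨K, hK⟩ := hv.bound s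
  exact integrable_mul_of_wt_mul hh hv.continuous.aestronglyMeasurable (Eventually.of_forall hK)

/-- A function of moderate growth that annihilates all test functions vanishes. -/
theorem ae_eq_zero_of_integral_test {s : ℝ} {y : ℂ → ℂ} (hy : Integrable fun z => wt s z * y z)
    (h : ∀ v, IsTest v → ∫ z, y z * v z = 0) : ∀ᵐ z, y z = 0 := by
  have hl := (ae_eq_zero_of_integral_contDiff_smul_eq_zero hy.locallyIntegrable fun g hg hc => ?_)
  · filter_upwards [hl] with z hz
    exact (mul_eq_zero.mp hz).resolve_left (Complex.ofReal_ne_zero.mpr (wt_pos s z).ne')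
  · have hwt : ContDiff ℝ ∞ fun z => (wt s z : ℂ) := by
      refine Complex.ofRealCLM.contDiff.comp ?_
      change ContDiff ℝ ∞ fun z : ℂ => (1 + ‖z‖ ^ 2) ^ (-(s / 2))
      refine ContDiff.rpow_const_of_ne ?_ fun z => (rhoSq_pos z).ne'
      exact contDiff_const.add (contDiff_norm_sq ℝ)
    have ht : IsTest fun z => (wt s z : ℂ) * (g z : ℂ) := by
      refine IsTest.smooth_mul hwt ⟨Complex.ofRealCLM.contDiff.comp hg, ?_⟩
      exact hc.comp_left (g := fun x : ℝ => (x : ℂ)) Complex.ofReal_zero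
    rw [← h _ ht]
    refine integral_congr_ae (Eventually.of_forall fun z => ?_)
    simp only [Complex.real_smul]
    ring

theorem integral_test_neg_comb {v φ₀ φ₁ : ℂ → ℂ} {a b : ℂ} (hv : Integrable v)
    (h₀ : Integrable φ₀) (h₁ : Integrable φ₁) :
    ∫ z, (v z + (-a * φ₀ z + -b * φ₁ z)) = (∫ z, v z) - a * (∫ z, φ₀ z) - b * ∫ z, φ₁ z := by
  have h2 : Integrable fun z => -a * φ₀ z + -b * φ₁ z := (h₀.const_mul _).add (h₁.const_mul _)
  rw [integral_add hv h2, integral_add (h₀.const_mul _) (h₁.const_mul _), integral_const_mul, integral_const_mul]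
  ring

/-- Weakly holomorphic functions of moderate growth are affine. -/
theorem exists_affine_of_weakly_holomorphic {y : ℂ → ℂ} (hy : Integrable fun z => wt 4 z * y z)
    (hw : ∀ v, IsTest v → ∫ z, y z * dbar v z = 0) :
    ∃ c₀ c₁ : ℂ, ∀ᵐ z, y z = c₀ + c₁ * z := by
  obtain ⟨hm₀, hm₁⟩ := integral_bump_ne_zero
  set m₀ := ∫ z, bump z
  set m₁ := ∫ z, z * (conj z * bump z)
  -- By parity of `bump`, the pair `bump`, `z̄ bump` has a diagonal matrix of moments against `1`
  -- and `z`. The affine coefficients can therefore be read off by pairing `y` with these two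
  -- functions.
  set φ₁ : ℂ → ℂ := fun z => conj z * bump z with hφ₁
  have t0 : IsTest bump := isTest_bump
  have t1 : IsTest φ₁ := IsTest.smooth_mul contDiff_conj t0
  have o1 : ∫ z, φ₁ z = 0 := integral_odd_eq_zero fun z => by simp [hφ₁, bump_neg]
  have o0 : ∫ z, z * bump z = 0 := integral_odd_eq_zero fun z => by simp [bump_neg]
  refine ⟨(∫ z, y z * bump z) / m₀, (∫ z, y z * φ₁ z) / m₁, ?_⟩
  set c₀ := (∫ z, y z * bump z) / m₀ with hc₀
  set c₁ := (∫ z, y z * φ₁ z) / m₁ with hc₁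
  have hy' : Integrable fun z => wt 4 z * (y z - (c₀ + c₁ * z)) := by
    have h1 : Integrable fun z => (wt 4 z : ℂ) * (c₀ + c₁ * z) := by
      refine ((integrable_wt (s := 3) (by norm_num)).const_mul (‖c₀‖ + ‖c₁‖)).mono' ?_
        (Eventually.of_forall fun z => ?_)
      · exact ((Complex.continuous_ofReal.comp (continuous_wt 4)).mul (by fun_prop)).aestronglyMeasurable
      · rw [norm_mul, Complex.norm_real, Real.norm_of_nonneg (wt_nonneg 4 z)]
        have e1 := norm_mul_wt_le 4 z
        norm_num at e1
        have e2 : wt 4 z ≤ wt 3 z := wt_anti (by norm_num) z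
        have e3 : ‖c₀ + c₁ * z‖ ≤ ‖c₀‖ + ‖c₁‖ * ‖z‖ := (norm_add_le _ _).trans_eq (by rw [norm_mul])
        calc wt 4 z * ‖c₀ + c₁ * z‖ ≤ wt 4 z * (‖c₀‖ + ‖c₁‖ * ‖z‖) := by
              gcongr; exact wt_nonneg _ _
          _ = ‖c₀‖ * wt 4 z + ‖c₁‖ * (‖z‖ * wt 4 z) := by ring
          _ ≤ ‖c₀‖ * wt 3 z + ‖c₁‖ * wt 3 z := by gcongr
          _ = _ := by ring
    refine (hy.sub h1).congr (Eventually.of_forall fun z => ?_)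
    simp only [Pi.sub_apply]
    ring
  have := ae_eq_zero_of_integral_test hy' fun v hv => ?_
  · filter_upwards [this] with z hz
    exact sub_eq_zero.mp hz
  -- Subtracting `a bump + b φ₁` from `v` kills both moments, so the previous lemma determines `∫ y
  -- v` from the two reference pairings.
  set a := (∫ z, v z) / m₀ with ha
  set b := (∫ z, z * v z) / m₁ with hb
  have hzv : IsTest fun z => z * v z := IsTest.smooth_mul contDiff_id hv
  have hz0 : IsTest fun z => z * bump z := IsTest.smooth_mul contDiff_id t0
  have hz1 : IsTest fun z => z * φ₁ z := IsTest.smooth_mul contDiff_id t1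
  have hm1' : ∫ z, z * φ₁ z = m₁ := rfl
  have htest : IsTest fun z => v z + (-a * bump z + -b * φ₁ z) :=
    hv.add ((t0.const_mul _).add (t1.const_mul _))
  have k0 : ∫ z, (v z + (-a * bump z + -b * φ₁ z)) = 0 := by
    rw [integral_test_neg_comb hv.integrable t0.integrable t1.integrable, o1, ha,
      div_mul_cancel₀ _ hm₀]
    ring
  have k1 : ∫ z, z * (v z + (-a * bump z + -b * φ₁ z)) = 0 := by
    have := integral_test_neg_comb (a := a) (b := b) hzv.integrable hz0.integrable hz1.integrable
    rw [o0, hm1', hb, div_mul_cancel₀ _ hm₁] at this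
    refine Eq.trans (integral_congr_ae (Eventually.of_forall fun z => ?_)) (this.trans (by ring))
    simp only []
    ring
  have k2 := integral_mul_eq_zero_of_moments hy hw htest k0 k1
  have i0 := t0.integrable_mul hy
  have i1 := t1.integrable_mul hy
  have iv := hv.integrable_mul hy
  have k3 := integral_test_neg_comb (a := a) (b := b) iv i0 i1
  have k4 : (∫ z, y z * v z) - a * (∫ z, y z * bump z) - b * ∫ z, y z * φ₁ z = 0 := by
    rw [← k3, ← k2]
    refine integral_congr_ae (Eventually.of_forall fun z => ?_)
    simp only []
    ring
  have k5 : ∫ z, (y z - (c₀ + c₁ * z)) * v z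
      = (∫ z, y z * v z) - c₀ * (∫ z, v z) - c₁ * ∫ z, z * v z := by
    have := integral_test_neg_comb (a := c₀) (b := c₁) iv hv.integrable hzv.integrable
    rw [← this]
    refine integral_congr_ae (Eventually.of_forall fun z => ?_)
    simp only []
    ring
  rw [k5, ← k4, ha, hb, hc₀, hc₁]
  ring

/-! ### Fixed points of the soliton operator. -/

theorem IsTest.dbar_star {v : ℂ → ℂ} (hv : IsTest v) (z : ℂ) :
    DSSoliton.dbar (fun w => conj (v w)) z = conj (DSSoliton.dz v z) := (hv.hasW z).star.dbar_eq

theorem IsTest.dz_star {v : ℂ → ℂ} (hv : IsTest v) (z : ℂ) :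
    DSSoliton.dz (fun w => conj (v w)) z = conj (DSSoliton.dbar v z) := (hv.hasW z).star.dz_eq

theorem IsTest.cauchyBar_dz {v : ℂ → ℂ} (hv : IsTest v) (z : ℂ) :
    cauchyBar (DSSoliton.dz v) z = v z := by
  rw [cauchyBar_eq]
  have : (fun w => conj (DSSoliton.dz v w)) = DSSoliton.dbar fun w => conj (v w) :=
    funext fun w => (hv.dbar_star w).symm
  rw [this, hv.star.cauchy_dbar, Complex.conj_conj]

theorem cauchy_linear {F G : ℂ → ℂ} (hF : AEStronglyMeasurable F volume)
    (hG : AEStronglyMeasurable G volume) {c d b : ℝ} (hb : 1 < b) (hFb : ∀ᵐ z, ‖F z‖ ≤ c * wt b z)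
    (hGb : ∀ᵐ z, ‖G z‖ ≤ d * wt b z) (m n z : ℂ) :
    cauchy (fun w => m * F w + n * G w) z = m * cauchy F z + n * cauchy G z := by
  have h1 := integrable_inv_sub_mul hF hb hFb z
  have h2 := integrable_inv_sub_mul hG hb hGb z
  unfold cauchy
  have h3 : ∫ ζ, (z - ζ)⁻¹ * (m * F ζ + n * G ζ) =
      m * (∫ ζ, (z - ζ)⁻¹ * F ζ) + n * ∫ ζ, (z - ζ)⁻¹ * G ζ := by
    rw [← integral_const_mul, ← integral_const_mul, ← integral_add (h1.const_mul _) (h2.const_mul _)]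
    refine integral_congr_ae (Eventually.of_forall fun ζ => ?_)
    ring
  rw [h3]
  ring

theorem cauchyBar_linear {F G : ℂ → ℂ} (hF : AEStronglyMeasurable F volume)
    (hG : AEStronglyMeasurable G volume) {c d b : ℝ} (hb : 1 < b) (hFb : ∀ᵐ z, ‖F z‖ ≤ c * wt b z)
    (hGb : ∀ᵐ z, ‖G z‖ ≤ d * wt b z) (m n z : ℂ) :
    cauchyBar (fun w => m * F w + n * G w) z = m * cauchyBar F z + n * cauchyBar G z := by
  simp only [cauchyBar_eq, map_add, map_mul]
  rw [cauchy_linear (Complex.continuous_conj.comp_aestronglyMeasurable hF)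
    (Complex.continuous_conj.comp_aestronglyMeasurable hG) hb (c := c) (d := d)]
  · simp
  · simpa only [Function.comp_apply, RCLike.norm_conj] using hFb
  · simpa only [Function.comp_apply, RCLike.norm_conj] using hGb

theorem stronglyMeasurable_cauchyBar {F : ℂ → ℂ} (hF : AEStronglyMeasurable F volume) :
    StronglyMeasurable (cauchyBar F) := by
  have : cauchyBar F = fun z => conj (cauchy (fun w => conj (F w)) z) := funext (cauchyBar_eq F)
  rw [this]
  exact Complex.continuous_conj.comp_stronglyMeasurable
    (stronglyMeasurable_cauchy (Complex.continuous_conj.comp_aestronglyMeasurable hF))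

theorem cauchyBar_congr {F G : ℂ → ℂ} (h : F =ᵐ[volume] G) : cauchyBar F = cauchyBar G := by
  ext z
  unfold cauchyBar
  congr 1
  refine integral_congr_ae ?_
  filter_upwards [h] with w hw
  rw [hw]

theorem cauchy_congr {F G : ℂ → ℂ} (h : F =ᵐ[volume] G) : cauchy F = cauchy G := by
  ext z
  unfold cauchy
  congr 1
  refine integral_congr_ae ?_
  filter_upwards [h] with w hw
  rw [hw]

/-- A fixed point of the scattering operator of the soliton, together with the companion
Cauchy transform. -/
structure IsFixedPair (κ : ℂ) (h : ℂ → ℂ) : Prop where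
  integrable : Integrable fun z => wt 2 z * h z
  bounded : ∃ B : ℝ, ∀ z, ‖cauchyBar (fun w => expo κ w * (rhoSq w : ℂ)⁻¹ * h w) z‖ ≤ B
  fixed : ∀ᵐ z, h z = -cauchy (fun ζ => (rhoSq ζ : ℂ)⁻¹ * expo (-κ) ζ *
    cauchyBar (fun w => expo κ w * (rhoSq w : ℂ)⁻¹ * h w) ζ) z

theorem continuous_inv_rhoSq : Continuous fun z => (rhoSq z : ℂ)⁻¹ :=
  (contDiff_inv_rhoSq (n := 0)).continuous

theorem continuous_expo (k : ℂ) : Continuous (expo k) := (contDiff_expo k (n := 0)).continuous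

namespace IsFixedPair

variable {κ : ℂ} {h : ℂ → ℂ}

theorem aestronglyMeasurable (H : IsFixedPair κ h) : AEStronglyMeasurable h volume :=
  aestronglyMeasurable_of_wt_mul H.integrable.aestronglyMeasurable

theorem aestronglyMeasurable_inner (H : IsFixedPair κ h) :
    AEStronglyMeasurable (fun w => expo κ w * (rhoSq w : ℂ)⁻¹ * h w) volume :=
  ((continuous_expo κ).mul continuous_inv_rhoSq).aestronglyMeasurable.mul H.aestronglyMeasurable

theorem aestronglyMeasurable_outer (H : IsFixedPair κ h) :
    AEStronglyMeasurable (fun ζ => (rhoSq ζ : ℂ)⁻¹ * expo (-κ) ζ *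
      cauchyBar (fun w => expo κ w * (rhoSq w : ℂ)⁻¹ * h w) ζ) volume :=
  (continuous_inv_rhoSq.mul (continuous_expo (-κ))).aestronglyMeasurable.mul
    (stronglyMeasurable_cauchyBar H.aestronglyMeasurable_inner).aestronglyMeasurable

theorem exists_outer_bound (H : IsFixedPair κ h) : ∃ B : ℝ, ∀ ζ, ‖(rhoSq ζ : ℂ)⁻¹ * expo (-κ) ζ *
    cauchyBar (fun w => expo κ w * (rhoSq w : ℂ)⁻¹ * h w) ζ‖ ≤ B * wt 2 ζ := by
  obtain ⟨B, hB⟩ := H.bounded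
  refine ⟨B, fun ζ => ?_⟩
  rw [norm_mul, norm_mul, norm_inv_rhoSq, norm_expo, mul_one, mul_comm]
  exact mul_le_mul_of_nonneg_right (hB ζ) (wt_nonneg _ _)

/-- Bootstrap: the companion transform is bounded, so the outer density is `O(ρ⁻²)`, and its Cauchy
transform is bounded. -/
theorem exists_bound (H : IsFixedPair κ h) : ∃ C : ℝ, ∀ᵐ z, ‖h z‖ ≤ C := by
  obtain ⟨B, hB⟩ := H.exists_outer_bound
  obtain ⟨C, hC, hCb⟩ := exists_norm_cauchy_le (b := 2) (s := 0) le_rfl zero_le_one (by norm_num)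
  refine ⟨‖(Real.pi : ℂ)⁻¹‖ * (C * B * 1), ?_⟩
  filter_upwards [H.fixed] with z hz
  rw [hz, norm_neg, cauchy, norm_mul, ← wt_zero z]
  gcongr
  exact hCb _ B (Eventually.of_forall hB) z

theorem exists_inner_bound (H : IsFixedPair κ h) : ∃ C : ℝ, ∀ᵐ z,
    ‖expo κ z * (rhoSq z : ℂ)⁻¹ * h z‖ ≤ C * wt 2 z := by
  obtain ⟨C, hC⟩ := H.exists_bound
  refine ⟨C, ?_⟩
  filter_upwards [hC] with z hz
  rw [norm_mul, norm_mul, norm_inv_rhoSq, norm_expo, one_mul, mul_comm]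
  exact mul_le_mul_of_nonneg_right hz (wt_nonneg _ _)

/-- The weak form of `∂̄h = -ρ⁻² e_{-κ} G`, where `G` is the companion transform. -/
theorem integral_mul_dbar (H : IsFixedPair κ h) {v : ℂ → ℂ} (hv : IsTest v) :
    ∫ z, h z * dbar v z = ∫ ζ, (rhoSq ζ : ℂ)⁻¹ * expo (-κ) ζ *
      cauchyBar (fun w => expo κ w * (rhoSq w : ℂ)⁻¹ * h w) ζ * v ζ := by
  obtain ⟨B, hB⟩ := H.exists_outer_bound
  have h1 := cauchy_duality H.aestronglyMeasurable_outer one_lt_two (Eventually.of_forall hB)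
    hv.dbar.integrable
  simp only [hv.cauchy_dbar] at h1
  rw [← neg_eq_iff_eq_neg, ← integral_neg] at h1
  rw [← h1]
  refine integral_congr_ae ?_
  filter_upwards [H.fixed] with z hz
  rw [← neg_mul, ← hz]

/-- The weak form of `∂G = e_κ ρ⁻² h`. -/
theorem integral_mul_dz (H : IsFixedPair κ h) {v : ℂ → ℂ} (hv : IsTest v) :
    ∫ z, cauchyBar (fun w => expo κ w * (rhoSq w : ℂ)⁻¹ * h w) z * dz v z =
      -∫ ζ, expo κ ζ * (rhoSq ζ : ℂ)⁻¹ * h ζ * v ζ := by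
  obtain ⟨C, hC⟩ := H.exists_inner_bound
  have h1 := cauchyBar_duality H.aestronglyMeasurable_inner one_lt_two hC hv.dz.integrable
  rw [h1]
  simp only [hv.cauchyBar_dz]

theorem isTest_darboux {v : ℂ → ℂ} (hv : IsTest v) : IsTest (darboux κ v) := by
  have h1 : IsTest fun z => -1 * dz v z := hv.dz.const_mul (-1)
  have h2 : IsTest fun z => (Complex.I * κ + conj z * (rhoSq z : ℂ)⁻¹) * v z :=
    IsTest.smooth_mul (contDiff_const.add (contDiff_conj.mul contDiff_inv_rhoSq)) hv
  have h3 : darboux κ v = fun z => -1 * dz v z +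
      (Complex.I * κ + conj z * (rhoSq z : ℂ)⁻¹) * v z := funext fun z => by rw [darboux, neg_one_mul]
  rw [h3]
  exact h1.add h2

/-- The commutator is multiplication by `∂̄(z̄ρ⁻²) = ρ⁻⁴`. It equals the potential produced by
eliminating `G`, which is why the second-order equation factors. -/
theorem dbar_darboux {v : ℂ → ℂ} (hv : IsTest v) (z : ℂ) :
    dbar (darboux κ v) z = darboux κ (dbar v) z + ((rhoSq z : ℂ)⁻¹) ^ 2 * v z := by
  have h1 := ((hv.dz.hasW z).neg).add
    (((HasW.const (Complex.I * κ) z).add ((HasW.conj_id z).mul (HasW.inv_rhoSq z))).mul (hv.hasW z))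
  have h2 := h1.dbar_eq
  have h3 : (fun w => -dz v w + (Complex.I * κ + conj w * (rhoSq w : ℂ)⁻¹) * v w) = darboux κ v := rfl
  rw [h3] at h2
  rw [h2, darboux, ← hv.dz_dbar]
  have h0 := rhoSq_ne_zero z
  have hr := ofReal_rhoSq z
  field_simp
  rw [hr]
  ring

/-- Write `L` for the Darboux operator. The `∂̄`-equation is tested with `L v`, the `∂`-equation
with `ρ⁻² e_{-κ} v`, whose `∂` is `-ρ⁻² e_{-κ} L v`. The terms in `G` cancel, and the commutator
absorbs what remains. -/
theorem integral_mul_darboux_dbar (H : IsFixedPair κ h) {v : ℂ → ℂ} (hv : IsTest v) :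
    ∫ z, h z * darboux κ (dbar v) z = 0 := by
  have h1 := H.integral_mul_dbar (isTest_darboux (κ := κ) hv)
  have hw : IsTest fun z => (rhoSq z : ℂ)⁻¹ * expo (-κ) z * v z :=
    IsTest.smooth_mul (contDiff_inv_rhoSq.mul (contDiff_expo _)) hv
  have hdz : ∀ z, dz (fun z => (rhoSq z : ℂ)⁻¹ * expo (-κ) z * v z) z =
      -((rhoSq z : ℂ)⁻¹ * expo (-κ) z * darboux κ v z) := fun z => by
    rw [(((HasW.inv_rhoSq z).mul (HasW.expo (-κ) z)).mul (hv.hasW z)).dz_eq, darboux]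
    field_simp [rhoSq_ne_zero z]
    ring
  have h2 := H.integral_mul_dz hw
  simp only [hdz, mul_neg, integral_neg, neg_inj] at h2
  have hsq : IsTest fun z => ((rhoSq z : ℂ)⁻¹) ^ 2 * v z :=
    IsTest.smooth_mul (contDiff_inv_rhoSq.pow 2) hv
  have i1 := (isTest_darboux (κ := κ) hv).dbar.integrable_mul H.integrable
  have i2 := hsq.integrable_mul H.integrable
  have h3 : ∫ z, h z * darboux κ (dbar v) z = (∫ z, h z * dbar (darboux κ v) z) -
      ∫ z, h z * (((rhoSq z : ℂ)⁻¹) ^ 2 * v z) := by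
    rw [← integral_sub i1 i2]
    refine integral_congr_ae (Eventually.of_forall fun z => ?_)
    simp only [dbar_darboux hv]
    ring
  rw [h3, h1, sub_eq_zero]
  have e : ∀ ζ, expo κ ζ * (rhoSq ζ : ℂ)⁻¹ * h ζ * ((rhoSq ζ : ℂ)⁻¹ * expo (-κ) ζ * v ζ) =
      h ζ * (((rhoSq ζ : ℂ)⁻¹) ^ 2 * v ζ) := fun ζ => by
    have := expo_neg_mul_expo κ ζ
    linear_combination (h ζ * ((rhoSq ζ : ℂ)⁻¹) ^ 2 * v ζ) * this
  simp only [e] at h2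
  rw [← h2]
  refine integral_congr_ae (Eventually.of_forall fun z => ?_)
  ring

/-- The explicit form of the fixed points. -/
theorem exists_eq (H : IsFixedPair κ h) :
    ∃ c₀ c₁ : ℂ, ∀ᵐ z, h z = expo (-κ) z * (rhoSq z : ℂ)⁻¹ * (c₀ + c₁ * conj z) := by
  have hsm : ContDiff ℝ ∞ fun z => (rhoSq z : ℂ) * expo κ z := contDiff_rhoSq.mul (contDiff_expo κ)
  -- `ρ² e_κ h` is antiholomorphic, so its conjugate is the function to be shown affine; the factor
  -- `ρ²` moves the integrability weight from `ρ⁻²` to `ρ⁻⁴`.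
  have hy : Integrable fun z => (wt 4 z : ℂ) * conj (h z * ((rhoSq z : ℂ) * expo κ z)) := by
    refine H.integrable.norm.mono' ?_ (Eventually.of_forall fun z => ?_)
    · refine (Complex.continuous_ofReal.comp (continuous_wt 4)).aestronglyMeasurable.mul ?_
      exact Complex.continuous_conj.comp_aestronglyMeasurable
        (H.aestronglyMeasurable.mul hsm.continuous.aestronglyMeasurable)
    · rw [norm_mul, RCLike.norm_conj, norm_mul, norm_mul, norm_expo, mul_one, norm_mul,
        Complex.norm_real, Complex.norm_real, Complex.norm_real, Real.norm_of_nonneg (wt_nonneg _ _),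
        Real.norm_of_nonneg (wt_nonneg _ _), Real.norm_of_nonneg (rhoSq_pos z).le]
      have e : wt 4 z = (rhoSq z)⁻¹ * wt 2 z := by rw [← wt_two, ← wt_add]; norm_num
      rw [e]
      rw [mul_assoc, mul_comm]
      have := (rhoSq_pos z).ne'
      refine le_of_eq ?_
      field_simp
  have hlin := exists_affine_of_weakly_holomorphic hy fun v hv => ?_
  · obtain ⟨c₀, c₁, hc⟩ := hlin
    refine ⟨conj c₀, conj c₁, ?_⟩
    filter_upwards [hc] with z hz
    have h1 := congrArg conj hz
    rw [Complex.conj_conj, map_add, map_mul] at h1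
    rw [← h1]
    have h0 := rhoSq_ne_zero z
    have := expo_neg_mul_expo κ z
    field_simp
    linear_combination -(h z) * this
  -- `ρ² e_κ` solves the homogeneous Darboux equation, so on this test function only the derivative
  -- of `v̄` survives.
  · have hs : IsTest fun z => ((rhoSq z : ℂ) * expo κ z) * conj (v z) := IsTest.smooth_mul hsm hv.star
    have h1 := integral_mul_darboux_eq_zero H.integrable (fun v hv => H.integral_mul_darboux_dbar hv) hs
    have hd : ∀ z, darboux κ (fun z => ((rhoSq z : ℂ) * expo κ z) * conj (v z)) z =
        -((rhoSq z : ℂ) * expo κ z * conj (dbar v z)) := fun z => by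
      rw [darboux, (((HasW.rhoSq z).mul (HasW.expo κ z)).mul (hv.star.hasW z)).dz_eq, hv.dz_star]
      have h0 := rhoSq_ne_zero z
      field_simp
      ring
    simp only [hd, mul_neg, integral_neg, neg_eq_zero] at h1
    rw [← map_zero (starRingEnd ℂ), ← h1, ← integral_conj]
    refine integral_congr_ae (Eventually.of_forall fun z => ?_)
    simp only [map_mul, Complex.conj_conj]
    ring

/-- The explicit form `h = e_{-κ} ρ⁻² (c₀ + c₁ z̄)` gives `G = (c₀ z - c₁)ρ⁻²`, and direct
differentiation yields `∂̄h = -iκ̄h - ρ⁻² e_{-κ} G`. Comparison with the first-order equation leaves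
`iκ̄h = 0`. -/
theorem eq_zero (H : IsFixedPair κ h) (hκ : κ ≠ 0) : ∀ᵐ z, h z = 0 := by
  obtain ⟨c₀, c₁, hc⟩ := H.exists_eq
  have hG : cauchyBar (fun w => expo κ w * (rhoSq w : ℂ)⁻¹ * h w) =
      fun z => (c₀ * z - c₁) * (rhoSq z : ℂ)⁻¹ := by
    have h1 : (fun w => expo κ w * (rhoSq w : ℂ)⁻¹ * h w) =ᵐ[volume]
        fun w => c₀ * ((rhoSq w : ℂ) ^ 2)⁻¹ + c₁ * (conj w * ((rhoSq w : ℂ) ^ 2)⁻¹) := by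
      filter_upwards [hc] with w hw
      rw [hw]
      have h0 := rhoSq_ne_zero w
      have := expo_neg_mul_expo κ w
      field_simp
      linear_combination (c₀ + c₁ * conj w) * this
    rw [cauchyBar_congr h1]
    ext z
    have m1 : Continuous fun w => ((rhoSq w : ℂ) ^ 2)⁻¹ := by
      simp only [← inv_pow]
      exact continuous_inv_rhoSq.pow 2
    have m2 : Continuous fun w => conj w * ((rhoSq w : ℂ) ^ 2)⁻¹ := Complex.continuous_conj.mul m1
    rw [cauchyBar_linear m1.aestronglyMeasurable m2.aestronglyMeasurable (b := 3) (c := 1) (d := 1)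
      (by norm_num), cauchyBar_inv_rhoSq_sq, cauchyBar_conj_mul_inv_rhoSq_sq]
    · ring
    · refine Eventually.of_forall fun w => ?_
      rw [norm_inv_rhoSq_sq, one_mul]
      exact wt_anti (by norm_num) w
    · refine Eventually.of_forall fun w => ?_
      rw [norm_mul, RCLike.norm_conj, norm_inv_rhoSq_sq, one_mul]
      have := norm_mul_wt_le 4 w
      norm_num at this
      exact this
  set F : ℂ → ℂ := fun z => expo (-κ) z * (rhoSq z : ℂ)⁻¹ * (c₀ + c₁ * conj z) with hF
  have hFs : ContDiff ℝ ∞ F := ((contDiff_expo _).mul contDiff_inv_rhoSq).mul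
    (contDiff_const.add (contDiff_const.mul contDiff_conj))
  have hFd : ∀ z, dbar F z = -(Complex.I * conj κ * F z) -
      (rhoSq z : ℂ)⁻¹ * expo (-κ) z * ((c₀ * z - c₁) * (rhoSq z : ℂ)⁻¹) := fun z => by
    rw [(((HasW.expo (-κ) z).mul (HasW.inv_rhoSq z)).mul ((HasW.const c₀ z).add
      ((HasW.const c₁ z).mul (HasW.conj_id z)))).dbar_eq, hF]
    have h0 := rhoSq_ne_zero z
    have hr := ofReal_rhoSq z
    simp only [map_neg]
    field_simp
    rw [hr]
    ring
  have hκ' : Complex.I * conj κ ≠ 0 :=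
    mul_ne_zero Complex.I_ne_zero ((map_ne_zero (starRingEnd ℂ)).mpr hκ)
  refine ae_eq_zero_of_integral_test H.integrable fun v hv => ?_
  have h1 := H.integral_mul_dbar hv
  rw [hG] at h1
  have h2 := DSSoliton.IsTest.integral_mul_dbar (hFs.of_le (by norm_num)) hv
  have h3 : ∫ z, h z * dbar v z = ∫ z, F z * dbar v z := by
    refine integral_congr_ae ?_
    filter_upwards [hc] with z hz
    rw [hz]
  have hg : IsTest fun z => (rhoSq z : ℂ)⁻¹ * expo (-κ) z * ((c₀ * z - c₁) * (rhoSq z : ℂ)⁻¹) * v z :=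
    IsTest.smooth_mul ((contDiff_inv_rhoSq.mul (contDiff_expo _)).mul
      (((contDiff_const.mul contDiff_id).sub contDiff_const).mul contDiff_inv_rhoSq)) hv
  have hFv : IsTest fun z => F z * v z := IsTest.smooth_mul hFs hv
  have h4 : ∫ z, dbar F z * v z = -(Complex.I * conj κ * ∫ z, F z * v z) -
      ∫ z, (rhoSq z : ℂ)⁻¹ * expo (-κ) z * ((c₀ * z - c₁) * (rhoSq z : ℂ)⁻¹) * v z := by
    have i1 : Integrable fun z => -(Complex.I * conj κ * (F z * v z)) :=
      (hFv.integrable.const_mul _).neg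
    rw [← integral_const_mul, ← integral_neg, ← integral_sub i1 hg.integrable]
    refine integral_congr_ae (Eventually.of_forall fun z => ?_)
    simp only [hFd]
    ring
  have h5 : Complex.I * conj κ * ∫ z, F z * v z = 0 := by
    rw [h3, h2, h4] at h1
    linear_combination h1
  rw [← (mul_eq_zero.mp h5).resolve_left hκ']
  refine integral_congr_ae ?_
  filter_upwards [hc] with z hz
  rw [hz]

end IsFixedPair

/-! ### Weighted conjugate Cauchy operators from `L^p` to `L^∞`. -/

theorem norm_toLp_le {r : ℝ≥0∞} (hr : 1 ≤ r) (hr' : r ≠ ⊤) {f : ℂ → ℂ} (hf : MemLp f r volume) {A : ℝ}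
    (hA : ∫ z, ‖f z‖ ^ r.toReal ≤ A) : ‖hf.toLp f‖ ≤ A ^ r.toReal⁻¹ := by
  have h0 : 0 ≤ ∫ z, ‖f z‖ ^ r.toReal := integral_nonneg fun z => by positivity
  rw [Lp.norm_toLp, hf.eLpNorm_eq_integral_rpow_norm (one_pos.trans_le hr).ne' hr',
    ENNReal.toReal_ofReal (by positivity)]
  gcongr

theorem memLp_of_le_wt {r : ℝ≥0∞} (hr : 1 ≤ r) (hr' : r ≠ ⊤) {f : ℂ → ℂ}
    (hf : AEStronglyMeasurable f volume) {c s : ℝ} (hs : 2 < s * r.toReal)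
    (hb : ∀ᵐ z, ‖f z‖ ≤ c * wt s z) : MemLp f r volume := by
  have hw : MemLp (fun z => wt s z) r volume := by
    rw [← integrable_norm_rpow_iff (continuous_wt s).aestronglyMeasurable (one_pos.trans_le hr).ne' hr']
    refine (integrable_wt hs).congr (Eventually.of_forall fun z => ?_)
    change wt (s * r.toReal) z = ‖wt s z‖ ^ r.toReal
    rw [Real.norm_of_nonneg (wt_nonneg _ _), wt, wt, ← Real.rpow_mul (rhoSq_pos z).le]
    congr 1
    ring
  refine (hw.const_mul c).mono hf ?_
  filter_upwards [hb] with z hz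
  exact hz.trans (le_abs_self _)

theorem ae_norm_le_norm (g : Lp ℂ ∞ (volume : Measure ℂ)) : ∀ᵐ z, ‖g z‖ ≤ ‖g‖ := by
  have h := ae_le_eLpNormEssSup (f := g) (μ := (volume : Measure ℂ))
  filter_upwards [h] with z hz
  rw [Lp.norm_def, eLpNorm_exponent_top]
  have hfin : eLpNormEssSup g volume ≠ ⊤ := by
    rw [← eLpNorm_exponent_top]
    exact (Lp.memLp g).2.ne
  have := ENNReal.toReal_mono hfin hz
  simpa using this

theorem norm_toLp_top_le {f : ℂ → ℂ} (hf : MemLp f ∞ volume) {C : ℝ} (hC : 0 ≤ C)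
    (hb : ∀ᵐ z, ‖f z‖ ≤ C) : ‖hf.toLp f‖ ≤ C := by
  rw [Lp.norm_toLp, eLpNorm_exponent_top]
  exact ENNReal.toReal_le_of_le_ofReal hC (eLpNormEssSup_le_of_ae_bound hb)

/-- A continuous weight of order `ρ⁻²`. -/
def IsWeight (w : ℂ → ℂ) : Prop := Continuous w ∧ ∃ c : ℝ, 0 ≤ c ∧ ∀ z, ‖w z‖ ≤ c * wt 2 z

theorem isWeight_inv_rhoSq : IsWeight fun z => (rhoSq z : ℂ)⁻¹ :=
  ⟨(contDiff_inv_rhoSq (n := 0)).continuous, 1, zero_le_one, fun z => by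
    rw [norm_inv_rhoSq, one_mul]⟩

theorem IsTest.isWeight {v : ℂ → ℂ} (hv : IsTest v) : IsWeight v := by
  obtain ⟨C, hC⟩ := hv.bound 2
  refine ⟨hv.continuous, C, ?_, hC⟩
  exact nonneg_of_mul_nonneg_left ((norm_nonneg _).trans (hC 0)) (wt_pos _ _)

theorem integrable_mul_Lp {p q : ℝ≥0∞} [q.HolderConjugate p] {k : ℂ → ℂ} (hk : MemLp k q volume)
    (h : LpC p) : Integrable fun z => k z * h z := hk.integrable_mul (Lp.memLp h)

section Holder

variable {p q : ℝ≥0∞} [Fact (1 ≤ p)] [Fact (1 ≤ q)] [q.HolderConjugate p]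

/-- The functional on `L^p` given by integration against an `L^q` function. -/
noncomputable def pairing (k : LpC q) : LpC p →L[ℂ] ℂ :=
  (ContinuousLinearMap.mul ℂ ℂ).lpPairing volume q p k

theorem pairing_toLp_apply {k : ℂ → ℂ} (hk : MemLp k q volume) (h : LpC p) :
    pairing (hk.toLp k) h = ∫ z, k z * h z := by
  rw [pairing, ContinuousLinearMap.lpPairing_eq_integral]
  refine integral_congr_ae ?_
  filter_upwards [hk.coeFn_toLp] with z hz
  rw [hz, ContinuousLinearMap.mul_apply']

variable (p q) in
theorem exists_norm_integral_mul_le : ∃ K : ℝ, 0 ≤ K ∧ ∀ (k : ℂ → ℂ) (hk : MemLp k q volume)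
    (h : LpC p), ‖∫ z, k z * h z‖ ≤ K * ‖hk.toLp k‖ * ‖h‖ := by
  refine ⟨‖(ContinuousLinearMap.mul ℂ ℂ).lpPairing (volume : Measure ℂ) q p‖,
    ContinuousLinearMap.opNorm_nonneg _, fun k hk h => ?_⟩
  rw [← pairing_toLp_apply hk h]
  exact ContinuousLinearMap.le_opNorm₂ _ _ _

end Holder

theorem norm_expo_sub_expo_le (k l z : ℂ) : ‖expo k z - expo l z‖ ≤ 2 * ‖k - l‖ * ‖z‖ := by
  have h1 : ∀ k : ℂ, expo k z = Complex.exp (((2 * (k * z).re : ℝ) : ℂ) * Complex.I) := fun k => by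
    rw [expo]
    congr 1
    have : k * z + conj k * conj z = ((2 * (k * z).re : ℝ) : ℂ) := by
      rw [← map_mul, Complex.add_conj]
    rw [this, mul_comm]
  have h2 : expo k z - expo l z = expo l z * (expo (k - l) z - 1) := by
    have := expo_add l (k - l) z
    rw [add_sub_cancel] at this
    rw [this]
    ring
  rw [h2, norm_mul, norm_expo, one_mul, h1, mul_comm _ Complex.I]
  refine (Real.norm_exp_I_mul_ofReal_sub_one_le).trans ?_
  rw [Real.norm_eq_abs, abs_mul, abs_two, mul_assoc, ← norm_mul]
  gcongr
  exact Complex.abs_re_le_norm _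

/-- The unimodular multiple of the conjugate Cauchy transform that depends regularly on `κ`. -/
noncomputable def barFun (κ : ℂ) (w h : ℂ → ℂ) (ζ : ℂ) : ℂ :=
  expo (-κ) ζ * cauchyBar (fun x => expo κ x * (w x * h x)) ζ

/-- The outer factor `e_{-κ}` merges with the inner phase into `e_κ(x - ζ)`, which equals `1` at the
singularity for every `κ`. This is what makes the dependence on `κ` Lipschitz. -/
theorem barFun_eq (κ : ℂ) (w h : ℂ → ℂ) (ζ : ℂ) : barFun κ w h ζ =
    (Real.pi : ℂ)⁻¹ * ∫ x, expo κ (x - ζ) * (conj ζ - conj x)⁻¹ * w x * h x := by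
  rw [barFun, cauchyBar, mul_left_comm, ← integral_const_mul]
  congr 1
  refine integral_congr_ae (Eventually.of_forall fun x => ?_)
  simp only [expo_sub_apply]
  ring

theorem stronglyMeasurable_barFun (κ : ℂ) {p : ℝ≥0∞} {w : ℂ → ℂ} (hw : IsWeight w) (h : LpC p) :
    StronglyMeasurable (barFun κ w h) := by
  refine (contDiff_expo (-κ) (n := 0)).continuous.stronglyMeasurable.mul
    (stronglyMeasurable_cauchyBar ?_)
  exact (contDiff_expo κ (n := 0)).continuous.aestronglyMeasurable.mul
    (hw.1.aestronglyMeasurable.mul (Lp.aestronglyMeasurable h))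

/-- The bound `q < 2` is what makes the Cauchy kernel locally `L^q`. -/
theorem one_lt_toReal_conj {p q : ℝ≥0∞} [q.HolderConjugate p] (hp : 2 < p) (hp' : p ≠ ⊤) :
    q ≠ ⊤ ∧ 1 < q.toReal ∧ q.toReal < 2 ∧ 2 < p.toReal := by
  have hpr : 2 < p.toReal := by
    have := (ENNReal.toReal_lt_toReal (by norm_num) hp').mpr hp
    simpa using this
  have hc : p.HolderConjugate q := ENNReal.HolderConjugate.symm (p := q) (q := p)
  have h := ENNReal.HolderConjugate.toReal (p := p) (q := q) (one_lt_two.trans hpr)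
  have h1 := h.symm.lt
  have h2 := h.inv_add_inv_eq_one
  refine ⟨fun hq => ?_, h1, ?_, hpr⟩
  · rw [hq] at h1
    norm_num at h1
  · have h3 : p.toReal⁻¹ < 2⁻¹ := inv_strictAnti₀ two_pos hpr
    have h4 : (2 : ℝ)⁻¹ < q.toReal⁻¹ := by linarith
    exact (inv_lt_inv₀ two_pos (by linarith)).mp h4

section BarOp

variable {q : ℝ≥0∞} [Fact (1 ≤ q)]

/-- The `q`-th power of the kernel is at most a constant times `|ζ - x|^{-q} ρ(x)^{-2q}`, whose
integral is bounded uniformly in `ζ` since `q < 2 < 3q`. Hölder's inequality then gives the map into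
`L^∞`. -/
theorem memLp_barKernel (hq' : q ≠ ⊤) (hq1 : 1 < q.toReal) (hq2 : q.toReal < 2) {w : ℂ → ℂ}
    (hw : IsWeight w) :
    ∃ A : ℝ, 0 ≤ A ∧ ∀ κ ζ : ℂ, ∃ hk : MemLp (fun x => expo κ (x - ζ) * (conj ζ - conj x)⁻¹ * w x) q
      volume, ‖hk.toLp _‖ ≤ A := by
  obtain ⟨hwc, c, hc, hcb⟩ := hw
  obtain ⟨C, hC, hCb⟩ := exists_potential_bound (a := q.toReal) (b := 2 * q.toReal) (by linarith) hq2
    (by linarith) (by linarith)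
  have hq : (1 : ℝ≥0∞) ≤ q := Fact.out
  refine ⟨(c ^ q.toReal * C) ^ q.toReal⁻¹, by positivity, fun κ ζ => ?_⟩
  have hm : AEStronglyMeasurable (fun x => expo κ (x - ζ) * (conj ζ - conj x)⁻¹ * w x) volume := by
    have h1 : Measurable fun x : ℂ => (conj ζ - conj x)⁻¹ := by fun_prop
    have h2 : Continuous fun x => expo κ (x - ζ) :=
      (contDiff_expo κ (n := 0)).continuous.comp (by fun_prop)
    exact ((h2.measurable.mul h1).mul hwc.measurable).aestronglyMeasurable
  have hle : ∀ x, ‖expo κ (x - ζ) * (conj ζ - conj x)⁻¹ * w x‖ ^ q.toReal ≤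
      c ^ q.toReal * (‖ζ - x‖ ^ (-q.toReal) * wt (2 * q.toReal) x) := fun x => by
    rw [norm_mul, norm_mul, norm_expo, one_mul, norm_inv, ← map_sub, RCLike.norm_conj]
    calc (‖ζ - x‖⁻¹ * ‖w x‖) ^ q.toReal ≤ (‖ζ - x‖⁻¹ * (c * wt 2 x)) ^ q.toReal := by
          gcongr; exact hcb x
      _ = _ := by
        rw [Real.mul_rpow (by positivity) (by have := wt_nonneg 2 x; positivity),
          Real.mul_rpow hc (wt_nonneg _ _), Real.inv_rpow (norm_nonneg _), Real.rpow_neg (norm_nonneg _),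
          wt, wt, ← Real.rpow_mul (rhoSq_pos x).le, mul_left_comm]
        congr 4
        ring
  have hint : Integrable fun x => ‖expo κ (x - ζ) * (conj ζ - conj x)⁻¹ * w x‖ ^ q.toReal := by
    refine ((hCb ζ).1.const_mul (c ^ q.toReal)).mono' ?_ (Eventually.of_forall fun x => ?_)
    · exact (hm.norm.aemeasurable.pow_const q.toReal).aestronglyMeasurable
    · rw [Real.norm_of_nonneg (by positivity)]
      exact hle x
  have hk := (integrable_norm_rpow_iff hm (one_pos.trans_le hq).ne' hq').mp hint
  refine ⟨hk, norm_toLp_le hq hq' hk ?_⟩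
  calc _ ≤ ∫ x, c ^ q.toReal * (‖ζ - x‖ ^ (-q.toReal) * wt (2 * q.toReal) x) :=
        integral_mono hint ((hCb ζ).1.const_mul _) hle
    _ ≤ _ := by rw [integral_const_mul]; gcongr; exact (hCb ζ).2

theorem IsWeight.memLp (hq' : q ≠ ⊤) (hq1 : 1 < q.toReal) {w : ℂ → ℂ} (hw : IsWeight w) :
    MemLp w q volume := by
  obtain ⟨hwc, c, hc, hcb⟩ := hw
  exact memLp_of_le_wt Fact.out hq' hwc.aestronglyMeasurable (s := 2) (by linarith)
    (Eventually.of_forall hcb)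

end BarOp

/-- The conjugate Cauchy transform as a family of operators from `L^p` to `L^∞`. -/
theorem exists_barOp {p : ℝ≥0∞} [Fact (1 ≤ p)] (hp : 2 < p) (hp' : p ≠ ⊤) {w : ℂ → ℂ}
    (hw : IsWeight w) (q : ℝ≥0∞) [Fact (1 ≤ q)] [q.HolderConjugate p] :
    ∃ B : ℂ → (LpC p →L[ℂ] LpC ∞), (∀ κ h, (B κ h : ℂ → ℂ) =ᵐ[volume] barFun κ w h) ∧
      (∃ C : ℝ, ∀ κ, ‖B κ‖ ≤ C) ∧ (∃ L : ℝ, ∀ κ κ', ‖B κ - B κ'‖ ≤ L * ‖κ - κ'‖) ∧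
      ∀ h : LpC p, ∃ C : ℝ, ∀ κ z, ‖barFun κ w h z‖ ≤ C := by
  obtain ⟨hq', hq1, hq2, -⟩ := one_lt_toReal_conj (p := p) (q := q) hp hp'
  obtain ⟨A, hA, hk⟩ := memLp_barKernel (q := q) hq' hq1 hq2 hw
  obtain ⟨K, hK, hKb⟩ := exists_norm_integral_mul_le p q
  have hpi : ‖(Real.pi : ℂ)⁻¹‖ = Real.pi⁻¹ := by
    rw [norm_inv, Complex.norm_real, Real.norm_of_nonneg Real.pi_pos.le]
  have hbound : ∀ κ (h : LpC p) z, ‖barFun κ w h z‖ ≤ Real.pi⁻¹ * (K * A) * ‖h‖ := fun κ h z => by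
    obtain ⟨hm, hmA⟩ := hk κ z
    rw [barFun_eq, norm_mul, hpi, mul_assoc]
    gcongr
    refine (hKb _ hm h).trans ?_
    gcongr
  have hmem : ∀ κ (h : LpC p), MemLp (barFun κ w h) ∞ volume := fun κ h =>
    memLp_top_of_bound (stronglyMeasurable_barFun κ hw h).aestronglyMeasurable _
      (Eventually.of_forall (hbound κ h))
  have hint : ∀ κ (h : LpC p) z, Integrable fun x =>
      expo κ (x - z) * (conj z - conj x)⁻¹ * w x * h x := fun κ h z =>
    integrable_mul_Lp (hk κ z).choose h
  have hadd : ∀ κ (h g : LpC p), barFun κ w (h + g : LpC p) = barFun κ w h + barFun κ w g :=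
    fun κ h g => by
    ext z
    rw [Pi.add_apply, barFun_eq, barFun_eq, barFun_eq, ← mul_add, ← integral_add (hint κ h z) (hint κ g z)]
    congr 1
    refine integral_congr_ae ?_
    filter_upwards [Lp.coeFn_add h g] with x hx
    rw [hx, Pi.add_apply, mul_add]
  have hsmul : ∀ κ (c : ℂ) (h : LpC p), barFun κ w (c • h : LpC p) = c • barFun κ w h :=
    fun κ c h => by
    ext z
    rw [Pi.smul_apply, barFun_eq, barFun_eq, smul_eq_mul, mul_left_comm]
    congr 1
    rw [← integral_const_mul]
    refine integral_congr_ae ?_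
    filter_upwards [Lp.coeFn_smul c h] with x hx
    rw [hx, Pi.smul_apply, smul_eq_mul]
    ring
  have hnorm : ∀ κ (h : LpC p), ‖(hmem κ h).toLp _‖ ≤ Real.pi⁻¹ * (K * A) * ‖h‖ := fun κ h =>
    norm_toLp_top_le _ (by positivity) (Eventually.of_forall (hbound κ h))
  set B : ℂ → (LpC p →L[ℂ] LpC ∞) := fun κ => LinearMap.mkContinuous
    { toFun := fun h => (hmem κ h).toLp _
      map_add' := fun h g => by
        rw [← MemLp.toLp_add]
        exact MemLp.toLp_congr _ _ (by rw [hadd])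
      map_smul' := fun c h => by
        rw [RingHom.id_apply, ← MemLp.toLp_const_smul]
        exact MemLp.toLp_congr _ _ (by rw [hsmul]) } (Real.pi⁻¹ * (K * A))
    (hnorm κ) with hB
  have hBapp : ∀ κ h, (B κ h : ℂ → ℂ) =ᵐ[volume] barFun κ w h := fun κ h => (hmem κ h).coeFn_toLp
  have hwm := hw.memLp hq' hq1 (q := q)
  refine ⟨B, hBapp, ⟨Real.pi⁻¹ * (K * A), fun κ => LinearMap.mkContinuous_norm_le _ (by positivity) (hnorm κ)⟩,
    ⟨Real.pi⁻¹ * (2 * (K * ‖hwm.toLp _‖)), fun κ κ' => ?_⟩, fun h => ⟨_, fun κ => hbound κ h⟩⟩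
  have hdiff : ∀ (h : LpC p) z, ‖barFun κ w h z - barFun κ' w h z‖ ≤
      Real.pi⁻¹ * (2 * (K * ‖hwm.toLp _‖)) * ‖κ - κ'‖ * ‖h‖ := fun h z => by
    obtain ⟨hm, -⟩ := hk κ z
    obtain ⟨hm', -⟩ := hk κ' z
    have hd := hm.sub hm'
    have e : barFun κ w h z - barFun κ' w h z = (Real.pi : ℂ)⁻¹ *
        ∫ x, ((fun x => expo κ (x - z) * (conj z - conj x)⁻¹ * w x) -
          fun x => expo κ' (x - z) * (conj z - conj x)⁻¹ * w x) x * h x := by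
      rw [barFun_eq, barFun_eq, ← mul_sub, ← integral_sub (hint κ h z) (hint κ' h z)]
      congr 1
      refine integral_congr_ae (Eventually.of_forall fun x => ?_)
      simp only [Pi.sub_apply]
      ring
    -- The phase difference is at most `2|κ - κ'||x - z|`, which cancels the singularity and leaves
    -- only the weight.
    have hle : ‖hd.toLp _‖ ≤ 2 * ‖κ - κ'‖ * ‖hwm.toLp _‖ := by
      refine Lp.norm_le_mul_norm_of_ae_le_mul ?_
      filter_upwards [hd.coeFn_toLp, hwm.coeFn_toLp] with x h1 h2
      rw [h1, h2, Pi.sub_apply, ← sub_mul, ← sub_mul, norm_mul, norm_mul, norm_inv, ← map_sub,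
        RCLike.norm_conj, norm_sub_rev z x]
      have h3 := norm_expo_sub_expo_le κ κ' (x - z)
      refine mul_le_mul_of_nonneg_right ?_ (norm_nonneg _)
      rcases eq_or_ne (x - z) 0 with h0 | h0
      · rw [h0, norm_zero, inv_zero, mul_zero]
        positivity
      · rwa [← div_eq_mul_inv, div_le_iff₀ (norm_pos_iff.mpr h0)]
    rw [e, norm_mul, hpi]
    calc _ ≤ Real.pi⁻¹ * (K * ‖hd.toLp _‖ * ‖h‖) := by gcongr; exact hKb _ hd h
      _ ≤ Real.pi⁻¹ * (K * (2 * ‖κ - κ'‖ * ‖hwm.toLp _‖) * ‖h‖) := by gcongr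
      _ = _ := by ring
  refine ContinuousLinearMap.opNorm_le_bound _ (by positivity) fun h => ?_
  have hs : (B κ - B κ') h = ((hmem κ h).sub (hmem κ' h)).toLp _ := rfl
  rw [hs]
  exact norm_toLp_top_le _ (by positivity) (Eventually.of_forall (hdiff h))

/-! ### Kernel operators from `L^∞` to `L^p` and compactness. -/

section Kernel

variable {p : ℝ≥0∞} [Fact (1 ≤ p)]

/-- The operator from `L^∞` to `L^p` with kernel `F ∈ L^p(L¹)`. -/
noncomputable def kernelOp (p : ℝ≥0∞) [Fact (1 ≤ p)] :
    Lp (LpC 1) p (volume : Measure ℂ) →L[ℂ] (LpC ∞ →L[ℂ] LpC p) :=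
  (((ContinuousLinearMap.mul ℂ ℂ).lpPairing (volume : Measure ℂ) 1 ∞).flip.compLpL₂ p volume).flip

theorem kernelOp_apply (F : Lp (LpC 1) p (volume : Measure ℂ)) (g : LpC ∞) :
    (kernelOp p F g : ℂ → ℂ) =ᵐ[volume] fun z => ∫ ζ, (F z : ℂ → ℂ) ζ * g ζ := by
  change ((((ContinuousLinearMap.mul ℂ ℂ).lpPairing (volume : Measure ℂ) 1 ∞).flip g).compLp F :
    ℂ → ℂ) =ᵐ[volume] _
  filter_upwards [ContinuousLinearMap.coeFn_compLp
    (((ContinuousLinearMap.mul ℂ ℂ).lpPairing (volume : Measure ℂ) 1 ∞).flip g) F] with z hz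
  rw [hz, ContinuousLinearMap.flip_apply, ContinuousLinearMap.lpPairing_eq_integral]
  rfl

theorem kernelOp_indicatorConst {s : Set ℂ} (hs : MeasurableSet s) (hμs : volume s < ⊤) (c : LpC 1)
    (g : LpC ∞) :
    kernelOp p (Lp.simpleFunc.indicatorConst p hs hμs.ne c : Lp (LpC 1) p (volume : Measure ℂ)) g =
      pairing (p := ∞) (q := 1) c g • indicatorConstLp p hs hμs.ne (1 : ℂ) := by
  ext1
  filter_upwards [kernelOp_apply (Lp.simpleFunc.indicatorConst p hs hμs.ne c :
      Lp (LpC 1) p (volume : Measure ℂ)) g, Lp.coeFn_smul (pairing (p := ∞) (q := 1) c g)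
      (indicatorConstLp p hs hμs.ne (1 : ℂ)), indicatorConstLp_coeFn (p := p) (hs := hs) (hμs := hμs.ne)
      (c := (1 : ℂ)), indicatorConstLp_coeFn (p := p) (hs := hs) (hμs := hμs.ne) (c := c)]
    with z h1 h2 h3 h4
  rw [h1, h2, Pi.smul_apply, h3, Lp.simpleFunc.coe_indicatorConst, h4, pairing,
    ContinuousLinearMap.lpPairing_eq_integral]
  by_cases hz : z ∈ s
  · simp only [Set.indicator_of_mem hz, smul_eq_mul, mul_one]
    rfl
  · simp only [Set.indicator_of_notMem hz, smul_zero]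
    refine (integral_congr_ae ?_).trans (integral_zero ℂ ℂ)
    filter_upwards [Lp.coeFn_zero ℂ 1 (volume : Measure ℂ)] with x hx
    rw [hx, Pi.zero_apply, zero_mul]

/-- A closed, additive property of operators holds for all kernel operators as soon as it holds
for those of rank one. -/
theorem kernelOp_induction (hp' : p ≠ ⊤) {motive : (LpC ∞ →L[ℂ] LpC p) → Prop}
    (rank_one : ∀ (c : LpC 1) (x : LpC p), motive ((pairing (p := ∞) (q := 1) c).smulRight x))
    (add : ∀ S T, motive S → motive T → motive (S + T)) (closed : IsClosed {S | motive S})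
    (F : Lp (LpC 1) p (volume : Measure ℂ)) : motive (kernelOp p F) := by
  refine Lp.induction hp' (fun F => motive (kernelOp p F)) (fun c s hs hμs => ?_)
    (fun f g hf hg _ h1 h2 => ?_) (closed.preimage (kernelOp p).continuous) F
  · have : kernelOp p (Lp.simpleFunc.indicatorConst p hs hμs.ne c : Lp (LpC 1) p (volume : Measure ℂ)) =
        (pairing (p := ∞) (q := 1) c).smulRight (indicatorConstLp p hs hμs.ne (1 : ℂ)) :=
      ContinuousLinearMap.ext fun g => kernelOp_indicatorConst hs hμs c g
    rw [this]
    exact rank_one _ _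
  · rw [map_add]
    exact add _ _ h1 h2

/-- Simple `L¹`-valued kernels give finite-rank operators, and compact operators are closed in norm.
-/
theorem isCompactOperator_kernelOp (hp' : p ≠ ⊤) (F : Lp (LpC 1) p (volume : Measure ℂ)) :
    IsCompactOperator (kernelOp p F) := by
  refine kernelOp_induction hp' (motive := fun S => IsCompactOperator S) (fun c x => ?_)
    (fun S T hS hT => hS.add hT) ?_ F
  · have h1 : IsCompactOperator (ContinuousLinearMap.toSpanSingleton ℂ x : ℂ →L[ℂ] LpC p) :=
      isCompactOperator_of_locallyCompactSpace_rng _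
    exact h1.comp_clm (pairing (p := ∞) (q := 1) c)
  · exact isClosed_setOfPred_isCompactOperator

end Kernel

/-- The Cauchy kernel with weight `w`, as an `L¹`-valued function. -/
theorem exists_cauchyKernel {w : ℂ → ℂ} (hw : IsWeight w) {p : ℝ≥0∞} [Fact (1 ≤ p)] (hp : 2 < p)
    (hp' : p ≠ ⊤) : ∃ F : Lp (LpC 1) p (volume : Measure ℂ),
      ∀ᵐ z, (F z : ℂ → ℂ) =ᵐ[volume] fun ζ => (Real.pi : ℂ)⁻¹ * ((z - ζ)⁻¹ * w ζ) := by
  obtain ⟨hwc, c, hc, hcb⟩ := hw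
  have hi : ∀ z, Integrable fun ζ => (Real.pi : ℂ)⁻¹ * ((z - ζ)⁻¹ * w ζ) := fun z =>
    (integrable_inv_sub_mul hwc.aestronglyMeasurable one_lt_two (Eventually.of_forall hcb) z).const_mul _
  set F : ℂ → LpC 1 := fun z => (memLp_one_iff_integrable.mpr (hi z)).toLp _ with hF
  have hnorm : ∀ z, ‖F z‖ = ∫ ζ, ‖(Real.pi : ℂ)⁻¹ * ((z - ζ)⁻¹ * w ζ)‖ := fun z => by
    rw [L1.norm_eq_integral_norm]
    refine integral_congr_ae ?_
    filter_upwards [(memLp_one_iff_integrable.mpr (hi z)).coeFn_toLp] with ζ hζ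
    rw [hF, hζ]
  -- Hölder continuity of order `1/2` from the kernel difference estimate; it supplies strong
  -- measurability of the `L¹`-valued map.
  have hcont : Continuous F := by
    obtain ⟨C, hC, hCb⟩ := exists_potential_bound (a := 3 / 2) (b := 2) (by norm_num) (by norm_num)
      (by norm_num) (by norm_num)
    have hd : ∀ z z', dist (F z) (F z') ≤ Real.pi⁻¹ * c * 4 * C * dist z z' ^ ((1 : ℝ) / 2) := fun z z' => by
      have e : F z - F z' = ((memLp_one_iff_integrable.mpr (hi z)).sub
        (memLp_one_iff_integrable.mpr (hi z'))).toLp _ := rfl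
      rw [dist_eq_norm, dist_eq_norm, e, L1.norm_eq_integral_norm]
      have hb : ∀ ζ, ‖(Real.pi : ℂ)⁻¹ * ((z - ζ)⁻¹ * w ζ) - (Real.pi : ℂ)⁻¹ * ((z' - ζ)⁻¹ * w ζ)‖ ≤
          (Real.pi⁻¹ * c * 2 * ‖z - z'‖ ^ ((1 : ℝ) / 2)) * (‖z - ζ‖ ^ (-((3 : ℝ) / 2)) * wt 2 ζ +
            ‖z' - ζ‖ ^ (-((3 : ℝ) / 2)) * wt 2 ζ) := fun ζ => by
        rw [← mul_sub, ← sub_mul, norm_mul, norm_mul, norm_inv, Complex.norm_real,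
          Real.norm_of_nonneg Real.pi_pos.le]
        have h1 := norm_inv_sub_inv_le (z - ζ) (z' - ζ)
        rw [sub_sub_sub_cancel_right] at h1
        calc _ ≤ Real.pi⁻¹ * ((2 * ‖z - z'‖ ^ ((1 : ℝ) / 2) * (‖z - ζ‖ ^ (-((3 : ℝ) / 2)) +
              ‖z' - ζ‖ ^ (-((3 : ℝ) / 2)))) * (c * wt 2 ζ)) := by
              gcongr
              exact hcb ζ
          _ = _ := by ring
      have hi2 : Integrable fun ζ => ‖z - ζ‖ ^ (-((3 : ℝ) / 2)) * wt 2 ζ +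
            ‖z' - ζ‖ ^ (-((3 : ℝ) / 2)) * wt 2 ζ := (hCb z).1.add (hCb z').1
      calc _ = ∫ ζ, ‖(Real.pi : ℂ)⁻¹ * ((z - ζ)⁻¹ * w ζ) - (Real.pi : ℂ)⁻¹ * ((z' - ζ)⁻¹ * w ζ)‖ := by
            refine integral_congr_ae ?_
            filter_upwards [((memLp_one_iff_integrable.mpr (hi z)).sub
              (memLp_one_iff_integrable.mpr (hi z'))).coeFn_toLp] with ζ hζ
            rw [hζ, Pi.sub_apply]
        _ ≤ ∫ ζ, (Real.pi⁻¹ * c * 2 * ‖z - z'‖ ^ ((1 : ℝ) / 2)) * (‖z - ζ‖ ^ (-((3 : ℝ) / 2)) * wt 2 ζ +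
            ‖z' - ζ‖ ^ (-((3 : ℝ) / 2)) * wt 2 ζ) :=
            integral_mono ((hi z).sub (hi z')).norm (hi2.const_mul _) hb
        _ ≤ (Real.pi⁻¹ * c * 2 * ‖z - z'‖ ^ ((1 : ℝ) / 2)) * (C + C) := by
            rw [integral_const_mul, integral_add (hCb z).1 (hCb z').1]
            gcongr
            · exact (hCb z).2
            · exact (hCb z').2
        _ = _ := by ring
    rw [continuous_iff_continuousAt]
    intro z'
    rw [ContinuousAt, tendsto_iff_dist_tendsto_zero]
    refine squeeze_zero (fun z => dist_nonneg) (fun z => hd z z') ?_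
    have h1 : Continuous fun z => Real.pi⁻¹ * c * 4 * C * dist z z' ^ ((1 : ℝ) / 2) := by
      refine continuous_const.mul (Continuous.rpow_const (by fun_prop) fun _ => Or.inr (by norm_num))
    have h2 := h1.tendsto z'
    rwa [dist_self, Real.zero_rpow (by norm_num), mul_zero] at h2
  obtain ⟨-, -, -, hpr⟩ := one_lt_toReal_conj (p := p) (q := ENNReal.conjExponent p) hp hp'
  -- The exponent `s = 1/2 + 1/p` is below `1` because `p > 2`, so this decay is available for the
  -- weight `ρ⁻²`; and `sp = p/2 + 1 > 2` puts `ρ^{-s}` in `L^p`.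
  obtain ⟨C, hC, hCb⟩ := exists_cauchy_potential_decay (b := 2) (s := 1 / 2 + 1 / p.toReal)
    (by positivity) (by
      have : 1 / p.toReal < 1 / 2 := one_div_lt_one_div_of_lt two_pos hpr
      linarith) (by
      have : 1 / p.toReal < 1 / 2 := one_div_lt_one_div_of_lt two_pos hpr
      linarith)
  have hFb : ∀ z, ‖F z‖ ≤ (Real.pi⁻¹ * c * C) * wt (1 / 2 + 1 / p.toReal) z := fun z => by
    rw [hnorm]
    calc _ ≤ ∫ ζ, (Real.pi⁻¹ * c) * (‖z - ζ‖⁻¹ * wt 2 ζ) := by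
          refine integral_mono (hi z).norm ((hCb z).1.const_mul _) fun ζ => ?_
          change ‖(Real.pi : ℂ)⁻¹ * ((z - ζ)⁻¹ * w ζ)‖ ≤ (Real.pi⁻¹ * c) * (‖z - ζ‖⁻¹ * wt 2 ζ)
          rw [norm_mul, norm_mul, norm_inv, norm_inv, Complex.norm_real,
            Real.norm_of_nonneg Real.pi_pos.le]
          calc _ ≤ Real.pi⁻¹ * (‖z - ζ‖⁻¹ * (c * wt 2 ζ)) := by gcongr; exact hcb ζ
            _ = _ := by ring
      _ ≤ _ := by
          rw [integral_const_mul, mul_assoc (Real.pi⁻¹ * c)]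
          gcongr
          exact (hCb z).2
  have hmem : MemLp F p volume := by
    have hw : MemLp (fun z => (wt (1 / 2 + 1 / p.toReal) z : ℂ)) p volume := by
      refine memLp_of_le_wt Fact.out hp' (Complex.continuous_ofReal.comp
        (continuous_wt _)).aestronglyMeasurable (c := 1) (s := 1 / 2 + 1 / p.toReal) ?_
        (Eventually.of_forall fun z => ?_)
      · rw [add_mul, one_div_mul_cancel (by positivity)]
        linarith
      · rw [Complex.norm_real, Real.norm_of_nonneg (wt_nonneg _ _), one_mul]
    refine (hw.norm.const_mul (Real.pi⁻¹ * c * C)).mono hcont.aestronglyMeasurable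
      (Eventually.of_forall fun z => (hFb z).trans ?_)
    rw [Complex.norm_real, Real.norm_of_nonneg (wt_nonneg _ _)]
    exact le_abs_self _
  refine ⟨hmem.toLp F, ?_⟩
  filter_upwards [hmem.coeFn_toLp] with z hz
  rw [hz]
  exact (memLp_one_iff_integrable.mpr (hi z)).coeFn_toLp

/-! ### Decay of the soliton operator for large `κ`. -/

theorem isClosed_setOf_tendsto_zero {ι V W : Type*} [SeminormedAddCommGroup V] [SeminormedAddCommGroup W]
    {l : Filter ι} {M : ι → V → W} {C : ℝ} (hM : ∀ i v v', ‖M i v - M i v'‖ ≤ C * ‖v - v'‖) :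
    IsClosed {v | Tendsto (fun i => M i v) l (𝓝 0)} := by
  refine isClosed_of_closure_subset fun v hv => ?_
  change Tendsto (fun i => M i v) l (𝓝 0)
  rw [Metric.tendsto_nhds]
  intro ε hε
  obtain ⟨v', hv', hd⟩ := Metric.mem_closure_iff.mp hv (ε / (2 * (|C| + 1))) (by positivity)
  have hv'' : Tendsto (fun i => M i v') l (𝓝 0) := hv'
  filter_upwards [(Metric.tendsto_nhds.mp hv'') (ε / 2) (by positivity)] with i hi
  rw [dist_zero_right] at hi ⊢
  have h1 : ‖M i v - M i v'‖ ≤ ε / 2 := by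
    refine (hM i v v').trans ?_
    rw [dist_eq_norm] at hd
    calc C * ‖v - v'‖ ≤ (|C| + 1) * (ε / (2 * (|C| + 1))) := by
          gcongr
          linarith [le_abs_self C]
      _ = ε / 2 := by field_simp
  calc ‖M i v‖ = ‖M i v - M i v' + M i v'‖ := by rw [sub_add_cancel]
    _ ≤ ‖M i v - M i v'‖ + ‖M i v'‖ := norm_add_le _ _
    _ < ε := by linarith

theorem Lp_induction_test {r : ℝ≥0∞} [Fact (1 ≤ r)] (hr : r ≠ ⊤) {motive : LpC r → Prop}
    (closed : IsClosed {h | motive h}) (test : ∀ (h : LpC r) (u : ℂ → ℂ), IsTest u → h =ᵐ[volume] u → motive h)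
    (h : LpC r) : motive h := by
  have hd := Lp.dense_hasCompactSupport_contDiff (F := ℂ) (μ := (volume : Measure ℂ)) hr
  exact hd.induction (fun x hx => by
    obtain ⟨g, hg, hc, hs⟩ := hx
    exact test x g ⟨hs, hc⟩ hg) closed h

theorem barFun_congr {κ : ℂ} {w h h' : ℂ → ℂ} (hh : h =ᵐ[volume] h') : barFun κ w h = barFun κ w h' := by
  have : (fun x => expo κ x * (w x * h x)) =ᵐ[volume] fun x => expo κ x * (w x * h' x) := by
    filter_upwards [hh] with x hx
    rw [hx]
  ext z
  rw [barFun, barFun, cauchyBar_congr this]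

/-- Since `C̄ ∂ = id` on test functions, expanding `∂(e_{-κ} v)` exchanges a factor `κ` for a
derivative of `v`. -/
theorem IsTest.mul_cauchyBar_expo {v : ℂ → ℂ} (hv : IsTest v) (κ z : ℂ) :
    Complex.I * κ * cauchyBar (fun x => expo (-κ) x * v x) z =
      cauchyBar (fun x => expo (-κ) x * DSSoliton.dz v x) z - expo (-κ) z * v z := by
  have h1 : IsTest fun x => expo (-κ) x * v x := IsTest.smooth_mul (contDiff_expo _) hv
  have h2 : IsTest fun x => expo (-κ) x * DSSoliton.dz v x := IsTest.smooth_mul (contDiff_expo _) hv.dz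
  have h3 : DSSoliton.dz (fun x => expo (-κ) x * v x) = fun x =>
      -(Complex.I * κ) * (expo (-κ) x * v x) + 1 * (expo (-κ) x * DSSoliton.dz v x) := by
    ext x
    rw [((HasW.expo (-κ) x).mul (hv.hasW x)).dz_eq]
    ring
  obtain ⟨c, hc⟩ := h1.bound 2
  obtain ⟨d, hd⟩ := h2.bound 2
  have h4 := h1.cauchyBar_dz z
  rw [h3, cauchyBar_linear h1.continuous.aestronglyMeasurable h2.continuous.aestronglyMeasurable
    one_lt_two (Eventually.of_forall hc) (Eventually.of_forall hd)] at h4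
  linear_combination -h4

theorem exists_norm_cauchyBar_le {b s : ℝ} (hs : 0 ≤ s) (hs1 : s ≤ 1) (hsb : s + 1 < b) :
    ∃ C : ℝ, 0 ≤ C ∧ ∀ (F : ℂ → ℂ) (c : ℝ), (∀ᵐ z, ‖F z‖ ≤ c * wt b z) →
      ∀ z, ‖cauchyBar F z‖ ≤ C * c * wt s z := by
  obtain ⟨C, hC, hCb⟩ := exists_norm_cauchy_le hs hs1 hsb
  refine ⟨Real.pi⁻¹ * C, by positivity, fun F c hF z => ?_⟩
  rw [cauchyBar_eq, RCLike.norm_conj, cauchy, norm_mul, norm_inv, Complex.norm_real,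
    Real.norm_of_nonneg Real.pi_pos.le, mul_assoc, mul_assoc]
  gcongr
  rw [← mul_assoc]
  exact hCb _ c (by simpa only [RCLike.norm_conj] using hF) z

/-- Oscillation makes the conjugate Cauchy transform of `e_{-κ} v` small. -/
theorem IsTest.exists_norm_cauchyBar_expo_le {v : ℂ → ℂ} (hv : IsTest v) :
    ∃ D : ℝ, 0 ≤ D ∧ ∀ κ z : ℂ, ‖κ‖ * ‖cauchyBar (fun x => expo (-κ) x * v x) z‖ ≤ D := by
  obtain ⟨C, hC, hCb⟩ := exists_norm_cauchyBar_le (b := 2) (s := 0) le_rfl zero_le_one (by norm_num)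
  obtain ⟨c, hc⟩ := hv.dz.bound 2
  obtain ⟨d, hd⟩ := hv.bound 0
  have key : ∀ κ z : ℂ, ‖κ‖ * ‖cauchyBar (fun x => expo (-κ) x * v x) z‖ ≤ C * c + d := fun κ z => by
    have h1 := hv.mul_cauchyBar_expo κ z
    have h2 : ‖κ‖ * ‖cauchyBar (fun x => expo (-κ) x * v x) z‖ =
        ‖cauchyBar (fun x => expo (-κ) x * DSSoliton.dz v x) z - expo (-κ) z * v z‖ := by
      rw [← h1, norm_mul, norm_mul, Complex.norm_I, one_mul]
    rw [h2]
    refine (norm_sub_le _ _).trans (add_le_add ?_ ?_)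
    · have := hCb (fun x => expo (-κ) x * DSSoliton.dz v x) c (Eventually.of_forall fun x => by
        rw [norm_mul, norm_expo, one_mul]
        exact hc x) z
      rwa [wt_zero, mul_one] at this
    · have := hd z
      rw [norm_mul, norm_expo, one_mul]
      rwa [wt_zero, mul_one] at this
  exact ⟨C * c + d, le_trans (by positivity) (key 0 0), key⟩

theorem cauchy_mul_left (c : ℂ) (F : ℂ → ℂ) (z : ℂ) : cauchy (fun w => c * F w) z = c * cauchy F z := by
  rw [cauchy, cauchy, mul_left_comm]
  congr 1
  rw [← integral_const_mul]
  refine integral_congr_ae (Eventually.of_forall fun x => ?_)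
  ring

theorem cauchyBar_mul_left (c : ℂ) (F : ℂ → ℂ) (z : ℂ) :
    cauchyBar (fun w => c * F w) z = c * cauchyBar F z := by
  rw [cauchyBar, cauchyBar, mul_left_comm]
  congr 1
  rw [← integral_const_mul]
  refine integral_congr_ae (Eventually.of_forall fun x => ?_)
  ring

theorem pairing_apply {p q : ℝ≥0∞} [Fact (1 ≤ p)] [Fact (1 ≤ q)] [q.HolderConjugate p] (k : LpC q)
    (h : LpC p) : pairing k h = ∫ z, k z * h z := by
  rw [pairing, ContinuousLinearMap.lpPairing_eq_integral]
  rfl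

/-- Transposition puts the transform on the smooth density: the functional has density `-w e_κ
C̄[e_{-κ} v]`, which the oscillation estimate bounds by `O(|w|/|κ|)`. The identity is used for test
`h` and extended by density. -/
theorem exists_norm_pairing_barOp_le {p : ℝ≥0∞} [Fact (1 ≤ p)] (q : ℝ≥0∞) [Fact (1 ≤ q)]
    [q.HolderConjugate p] (hp : 2 < p) (hp' : p ≠ ⊤) {w : ℂ → ℂ} (hw : IsWeight w)
    {B : ℂ → (LpC p →L[ℂ] LpC ∞)} (hB : ∀ κ h, (B κ h : ℂ → ℂ) =ᵐ[volume] barFun κ w h)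
    {c : LpC 1} {v : ℂ → ℂ} (hv : IsTest v) (hc : c =ᵐ[volume] v) :
    ∃ D : ℝ, ∀ κ, ‖κ‖ * ‖pairing (p := ∞) (q := 1) c ∘L B κ‖ ≤ D := by
  obtain ⟨hq', hq1, hq2, -⟩ := one_lt_toReal_conj (p := p) (q := q) hp hp'
  obtain ⟨D, hD, hDb⟩ := hv.exists_norm_cauchyBar_expo_le
  obtain ⟨K, hK, hKb⟩ := exists_norm_integral_mul_le p q
  have hwm := hw.memLp hq' hq1 (q := q)
  have key : ∀ (κ : ℂ) (h : LpC p), ‖κ‖ * ‖pairing (p := ∞) (q := 1) c (B κ h)‖ ≤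
      (D * (K * ‖hwm.toLp _‖)) * ‖h‖ := by
    intro κ
    have hm : ∀ z, ‖κ * (expo κ z * cauchyBar (fun x => expo (-κ) x * v x) z) * w z‖ ≤ D * ‖w z‖ :=
      fun z => by
        rw [norm_mul, norm_mul, norm_mul, norm_expo, one_mul]
        exact mul_le_mul_of_nonneg_right (hDb κ z) (norm_nonneg _)
    have htest : IsTest fun x => expo (-κ) x * v x := IsTest.smooth_mul (contDiff_expo _) hv
    have hkm : MemLp (fun z => κ * (expo κ z * cauchyBar (fun x => expo (-κ) x * v x) z) * w z) q
        volume := by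
      refine (hwm.norm.const_mul D).mono ?_ (Eventually.of_forall fun z => ?_)
      · exact ((((contDiff_expo κ (n := 0)).continuous.stronglyMeasurable.mul
          (stronglyMeasurable_cauchyBar htest.continuous.aestronglyMeasurable)).const_mul
          κ).mul hw.1.stronglyMeasurable).aestronglyMeasurable
      · exact (hm z).trans (le_abs_self _)
    have hkn : ‖hkm.toLp _‖ ≤ D * ‖hwm.toLp _‖ := by
      refine Lp.norm_le_mul_norm_of_ae_le_mul ?_
      filter_upwards [hkm.coeFn_toLp, hwm.coeFn_toLp] with z h1 h2
      rw [h1, h2]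
      exact hm z
    refine Lp_induction_test (hp') (motive := fun h => ‖κ‖ * ‖pairing (p := ∞) (q := 1) c (B κ h)‖ ≤
      (D * (K * ‖hwm.toLp _‖)) * ‖h‖) ?_ fun h u hu hhu => ?_
    · refine isClosed_le ?_ (continuous_const.mul continuous_norm)
      exact continuous_const.mul (((pairing (p := ∞) (q := 1) c).continuous.comp (B κ).continuous).norm)
    obtain ⟨-, a, ha, hab⟩ := id hw
    obtain ⟨d, hd⟩ := hu.bound 0
    have hF : AEStronglyMeasurable (fun x => expo κ x * (w x * u x)) volume :=
      ((contDiff_expo κ (n := 0)).continuous.mul (hw.1.mul hu.continuous)).aestronglyMeasurable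
    have hFb : ∀ x, ‖expo κ x * (w x * u x)‖ ≤ (a * d) * wt 2 x := fun x => by
      have h1 := hd x
      rw [wt_zero, mul_one] at h1
      rw [norm_mul, norm_mul, norm_expo, one_mul]
      calc _ ≤ (a * wt 2 x) * d := mul_le_mul (hab x) h1 (norm_nonneg _)
            (mul_nonneg ha (wt_nonneg _ _))
        _ = _ := by ring
    have e1 : pairing (p := ∞) (q := 1) c (B κ h) =
        ∫ z, cauchyBar (fun x => expo κ x * (w x * u x)) z * (expo (-κ) z * v z) := by
      rw [pairing_apply]
      refine integral_congr_ae ?_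
      filter_upwards [hc, hB κ h] with z h1 h2
      rw [h1, h2, barFun_congr hhu, barFun]
      ring
    have e2 : κ * pairing (p := ∞) (q := 1) c (B κ h) =
        -∫ z, κ * (expo κ z * cauchyBar (fun x => expo (-κ) x * v x) z) * w z * h z := by
      rw [e1, cauchyBar_duality hF one_lt_two (Eventually.of_forall hFb) htest.integrable, mul_neg,
        ← integral_const_mul]
      congr 1
      refine integral_congr_ae ?_
      filter_upwards [hhu] with z hz
      rw [hz]
      ring
    rw [← norm_mul, e2, norm_neg]
    refine (hKb _ hkm h).trans ?_
    calc K * ‖hkm.toLp _‖ * ‖h‖ ≤ K * (D * ‖hwm.toLp _‖) * ‖h‖ := by gcongr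
      _ = _ := by ring
  refine ⟨D * (K * ‖hwm.toLp _‖), fun κ => ?_⟩
  rcases eq_or_ne κ 0 with rfl | h0
  · rw [norm_zero, zero_mul]
    positivity
  · have hκ : 0 < ‖κ‖ := norm_pos_iff.mpr h0
    rw [← le_div_iff₀' hκ]
    refine ContinuousLinearMap.opNorm_le_bound _ (by positivity) fun h => ?_
    rw [div_mul_eq_mul_div, le_div_iff₀' hκ]
    exact key κ h

/-- A Riemann–Lebesgue argument: the kernel is approximated by rank-one kernels and their `L¹`
densities by test functions, where the decay is `O(1/|κ|)`. Both approximations use that `‖B κ‖` is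
bounded uniformly in `κ`. -/
theorem tendsto_kernelOp_comp_barOp {p : ℝ≥0∞} [Fact (1 ≤ p)] (hp : 2 < p) (hp' : p ≠ ⊤) {w : ℂ → ℂ} (hw : IsWeight w)
    {B : ℂ → (LpC p →L[ℂ] LpC ∞)} (hB : ∀ κ h, (B κ h : ℂ → ℂ) =ᵐ[volume] barFun κ w h)
    {C : ℝ} (hC : ∀ κ, ‖B κ‖ ≤ C) (q : ℝ≥0∞) [Fact (1 ≤ q)] [q.HolderConjugate p] (F : Lp (LpC 1) p (volume : Measure ℂ)) :
    Tendsto (fun κ => kernelOp p F ∘L B κ) (cocompact ℂ) (𝓝 0) := by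
  have hC0 : 0 ≤ C := (ContinuousLinearMap.opNorm_nonneg _).trans (hC 0)
  refine kernelOp_induction hp' (motive := fun S => Tendsto (fun κ => S ∘L B κ) (cocompact ℂ) (𝓝 0))
    (fun c x => ?_) (fun S T hS hT => ?_) ?_ F
  · have h1 : Tendsto (fun κ => pairing (p := ∞) (q := 1) c ∘L B κ) (cocompact ℂ) (𝓝 0) := by
      refine Lp_induction_test ENNReal.one_ne_top (motive := fun c => Tendsto (fun κ =>
        pairing (p := ∞) (q := 1) c ∘L B κ) (cocompact ℂ) (𝓝 0)) ?_ (fun c v hv hcv => ?_) c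
      · refine isClosed_setOf_tendsto_zero (M := fun (κ : ℂ) (c : LpC 1) =>
          pairing (p := ∞) (q := 1) c ∘L B κ) (C := ‖(ContinuousLinearMap.mul ℂ ℂ).lpPairing
          (volume : Measure ℂ) 1 ∞‖ * C) fun κ c c' => ?_
        have e : pairing (p := ∞) (q := 1) c ∘L B κ - pairing (p := ∞) (q := 1) c' ∘L B κ =
            (ContinuousLinearMap.mul ℂ ℂ).lpPairing (volume : Measure ℂ) 1 ∞ (c - c') ∘L B κ := by
          rw [map_sub, ContinuousLinearMap.sub_comp]
          rfl
        rw [e]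
        refine (ContinuousLinearMap.opNorm_comp_le _ _).trans ?_
        calc _ ≤ (‖(ContinuousLinearMap.mul ℂ ℂ).lpPairing (volume : Measure ℂ) 1 ∞‖ * ‖c - c'‖) * C :=
              mul_le_mul (ContinuousLinearMap.le_opNorm _ _) (hC κ)
                (ContinuousLinearMap.opNorm_nonneg _) (mul_nonneg (ContinuousLinearMap.opNorm_nonneg _)
                  (norm_nonneg _))
          _ = _ := by ring
      · obtain ⟨D, hD⟩ := exists_norm_pairing_barOp_le q hp hp' hw hB hv hcv
        rw [tendsto_zero_iff_norm_tendsto_zero]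
        have h2 : Tendsto (fun κ : ℂ => D * ‖κ‖⁻¹) (cocompact ℂ) (𝓝 0) := by
          have := (tendsto_inv_atTop_zero.comp (tendsto_norm_cocompact_atTop (E := ℂ))).const_mul D
          rwa [mul_zero] at this
        refine squeeze_zero' (Eventually.of_forall fun κ => ContinuousLinearMap.opNorm_nonneg _) ?_ h2
        filter_upwards [(tendsto_norm_cocompact_atTop (E := ℂ)).eventually_gt_atTop 0] with κ hκ
        rw [← div_eq_mul_inv, le_div_iff₀' hκ]
        exact hD κ
    have h3 : (fun κ => (pairing (p := ∞) (q := 1) c).smulRight x ∘L B κ) =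
        fun κ => ContinuousLinearMap.smulRightL ℂ (LpC p) (LpC p)
          (pairing (p := ∞) (q := 1) c ∘L B κ) x := by
      ext κ : 1
      rfl
    rw [h3]
    have h4 := ((ContinuousLinearMap.smulRightL ℂ (LpC p) (LpC p)).flip x).continuous.tendsto 0
    rw [map_zero] at h4
    exact h4.comp h1
  · have := hS.add hT
    rw [add_zero] at this
    simpa only [ContinuousLinearMap.add_comp] using this
  · refine isClosed_setOf_tendsto_zero (M := fun (κ : ℂ) (S : LpC ∞ →L[ℂ] LpC p) => S ∘L B κ) (C := C)
      fun κ S S' => ?_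
    rw [← ContinuousLinearMap.sub_comp, mul_comm]
    exact (ContinuousLinearMap.opNorm_comp_le _ _).trans
      (mul_le_mul_of_nonneg_left (hC κ) (ContinuousLinearMap.opNorm_nonneg _))


/-! ### The operator family `T(κ, ε)`. -/

/-- The operator `g ↦ C[w g]` from `L^∞` to `L^p`. -/
structure IsCauchyOp {p : ℝ≥0∞} [Fact (1 ≤ p)] (w : ℂ → ℂ) (S : LpC ∞ →L[ℂ] LpC p) : Prop where
  apply : ∀ g : LpC ∞, (S g : ℂ → ℂ) =ᵐ[volume] cauchy fun ζ => w ζ * g ζ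
  compact : IsCompactOperator S

/-- The family `h ↦ e_{-κ} C̄[e_κ w h]` of operators from `L^p` to `L^∞`. -/
structure IsBarOp {p : ℝ≥0∞} [Fact (1 ≤ p)] (w : ℂ → ℂ) (B : ℂ → (LpC p →L[ℂ] LpC ∞)) : Prop where
  apply : ∀ κ h, (B κ h : ℂ → ℂ) =ᵐ[volume] barFun κ w h
  uniform : ∃ C : ℝ, ∀ κ, ‖B κ‖ ≤ C
  lipschitz : ∃ L : ℝ, ∀ κ κ', ‖B κ - B κ'‖ ≤ L * ‖κ - κ'‖
  bounded : ∀ h : LpC p, ∃ C : ℝ, ∀ κ z, ‖barFun κ w h z‖ ≤ C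

theorem IsCauchyOp.apply_eq {p : ℝ≥0∞} [Fact (1 ≤ p)] {w : ℂ → ℂ} {S : LpC ∞ →L[ℂ] LpC p}
    (hS : IsCauchyOp w S) {g : LpC ∞} {f : ℂ → ℂ} (hg : g =ᵐ[volume] f) :
    (S g : ℂ → ℂ) =ᵐ[volume] cauchy fun ζ => w ζ * f ζ := by
  refine (hS.apply g).trans (Eventually.of_forall fun z => ?_)
  have : (fun ζ => w ζ * g ζ) =ᵐ[volume] fun ζ => w ζ * f ζ := by
    filter_upwards [hg] with ζ hζ
    rw [hζ]
  rw [cauchy_congr this]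

theorem IsBarOp.apply_eq {p : ℝ≥0∞} [Fact (1 ≤ p)] {w : ℂ → ℂ} {B : ℂ → (LpC p →L[ℂ] LpC ∞)}
    (hB : IsBarOp w B) {h : LpC p} {u : ℂ → ℂ} (hh : h =ᵐ[volume] u) (κ : ℂ) :
    (B κ h : ℂ → ℂ) =ᵐ[volume] barFun κ w u := by
  rw [← barFun_congr hh]
  exact hB.apply κ h

theorem exists_cauchyOp {p : ℝ≥0∞} [Fact (1 ≤ p)] (hp : 2 < p) (hp' : p ≠ ⊤) {w : ℂ → ℂ}
    (hw : IsWeight w) : ∃ S : LpC ∞ →L[ℂ] LpC p, IsCauchyOp w S ∧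
      ∃ F, S = kernelOp p F := by
  obtain ⟨F, hF⟩ := exists_cauchyKernel hw hp hp'
  refine ⟨kernelOp p F, ⟨fun g => ?_, isCompactOperator_kernelOp hp' F⟩, F, rfl⟩
  filter_upwards [kernelOp_apply F g, hF] with z h1 h2
  rw [h1, cauchy, ← integral_const_mul]
  refine integral_congr_ae ?_
  filter_upwards [h2] with ζ hζ
  rw [hζ]
  ring

theorem integrable_barKernel_mul {p : ℝ≥0∞} [Fact (1 ≤ p)] (hp : 2 < p) (hp' : p ≠ ⊤) {w : ℂ → ℂ}
    (hw : IsWeight w) (κ : ℂ) (h : LpC p) (z : ℂ) :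
    Integrable fun x => expo κ (x - z) * (conj z - conj x)⁻¹ * w x * h x := by
  have i1 : (ENNReal.conjExponent p).HolderConjugate p :=
    ENNReal.HolderConjugate.symm (p := p) (q := ENNReal.conjExponent p)
  have i2 : Fact (1 ≤ ENNReal.conjExponent p) := ⟨by simp [ENNReal.conjExponent]⟩
  obtain ⟨hq', hq1, hq2, -⟩ := one_lt_toReal_conj (p := p) (q := ENNReal.conjExponent p) hp hp'
  obtain ⟨A, -, hk⟩ := memLp_barKernel (q := ENNReal.conjExponent p) hq' hq1 hq2 hw
  exact integrable_mul_Lp (hk κ z).choose h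

theorem barFun_linear {p : ℝ≥0∞} [Fact (1 ≤ p)] (hp : 2 < p) (hp' : p ≠ ⊤) {w w' : ℂ → ℂ}
    (hw : IsWeight w) (hw' : IsWeight w') (m n κ : ℂ) (h : LpC p) (z : ℂ) :
    barFun κ (fun x => m * w x + n * w' x) h z = m * barFun κ w h z + n * barFun κ w' h z := by
  rw [barFun_eq, barFun_eq, barFun_eq]
  have h1 := (integrable_barKernel_mul hp hp' hw κ h z).const_mul m
  have h2 := (integrable_barKernel_mul hp hp' hw' κ h z).const_mul n
  rw [mul_left_comm, mul_left_comm n, ← mul_add, ← integral_const_mul m, ← integral_const_mul n,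
    ← integral_add h1 h2]
  congr 1
  refine integral_congr_ae (Eventually.of_forall fun x => ?_)
  ring

/-- The operators of which the scattering operator of the perturbed soliton is composed. -/
structure SolitonOps (p : ℝ≥0∞) [Fact (1 ≤ p)] (χ : ℂ → ℂ) where
  C₀ : LpC ∞ →L[ℂ] LpC p
  C₁ : LpC ∞ →L[ℂ] LpC p
  B₀ : ℂ → (LpC p →L[ℂ] LpC ∞)
  B₁ : ℂ → (LpC p →L[ℂ] LpC ∞)
  isCauchyOp₀ : IsCauchyOp (fun z => (rhoSq z : ℂ)⁻¹) C₀
  isCauchyOp₁ : IsCauchyOp χ C₁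
  isBarOp₀ : IsBarOp (fun z => (rhoSq z : ℂ)⁻¹) B₀
  isBarOp₁ : IsBarOp (fun z => conj (χ z)) B₁
  decay : Tendsto (fun κ => C₀ ∘L B₀ κ) (cocompact ℂ) (𝓝 0)

theorem exists_solitonOps {p : ℝ≥0∞} [Fact (1 ≤ p)] (hp : 2 < p) (hp' : p ≠ ⊤) {χ : ℂ → ℂ}
    (hχ : IsTest χ) : Nonempty (SolitonOps p χ) := by
  have i1 : (ENNReal.conjExponent p).HolderConjugate p :=
    ENNReal.HolderConjugate.symm (p := p) (q := ENNReal.conjExponent p)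
  have i2 : Fact (1 ≤ ENNReal.conjExponent p) := ⟨by simp [ENNReal.conjExponent]⟩
  obtain ⟨C₀, h1, F, hF⟩ := exists_cauchyOp hp hp' isWeight_inv_rhoSq
  obtain ⟨C₁, h2, -⟩ := exists_cauchyOp hp hp' hχ.isWeight
  obtain ⟨B₀, h3, ⟨K, hK⟩, h4, h5⟩ := exists_barOp hp hp' isWeight_inv_rhoSq (ENNReal.conjExponent p)
  obtain ⟨B₁, h6, hK', h7, h8⟩ := exists_barOp hp hp' hχ.star.isWeight (ENNReal.conjExponent p)
  refine ⟨⟨C₀, C₁, B₀, B₁, h1, h2, ⟨h3, ⟨K, hK⟩, h4, h5⟩, ⟨h6, hK', h7, h8⟩, ?_⟩⟩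
  rw [hF]
  exact tendsto_kernelOp_comp_barOp hp hp' isWeight_inv_rhoSq h3 hK (ENNReal.conjExponent p) F

namespace SolitonOps

variable {p : ℝ≥0∞} [Fact (1 ≤ p)] {χ : ℂ → ℂ} (S : SolitonOps p χ)

/-- The scattering operator at `k₀ + κ` of the soliton perturbed by `ε φ`, where `χ = e_{-k₀} φ`. -/
noncomputable def T (κ : ℂ) (ε : ℝ) : LpC p →L[ℂ] LpC p :=
  -(1 / 4 : ℂ) • (((2 : ℂ) • S.C₀ + (ε : ℂ) • S.C₁) ∘L ((2 : ℂ) • S.B₀ κ + (ε : ℂ) • S.B₁ κ))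

theorem isCompactOperator (κ : ℂ) (ε : ℝ) : IsCompactOperator (S.T κ ε) := by
  have h1 : IsCompactOperator ((2 : ℂ) • S.C₀ + (ε : ℂ) • S.C₁) :=
    (S.isCauchyOp₀.compact.smul (2 : ℂ)).add (S.isCauchyOp₁.compact.smul (ε : ℂ))
  exact (h1.comp_clm ((2 : ℂ) • S.B₀ κ + (ε : ℂ) • S.B₁ κ)).smul (-(1 / 4 : ℂ))

theorem T_eq (κ : ℂ) (ε : ℝ) : S.T κ ε = -(S.C₀ ∘L S.B₀ κ) -
    (ε / 2 : ℂ) • (S.C₁ ∘L S.B₀ κ + S.C₀ ∘L S.B₁ κ) - (ε ^ 2 / 4 : ℂ) • (S.C₁ ∘L S.B₁ κ) := by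
  ext1 h
  simp only [T, ContinuousLinearMap.comp_apply, smul_apply, add_apply, sub_apply, neg_apply, map_add, map_smul]
  module

theorem T_zero (κ : ℂ) : S.T κ 0 = -(S.C₀ ∘L S.B₀ κ) := by
  rw [T_eq]
  simp

theorem sub_T (κ : ℂ) (ε : ℝ) : S.T 0 0 - S.T κ ε = S.C₀ ∘L (S.B₀ κ - S.B₀ 0) +
    (ε / 2 : ℂ) • (S.C₁ ∘L S.B₀ κ + S.C₀ ∘L S.B₁ κ) + (ε ^ 2 / 4 : ℂ) • (S.C₁ ∘L S.B₁ κ) := by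
  rw [T_zero, T_eq, ContinuousLinearMap.comp_sub]
  abel

theorem exists_norm_B_le : ∃ K : ℝ, 0 ≤ K ∧ ∀ κ, ‖S.B₀ κ‖ ≤ K ∧ ‖S.B₁ κ‖ ≤ K := by
  obtain ⟨K₀, h₀⟩ := S.isBarOp₀.uniform
  obtain ⟨K₁, h₁⟩ := S.isBarOp₁.uniform
  have n0 : 0 ≤ ‖S.B₀ 0‖ := ContinuousLinearMap.opNorm_nonneg _
  exact ⟨max K₀ K₁, (n0.trans (h₀ 0)).trans (le_max_left _ _), fun κ =>
    ⟨(h₀ κ).trans (le_max_left _ _), (h₁ κ).trans (le_max_right _ _)⟩⟩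

theorem continuous_B₀ : Continuous S.B₀ := by
  obtain ⟨L, hL⟩ := S.isBarOp₀.lipschitz
  refine LipschitzWith.continuous (K := (|L|).toNNReal) (LipschitzWith.of_dist_le_mul fun κ κ' => ?_)
  rw [dist_eq_norm, dist_eq_norm, Real.coe_toNNReal _ (abs_nonneg _)]
  exact (hL κ κ').trans (mul_le_mul_of_nonneg_right (le_abs_self _) (norm_nonneg _))

theorem continuous_B₁ : Continuous S.B₁ := by
  obtain ⟨L, hL⟩ := S.isBarOp₁.lipschitz
  refine LipschitzWith.continuous (K := (|L|).toNNReal) (LipschitzWith.of_dist_le_mul fun κ κ' => ?_)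
  rw [dist_eq_norm, dist_eq_norm, Real.coe_toNNReal _ (abs_nonneg _)]
  exact (hL κ κ').trans (mul_le_mul_of_nonneg_right (le_abs_self _) (norm_nonneg _))

theorem continuous_T : Continuous fun x : ℂ × ℝ => S.T x.1 x.2 := by
  have h0 := S.continuous_B₀
  have h1 := S.continuous_B₁
  have h2 : Continuous fun x : ℂ × ℝ => (2 : ℂ) • S.C₀ + (x.2 : ℂ) • S.C₁ := by fun_prop
  have h3 : Continuous fun x : ℂ × ℝ => (2 : ℂ) • S.B₀ x.1 + (x.2 : ℂ) • S.B₁ x.1 := by fun_prop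
  exact (h2.clm_comp h3).const_smul (-(1 / 4 : ℂ))

/-- The phase `e_{k₀}` drops out: `u e_{-k} = (2ρ⁻² + εχ)e_{-κ}` and `e_k ū = e_κ(2ρ⁻² + εχ̄)`, so
only `κ` and `χ` remain. -/
theorem isScatOp (hp : 2 < p) (hp' : p ≠ ⊤) {k₀ : ℂ} {φ : ℂ → ℂ} (hχ : IsTest (chi k₀ φ))
    (S : SolitonOps p (chi k₀ φ)) (κ : ℂ) (ε : ℝ) :
    IsScatOp p (k₀ + κ) (fun z => soliton k₀ z + (ε : ℂ) * φ z) (S.T κ ε) := by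
  intro h
  set G : LpC ∞ := (2 : ℂ) • S.B₀ κ h + (ε : ℂ) • S.B₁ κ h with hG
  have hGae : G =ᵐ[volume] barFun κ (fun x => 2 * (rhoSq x : ℂ)⁻¹ + ε * conj (chi k₀ φ x)) h := by
    filter_upwards [Lp.coeFn_add ((2 : ℂ) • S.B₀ κ h) ((ε : ℂ) • S.B₁ κ h),
      Lp.coeFn_smul (2 : ℂ) (S.B₀ κ h), Lp.coeFn_smul (ε : ℂ) (S.B₁ κ h), S.isBarOp₀.apply κ h,
      S.isBarOp₁.apply κ h] with z h1 h2 h3 h4 h5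
    rw [hG, h1, Pi.add_apply, h2, h3, Pi.smul_apply, Pi.smul_apply, h4, h5,
      barFun_linear hp hp' isWeight_inv_rhoSq hχ.star.isWeight, smul_eq_mul, smul_eq_mul]
  have hT : S.T κ ε h = -(1 / 4 : ℂ) • ((2 : ℂ) • S.C₀ G + (ε : ℂ) • S.C₁ G) := rfl
  have hbd : ∀ {w : ℂ → ℂ}, IsWeight w → ∃ d : ℝ, ∀ᵐ z, ‖w z * G z‖ ≤ d * wt 2 z := fun hw => by
    obtain ⟨-, c, hc, hcb⟩ := hw
    refine ⟨c * ‖G‖, ?_⟩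
    filter_upwards [ae_norm_le_norm G] with z hz
    rw [norm_mul]
    calc _ ≤ (c * wt 2 z) * ‖G‖ := mul_le_mul (hcb z) hz (norm_nonneg _)
          (mul_nonneg hc (wt_nonneg _ _))
      _ = _ := by ring
  obtain ⟨d₀, hd₀⟩ := hbd isWeight_inv_rhoSq
  obtain ⟨d₁, hd₁⟩ := hbd hχ.isWeight
  have hGm : AEStronglyMeasurable G volume := Lp.aestronglyMeasurable G
  have m₀ : AEStronglyMeasurable (fun ζ => (rhoSq ζ : ℂ)⁻¹ * G ζ) volume :=
    isWeight_inv_rhoSq.1.aestronglyMeasurable.mul hGm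
  have m₁ : AEStronglyMeasurable (fun ζ => chi k₀ φ ζ * G ζ) volume :=
    hχ.continuous.aestronglyMeasurable.mul hGm
  have hin : (fun ζ => 2 * ((rhoSq ζ : ℂ)⁻¹ * G ζ) + ε * (chi k₀ φ ζ * G ζ)) =ᵐ[volume]
      fun ζ => (soliton k₀ ζ + (ε : ℂ) * φ ζ) * expo (-(k₀ + κ)) ζ * cauchyBar (fun w =>
        expo (k₀ + κ) w * conj (soliton k₀ w + (ε : ℂ) * φ w) * h w) ζ := by
    filter_upwards [hGae] with ζ hζ
    rw [hζ, barFun]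
    have e1 : (fun x => expo κ x * ((2 * (rhoSq x : ℂ)⁻¹ + ε * conj (chi k₀ φ x)) * h x)) =
        fun w => expo (k₀ + κ) w * conj (soliton k₀ w + (ε : ℂ) * φ w) * h w := by
      ext x
      have h1 := expo_neg_mul_expo k₀ x
      rw [expo_add, chi, soliton]
      simp only [map_mul, map_add, map_div₀, conj_expo, Complex.conj_ofReal, map_ofNat, neg_neg]
      linear_combination (-2 * expo κ x * (rhoSq x : ℂ)⁻¹ * h x) * h1
    rw [e1, neg_add, expo_add, chi, soliton]
    have h1 := expo_neg_mul_expo k₀ ζ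
    linear_combination (-2 * (rhoSq ζ : ℂ)⁻¹ * expo (-κ) ζ * cauchyBar (fun w =>
        expo (k₀ + κ) w * conj (soliton k₀ w + (ε : ℂ) * φ w) * h w) ζ) * h1
  filter_upwards [Lp.coeFn_smul (-(1 / 4 : ℂ)) ((2 : ℂ) • S.C₀ G + (ε : ℂ) • S.C₁ G),
    Lp.coeFn_add ((2 : ℂ) • S.C₀ G) ((ε : ℂ) • S.C₁ G), Lp.coeFn_smul (2 : ℂ) (S.C₀ G),
    Lp.coeFn_smul (ε : ℂ) (S.C₁ G), S.isCauchyOp₀.apply G, S.isCauchyOp₁.apply G] with z h1 h2 h3 h4 h5 h6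
  rw [hT, h1, Pi.smul_apply, h2, Pi.add_apply, h3, h4, Pi.smul_apply, Pi.smul_apply, h5, h6, smul_eq_mul,
    smul_eq_mul, smul_eq_mul, scatFun, ← cauchy_congr hin, cauchy_linear m₀ m₁ one_lt_two hd₀ hd₁]

end SolitonOps

/-! ### Explicit eigenvectors and dual eigenvectors of the soliton operator. -/

/-- At `z = 0` the kernel is `-1/ζ` and cancels the factor `ζ`, so known Cauchy transforms evaluate
integrals. -/
theorem integral_eq_of_cauchy_zero {f : ℂ → ℂ} : ∫ z, f z = -(Real.pi * cauchy (fun ζ => ζ * f ζ) 0) := by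
  have hpi : (Real.pi : ℂ) ≠ 0 := Complex.ofReal_ne_zero.mpr Real.pi_ne_zero
  rw [cauchy, mul_inv_cancel_left₀ hpi, ← integral_neg]
  refine integral_congr_ae ?_
  have hne : ∀ᵐ ζ : ℂ, ζ ≠ 0 := by simp [ae_iff, measure_singleton]
  filter_upwards [hne] with ζ hζ
  rw [zero_sub]
  field_simp

theorem integral_inv_rhoSq_sq : ∫ z, ((rhoSq z : ℂ) ^ 2)⁻¹ = Real.pi := by
  rw [integral_eq_of_cauchy_zero, cauchy_mul_inv_rhoSq_sq]
  simp [rhoSq]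

theorem integral_inv_rhoSq_cube : ∫ z, ((rhoSq z : ℂ) ^ 3)⁻¹ = Real.pi / 2 := by
  have hd : dbar (fun ζ => (rhoSq ζ : ℂ)⁻¹ * (rhoSq ζ : ℂ)⁻¹) = fun ζ => -2 * (ζ * ((rhoSq ζ : ℂ) ^ 3)⁻¹) := by
    ext ζ
    rw [((HasW.inv_rhoSq ζ).mul (HasW.inv_rhoSq ζ)).dbar_eq]
    have := rhoSq_ne_zero ζ
    field_simp
    ring
  have h := cauchy_dbar_of_decay (v := fun ζ => (rhoSq ζ : ℂ)⁻¹ * (rhoSq ζ : ℂ)⁻¹) (c := 2) (s := 4)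
    (b := 2) (contDiff_inv_rhoSq.mul contDiff_inv_rhoSq) (by norm_num) (by norm_num) (fun ζ => ?_)
    (fun ζ => ?_) 0
  · rw [hd, cauchy_mul_left] at h
    rw [integral_eq_of_cauchy_zero]
    have h0 : (rhoSq 0 : ℂ) = 1 := by simp [rhoSq]
    rw [h0] at h
    norm_num at h
    linear_combination (Real.pi / 2 : ℂ) * h
  · rw [norm_mul, norm_inv_rhoSq, ← wt_add]
    have := wt_nonneg 4 ζ
    norm_num
    linarith
  · rw [hd, norm_mul, norm_mul, norm_inv, norm_pow, ← inv_pow, ← norm_inv, norm_inv_rhoSq]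
    have h1 := norm_mul_wt_le 2 ζ
    have h2 : wt (2 - 1) ζ ≤ 1 := wt_le_one (by norm_num) ζ
    have h3 : wt 2 ζ ≤ 1 := wt_le_one (by norm_num) ζ
    have h4 := wt_nonneg 2 ζ
    norm_num
    calc ‖ζ‖ * wt 2 ζ ^ 3 = (‖ζ‖ * wt 2 ζ) * wt 2 ζ * wt 2 ζ := by ring
      _ ≤ 1 * 1 * wt 2 ζ := by gcongr; exact h1.trans h2
      _ = _ := by ring

theorem integrable_inv_rhoSq_pow {n : ℕ} (hn : 2 ≤ n) : Integrable fun z => ((rhoSq z : ℂ) ^ n)⁻¹ := by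
  refine (integrable_wt (s := 4) (by norm_num)).mono' ?_ (Eventually.of_forall fun z => ?_)
  · exact ((contDiff_rhoSq (n := 0)).continuous.pow n |>.inv₀
      fun z => pow_ne_zero n (rhoSq_ne_zero z)).aestronglyMeasurable
  · rw [norm_inv, norm_pow, ← inv_pow, ← norm_inv, norm_inv_rhoSq]
    have e : wt 4 z = wt 2 z ^ 2 := by rw [pow_two, ← wt_add]; norm_num
    rw [e]
    exact pow_le_pow_of_le_one (wt_nonneg _ _) (wt_le_one (by norm_num) z) hn

theorem integral_norm_sq_mul_inv_rhoSq_cube :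
    ∫ z, z * (conj z * ((rhoSq z : ℂ) ^ 3)⁻¹) = Real.pi / 2 := by
  have h : ∀ z, z * (conj z * ((rhoSq z : ℂ) ^ 3)⁻¹) = ((rhoSq z : ℂ) ^ 2)⁻¹ - ((rhoSq z : ℂ) ^ 3)⁻¹ :=
    fun z => by
      have h0 := rhoSq_ne_zero z
      have h1 := ofReal_rhoSq z
      field_simp
      rw [h1]
      ring
  simp only [h]
  rw [integral_sub (integrable_inv_rhoSq_pow le_rfl) (integrable_inv_rhoSq_pow (by norm_num)),
    integral_inv_rhoSq_sq, integral_inv_rhoSq_cube]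
  ring

/-- The fixed vectors `ρ⁻²`, `z̄ ρ⁻²` of the scattering operator of the soliton. -/
noncomputable def fixedFun : Fin 2 → ℂ → ℂ
  | 0, z => (rhoSq z : ℂ)⁻¹
  | 1, z => conj z * (rhoSq z : ℂ)⁻¹

/-- The densities of the dual fixed functionals. -/
noncomputable def dualFun : Fin 2 → ℂ → ℂ
  | 0, z => (2 / Real.pi : ℂ) * ((rhoSq z : ℂ) ^ 2)⁻¹
  | 1, z => (2 / Real.pi : ℂ) * (z * ((rhoSq z : ℂ) ^ 2)⁻¹)

/-- The Cauchy transforms of the dual densities. -/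
noncomputable def dualPot : Fin 2 → ℂ → ℂ
  | 0, z => (2 / Real.pi : ℂ) * (conj z * (rhoSq z : ℂ)⁻¹)
  | 1, z => (2 / Real.pi : ℂ) * (-(rhoSq z : ℂ)⁻¹)

/-- The conjugate Cauchy transforms of the weighted fixed vectors. -/
noncomputable def fixedPot : Fin 2 → ℂ → ℂ
  | 0, z => z * (rhoSq z : ℂ)⁻¹
  | 1, z => -(rhoSq z : ℂ)⁻¹

theorem continuous_inv_rhoSq_sq : Continuous fun z => ((rhoSq z : ℂ) ^ 2)⁻¹ := by
  simp only [← inv_pow]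
  exact continuous_inv_rhoSq.pow 2

theorem continuous_fixedFun (j : Fin 2) : Continuous (fixedFun j) := by
  fin_cases j
  · exact continuous_inv_rhoSq
  · exact Complex.continuous_conj.mul continuous_inv_rhoSq

theorem continuous_dualFun (j : Fin 2) : Continuous (dualFun j) := by
  fin_cases j
  · exact continuous_inv_rhoSq_sq.const_mul _
  · exact (continuous_id.mul continuous_inv_rhoSq_sq).const_mul _

theorem continuous_dualPot (j : Fin 2) : Continuous (dualPot j) := by
  fin_cases j
  · exact (Complex.continuous_conj.mul continuous_inv_rhoSq).const_mul _
  · exact continuous_inv_rhoSq.neg.const_mul _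

theorem norm_two_div_pi : ‖(2 / Real.pi : ℂ)‖ ≤ 1 := by
  rw [norm_div, Complex.norm_real, Real.norm_of_nonneg Real.pi_pos.le, div_le_one Real.pi_pos]
  norm_num
  linarith [Real.pi_gt_three]

theorem norm_inv_rhoSq_le (z : ℂ) : ‖(rhoSq z : ℂ)⁻¹‖ ≤ wt 1 z := by
  rw [norm_inv_rhoSq]
  exact wt_anti (by norm_num) z

theorem norm_fixedFun_le (j : Fin 2) (z : ℂ) : ‖fixedFun j z‖ ≤ wt 1 z := by
  fin_cases j
  · exact norm_inv_rhoSq_le z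
  · exact norm_conj_mul_inv_rhoSq_le z

theorem norm_dualPot_le (j : Fin 2) (z : ℂ) : ‖dualPot j z‖ ≤ wt 1 z := by
  fin_cases j
  · change ‖(2 / Real.pi : ℂ) * (conj z * (rhoSq z : ℂ)⁻¹)‖ ≤ wt 1 z
    rw [norm_mul]
    exact (mul_le_of_le_one_left (norm_nonneg _) norm_two_div_pi).trans (norm_conj_mul_inv_rhoSq_le z)
  · change ‖(2 / Real.pi : ℂ) * (-(rhoSq z : ℂ)⁻¹)‖ ≤ wt 1 z
    rw [norm_mul, norm_neg]
    exact (mul_le_of_le_one_left (norm_nonneg _) norm_two_div_pi).trans (norm_inv_rhoSq_le z)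

theorem norm_dualFun_le (j : Fin 2) (z : ℂ) : ‖dualFun j z‖ ≤ wt 3 z := by
  have h4 : wt 4 z ≤ wt 3 z := wt_anti (by norm_num) z
  fin_cases j
  · change ‖(2 / Real.pi : ℂ) * ((rhoSq z : ℂ) ^ 2)⁻¹‖ ≤ wt 3 z
    rw [norm_mul, norm_inv_rhoSq_sq]
    exact (mul_le_of_le_one_left (wt_nonneg _ _) norm_two_div_pi).trans h4
  · change ‖(2 / Real.pi : ℂ) * (z * ((rhoSq z : ℂ) ^ 2)⁻¹)‖ ≤ wt 3 z
    rw [norm_mul, norm_mul, norm_inv_rhoSq_sq]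
    have := norm_mul_wt_le 4 z
    norm_num at this
    exact (mul_le_of_le_one_left (mul_nonneg (norm_nonneg _) (wt_nonneg _ _)) norm_two_div_pi).trans this

theorem integrable_dualFun (i : Fin 2) : Integrable (dualFun i) :=
  (integrable_wt (s := 3) (by norm_num)).mono' (continuous_dualFun i).aestronglyMeasurable
    (Eventually.of_forall (norm_dualFun_le i))

theorem cauchy_dualFun (i : Fin 2) (z : ℂ) : cauchy (dualFun i) z = dualPot i z := by
  fin_cases i
  · exact (cauchy_mul_left _ _ z).trans (congrArg _ (cauchy_inv_rhoSq_sq z))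
  · exact (cauchy_mul_left _ _ z).trans (congrArg _ (cauchy_mul_inv_rhoSq_sq z))

theorem cauchyBar_fixedFun (j : Fin 2) (z : ℂ) :
    cauchyBar (fun x => (rhoSq x : ℂ)⁻¹ * fixedFun j x) z = fixedPot j z := by
  fin_cases j
  · have : (fun x => (rhoSq x : ℂ)⁻¹ * (rhoSq x : ℂ)⁻¹) = fun x => ((rhoSq x : ℂ) ^ 2)⁻¹ := by
      ext x; rw [pow_two, mul_inv]
    exact (congrArg (cauchyBar · z) this).trans (cauchyBar_inv_rhoSq_sq z)
  · have : (fun x => (rhoSq x : ℂ)⁻¹ * (conj x * (rhoSq x : ℂ)⁻¹)) = fun x => conj x * ((rhoSq x : ℂ) ^ 2)⁻¹ := by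
      ext x; rw [pow_two, mul_inv]; ring
    exact (congrArg (cauchyBar · z) this).trans (cauchyBar_conj_mul_inv_rhoSq_sq z)

theorem barFun_zero_fixedFun (j : Fin 2) (z : ℂ) :
    barFun 0 (fun z => (rhoSq z : ℂ)⁻¹) (fixedFun j) z = fixedPot j z := by
  have h : ∀ z, expo 0 z = 1 := fun z => by simp [expo]
  rw [barFun, neg_zero, h, one_mul, ← cauchyBar_fixedFun]
  simp only [h, one_mul]

theorem cauchy_fixedPot (j : Fin 2) (z : ℂ) :
    cauchy (fun x => (rhoSq x : ℂ)⁻¹ * fixedPot j x) z = -fixedFun j z := by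
  fin_cases j
  · have : (fun x => (rhoSq x : ℂ)⁻¹ * (x * (rhoSq x : ℂ)⁻¹)) = fun x => x * ((rhoSq x : ℂ) ^ 2)⁻¹ := by
      ext x; rw [pow_two, mul_inv]; ring
    exact (congrArg (cauchy · z) this).trans (cauchy_mul_inv_rhoSq_sq z)
  · have : (fun x => (rhoSq x : ℂ)⁻¹ * -(rhoSq x : ℂ)⁻¹) = fun x => -1 * ((rhoSq x : ℂ) ^ 2)⁻¹ := by
      ext x; rw [pow_two, mul_inv]; ring
    refine (congrArg (cauchy · z) this).trans ((cauchy_mul_left _ _ z).trans ?_)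
    rw [cauchy_inv_rhoSq_sq, neg_one_mul]
    rfl

/-- The double transform of the dual densities reproduces them up to sign. -/
theorem inv_rhoSq_mul_cauchyBar_dualPot (i : Fin 2) (z : ℂ) :
    (rhoSq z : ℂ)⁻¹ * cauchyBar (fun x => (rhoSq x : ℂ)⁻¹ * dualPot i x) z = -dualFun i z := by
  fin_cases i
  · have : (fun x => (rhoSq x : ℂ)⁻¹ * ((2 / Real.pi : ℂ) * (conj x * (rhoSq x : ℂ)⁻¹))) =
        fun x => (2 / Real.pi : ℂ) * (conj x * ((rhoSq x : ℂ) ^ 2)⁻¹) := by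
      ext x; rw [pow_two, mul_inv]; ring
    change (rhoSq z : ℂ)⁻¹ * cauchyBar (fun x => (rhoSq x : ℂ)⁻¹ * ((2 / Real.pi : ℂ) *
      (conj x * (rhoSq x : ℂ)⁻¹))) z = -((2 / Real.pi : ℂ) * ((rhoSq z : ℂ) ^ 2)⁻¹)
    rw [this, cauchyBar_mul_left, cauchyBar_conj_mul_inv_rhoSq_sq, pow_two, mul_inv]
    ring
  · have : (fun x => (rhoSq x : ℂ)⁻¹ * ((2 / Real.pi : ℂ) * (-(rhoSq x : ℂ)⁻¹))) =
        fun x => (-(2 / Real.pi : ℂ)) * ((rhoSq x : ℂ) ^ 2)⁻¹ := by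
      ext x; rw [pow_two, mul_inv]; ring
    change (rhoSq z : ℂ)⁻¹ * cauchyBar (fun x => (rhoSq x : ℂ)⁻¹ * ((2 / Real.pi : ℂ) *
      (-(rhoSq x : ℂ)⁻¹))) z = -((2 / Real.pi : ℂ) * (z * ((rhoSq z : ℂ) ^ 2)⁻¹))
    rw [this, cauchyBar_mul_left, cauchyBar_inv_rhoSq_sq, pow_two, mul_inv]
    ring

/-- Both diagonal integrals of the unnormalised densities are `π/2`, whence the constant `2/π`; the
off-diagonal ones vanish by parity. -/
theorem integral_dualFun_mul_fixedFun (i j : Fin 2) :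
    ∫ z, dualFun i z * fixedFun j z = if i = j then 1 else 0 := by
  have hpi : (Real.pi : ℂ) ≠ 0 := Complex.ofReal_ne_zero.mpr Real.pi_ne_zero
  have hneg : ∀ z, rhoSq (-z) = rhoSq z := fun z => by simp [rhoSq]
  fin_cases i <;> fin_cases j
  · change ∫ z, (2 / Real.pi : ℂ) * ((rhoSq z : ℂ) ^ 2)⁻¹ * (rhoSq z : ℂ)⁻¹ = 1
    have : ∀ z, (2 / Real.pi : ℂ) * ((rhoSq z : ℂ) ^ 2)⁻¹ * (rhoSq z : ℂ)⁻¹ =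
        (2 / Real.pi : ℂ) * ((rhoSq z : ℂ) ^ 3)⁻¹ := fun z => by rw [pow_succ _ 2, mul_inv]; ring
    simp only [this]
    rw [integral_const_mul, integral_inv_rhoSq_cube]
    field_simp
  · change ∫ z, (2 / Real.pi : ℂ) * ((rhoSq z : ℂ) ^ 2)⁻¹ * (conj z * (rhoSq z : ℂ)⁻¹) = 0
    exact integral_odd_eq_zero fun z => by rw [hneg, map_neg]; ring
  · change ∫ z, (2 / Real.pi : ℂ) * (z * ((rhoSq z : ℂ) ^ 2)⁻¹) * (rhoSq z : ℂ)⁻¹ = 0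
    exact integral_odd_eq_zero fun z => by rw [hneg]; ring
  · change ∫ z, (2 / Real.pi : ℂ) * (z * ((rhoSq z : ℂ) ^ 2)⁻¹) * (conj z * (rhoSq z : ℂ)⁻¹) = 1
    have : ∀ z, (2 / Real.pi : ℂ) * (z * ((rhoSq z : ℂ) ^ 2)⁻¹) * (conj z * (rhoSq z : ℂ)⁻¹) =
        (2 / Real.pi : ℂ) * (z * (conj z * ((rhoSq z : ℂ) ^ 3)⁻¹)) := fun z => by
      rw [pow_succ _ 2, mul_inv]; ring
    simp only [this]
    rw [integral_const_mul, integral_norm_sq_mul_inv_rhoSq_cube]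
    field_simp

section

variable {p : ℝ≥0∞} [Fact (1 ≤ p)]

theorem memLp_fixedFun (hp : 2 < p) (hp' : p ≠ ⊤) (j : Fin 2) : MemLp (fixedFun j) p volume := by
  obtain ⟨-, -, -, hpr⟩ := one_lt_toReal_conj (p := p) (q := ENNReal.conjExponent p) hp hp'
  exact memLp_of_le_wt Fact.out hp' (continuous_fixedFun j).aestronglyMeasurable (c := 1) (s := 1)
    (by rwa [one_mul]) (Eventually.of_forall fun z => by rw [one_mul]; exact norm_fixedFun_le j z)

/-- The functional given by integration against a weight. -/
theorem exists_functional (hp : 2 < p) (hp' : p ≠ ⊤) {w : ℂ → ℂ} (hw : IsWeight w) :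
    (∃ l : LpC p →L[ℂ] ℂ, ∀ h, l h = ∫ z, w z * h z) ∧ ∀ h : LpC p, Integrable fun z => w z * h z := by
  have i1 : (ENNReal.conjExponent p).HolderConjugate p :=
    ENNReal.HolderConjugate.symm (p := p) (q := ENNReal.conjExponent p)
  have i2 : Fact (1 ≤ ENNReal.conjExponent p) := ⟨by simp [ENNReal.conjExponent]⟩
  obtain ⟨hq', hq1, -, -⟩ := one_lt_toReal_conj (p := p) (q := ENNReal.conjExponent p) hp hp'
  have hm : MemLp w (ENNReal.conjExponent p) volume := hw.memLp hq' hq1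
  exact ⟨⟨pairing (hm.toLp w), fun h => pairing_toLp_apply hm h⟩, fun h => integrable_mul_Lp hm h⟩

theorem isWeight_dualFun (i : Fin 2) : IsWeight (dualFun i) :=
  ⟨continuous_dualFun i, 1, zero_le_one, fun z => by
    rw [one_mul]
    exact (norm_dualFun_le i z).trans (wt_anti (by norm_num) z)⟩

theorem norm_weight_mul_Linfty_le {w : ℂ → ℂ} {c : ℝ} (hc : 0 ≤ c) (hw : ∀ z, ‖w z‖ ≤ c * wt 2 z)
    (g : LpC ∞) : ∀ᵐ z, ‖w z * g z‖ ≤ (c * ‖g‖) * wt 2 z := by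
  filter_upwards [ae_norm_le_norm g] with z hz
  rw [norm_mul]
  calc _ ≤ (c * wt 2 z) * ‖g‖ := mul_le_mul (hw z) hz (norm_nonneg _) (mul_nonneg hc (wt_nonneg _ _))
    _ = _ := by ring

/-- The dual functionals on the range of a weighted Cauchy transform. -/
theorem integral_dualFun_mul_cauchyOp {w : ℂ → ℂ} (hw : IsWeight w) {S : LpC ∞ →L[ℂ] LpC p}
    (hS : IsCauchyOp w S) (i : Fin 2) (g : LpC ∞) :
    ∫ z, dualFun i z * S g z = -∫ z, w z * g z * dualPot i z := by
  obtain ⟨hwc, c, hc, hcb⟩ := hw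
  have h := cauchy_duality (F := fun ζ => w ζ * g ζ) (hwc.aestronglyMeasurable.mul
    (Lp.aestronglyMeasurable g)) one_lt_two (norm_weight_mul_Linfty_le hc hcb g) (integrable_dualFun i)
  simp only [cauchy_dualFun] at h
  rw [← h]
  refine integral_congr_ae ?_
  filter_upwards [hS.apply g] with z hz
  rw [hz, mul_comm]

theorem isFixedPair_of_fixed (hp : 2 < p) (hp' : p ≠ ⊤) {χ : ℂ → ℂ} (S : SolitonOps p χ) {κ : ℂ}
    {h : LpC p} (hh : S.T κ 0 h = h) : IsFixedPair κ h := by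
  have hbar : ∀ z, barFun κ (fun z => (rhoSq z : ℂ)⁻¹) h z = expo (-κ) z *
      cauchyBar (fun w => expo κ w * (rhoSq w : ℂ)⁻¹ * h w) z := fun z => by
    simp only [barFun, mul_assoc]
  refine ⟨?_, ?_, ?_⟩
  · have hw : IsWeight fun z => (wt 2 z : ℂ) := ⟨Complex.continuous_ofReal.comp (continuous_wt 2), 1,
      zero_le_one, fun z => by rw [Complex.norm_real, Real.norm_of_nonneg (wt_nonneg _ _), one_mul]⟩
    exact (exists_functional hp hp' hw).2 h
  · obtain ⟨C, hC⟩ := S.isBarOp₀.bounded h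
    refine ⟨C, fun z => ?_⟩
    have := hC κ z
    rwa [hbar, norm_mul, norm_expo, one_mul] at this
  · rw [S.T_zero] at hh
    have h1 : (h : ℂ → ℂ) =ᵐ[volume] ((-(S.C₀ (S.B₀ κ h)) : LpC p) : ℂ → ℂ) := by
      conv_lhs => rw [← hh]
      rfl
    filter_upwards [h1, Lp.coeFn_neg (S.C₀ (S.B₀ κ h)), S.isCauchyOp₀.apply_eq (S.isBarOp₀.apply κ h)]
      with z h1 h2 h3
    rw [h1, h2, Pi.neg_apply, h3]
    simp only [hbar, mul_assoc]

/-- The fixed vectors as elements of `L^p`. -/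
noncomputable def fixedVec (hp : 2 < p) (hp' : p ≠ ⊤) (j : Fin 2) : LpC p :=
  (memLp_fixedFun hp hp' j).toLp _

theorem coeFn_fixedVec (hp : 2 < p) (hp' : p ≠ ⊤) (j : Fin 2) :
    fixedVec hp hp' j =ᵐ[volume] fixedFun j := MemLp.coeFn_toLp _

theorem T_fixedVec (hp : 2 < p) (hp' : p ≠ ⊤) {χ : ℂ → ℂ} (S : SolitonOps p χ) (j : Fin 2) :
    S.T 0 0 (fixedVec hp hp' j) = fixedVec hp hp' j := by
  rw [S.T_zero]
  ext1
  have h0 := S.isBarOp₀.apply_eq (coeFn_fixedVec hp hp' j) 0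
  filter_upwards [Lp.coeFn_neg (S.C₀ (S.B₀ 0 (fixedVec hp hp' j))), S.isCauchyOp₀.apply_eq h0,
    coeFn_fixedVec hp hp' j] with z h1 h2 h3
  change ((-(S.C₀ (S.B₀ 0 (fixedVec hp hp' j))) : LpC p) : ℂ → ℂ) z = _
  rw [h1, Pi.neg_apply, h2, h3]
  simp only [barFun_zero_fixedFun, cauchy_fixedPot, neg_neg]

/-- Both transforms are skew, so the transpose of `-C ρ⁻² C̄ ρ⁻²` is `-ρ⁻² C̄ ρ⁻² C`, which fixes
the dual densities. Test functions provide the pointwise decay that the duality needs; density does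
the rest. -/
theorem integral_dualFun_mul_T (hp : 2 < p) (hp' : p ≠ ⊤) {χ : ℂ → ℂ} (S : SolitonOps p χ) (i : Fin 2)
    (h : LpC p) : ∫ z, dualFun i z * S.T 0 0 h z = ∫ z, dualFun i z * h z := by
  obtain ⟨⟨l, hl⟩, -⟩ := exists_functional hp hp' (isWeight_dualFun i)
  rw [← hl, ← hl]
  refine Lp_induction_test hp' (motive := fun h => l (S.T 0 0 h) = l h) (isClosed_eq
    (l.continuous.comp (S.T 0 0).continuous) l.continuous) (fun h u hu hhu => ?_) h
  have e : ∀ z, expo 0 z = 1 := fun z => by simp [expo]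
  have h1 : S.T 0 0 h = -(S.C₀ (S.B₀ 0 h)) := by rw [S.T_zero]; rfl
  rw [h1, map_neg, hl, hl, integral_dualFun_mul_cauchyOp isWeight_inv_rhoSq S.isCauchyOp₀, neg_neg]
  have hF : IsTest fun x => (rhoSq x : ℂ)⁻¹ * u x := IsTest.smooth_mul contDiff_inv_rhoSq hu
  obtain ⟨c, hc⟩ := hF.bound 2
  have hv : Integrable fun z => (rhoSq z : ℂ)⁻¹ * dualPot i z := by
    refine (integrable_wt (s := 3) (by norm_num)).mono' (continuous_inv_rhoSq.mul
      (continuous_dualPot i)).aestronglyMeasurable (Eventually.of_forall fun z => ?_)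
    have h3 : wt 3 z = wt 2 z * wt 1 z := by rw [← wt_add]; norm_num
    rw [norm_mul, norm_inv_rhoSq, h3]
    exact mul_le_mul_of_nonneg_left (norm_dualPot_le i z) (wt_nonneg _ _)
  have h2 := cauchyBar_duality hF.continuous.aestronglyMeasurable one_lt_two (Eventually.of_forall hc) hv
  have h3 : ∫ z, (rhoSq z : ℂ)⁻¹ * S.B₀ 0 h z * dualPot i z =
      ∫ z, cauchyBar (fun x => (rhoSq x : ℂ)⁻¹ * u x) z * ((rhoSq z : ℂ)⁻¹ * dualPot i z) := by
    refine integral_congr_ae ?_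
    filter_upwards [S.isBarOp₀.apply_eq hhu 0] with z hz
    rw [hz, barFun, neg_zero, e, one_mul]
    simp only [e, one_mul]
    ring
  rw [h3, h2, ← integral_neg]
  refine integral_congr_ae ?_
  filter_upwards [hhu] with z hz
  rw [hz, mul_right_comm, inv_rhoSq_mul_cauchyBar_dualPot, neg_mul, neg_neg]

/-- The number `1` is a semisimple eigenvalue of the scattering operator of the soliton. -/
theorem semisimpleAtOne (hp : 2 < p) (hp' : p ≠ ⊤) {χ : ℂ → ℂ} (S : SolitonOps p χ)
    {l : Fin 2 → LpC p →L[ℂ] ℂ} (hl : ∀ i h, l i h = ∫ z, dualFun i z * h z) :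
    SemisimpleAtOne (S.T 0 0) (fixedVec hp hp') l where
  compact := S.isCompactOperator 0 0
  apply_vec := T_fixedVec hp hp' S
  dual_apply i x := by rw [hl, hl, integral_dualFun_mul_T hp hp' S]
  biorth i j := by
    rw [hl, ← integral_dualFun_mul_fixedFun]
    refine integral_congr_ae ?_
    filter_upwards [coeFn_fixedVec hp hp' j] with z hz
    rw [hz]
  ker_le x hx := by
    obtain ⟨c₀, c₁, hc⟩ := (isFixedPair_of_fixed hp hp' S hx).exists_eq
    have e : x = c₀ • fixedVec hp hp' 0 + c₁ • fixedVec hp hp' 1 := by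
      ext1
      filter_upwards [hc, Lp.coeFn_add (c₀ • fixedVec hp hp' 0) (c₁ • fixedVec hp hp' 1),
        Lp.coeFn_smul c₀ (fixedVec hp hp' 0), Lp.coeFn_smul c₁ (fixedVec hp hp' 1),
        coeFn_fixedVec hp hp' 0, coeFn_fixedVec hp hp' 1] with z h1 h2 h3 h4 h5 h6
      rw [h1, h2, Pi.add_apply, h3, h4, Pi.smul_apply, Pi.smul_apply, h5, h6, neg_zero]
      simp only [expo, map_zero, zero_mul, add_zero, mul_zero, Complex.exp_zero, fixedFun, smul_eq_mul]
      ring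
    rw [e]
    exact Submodule.add_mem _ (Submodule.smul_mem _ _ (Submodule.subset_span ⟨0, rfl⟩))
      (Submodule.smul_mem _ _ (Submodule.subset_span ⟨1, rfl⟩))

theorem isUnit_one_sub_T_zero (hp : 2 < p) (hp' : p ≠ ⊤) {χ : ℂ → ℂ} (S : SolitonOps p χ) {κ : ℂ}
    (hκ : κ ≠ 0) : IsUnit (1 - S.T κ 0) := by
  refine isUnit_one_sub_of_isCompactOperator (S.isCompactOperator κ 0) fun x hx => ?_
  ext1
  filter_upwards [(isFixedPair_of_fixed hp hp' S hx).eq_zero hκ, Lp.coeFn_zero ℂ p (volume : Measure ℂ)]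
    with z h1 h2
  rw [h1, h2, Pi.zero_apply]

end

/-! ### The first-order term in `κ`. -/

/-- The bilinear form `∬ n(z) M(x - z) s(x)`. -/
noncomputable def convForm (n s M : ℂ → ℂ) : ℂ := ∫ z, n z * ∫ x, M (x - z) * s x

section ConvForm

variable {n s M M' : ℂ → ℂ} {m m' : ℝ}

theorem integrable_convForm_inner (hM : Measurable M) (hMb : ∀ y, ‖M y‖ ≤ m) (hs : Integrable s) (z : ℂ) :
    Integrable fun x => M (x - z) * s x := by
  have h1 : Measurable fun x => M (x - z) := hM.comp (measurable_id.sub_const z)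
  refine (hs.norm.const_mul m).mono' (h1.aestronglyMeasurable.mul hs.aestronglyMeasurable)
    (Eventually.of_forall fun x => ?_)
  rw [norm_mul]
  exact mul_le_mul_of_nonneg_right (hMb _) (norm_nonneg _)

theorem norm_convForm_inner_le (hMb : ∀ y, ‖M y‖ ≤ m) (hs : Integrable s) (z : ℂ) :
    ‖∫ x, M (x - z) * s x‖ ≤ m * ∫ x, ‖s x‖ := by
  rw [← integral_const_mul]
  refine norm_integral_le_of_norm_le (hs.norm.const_mul m) (Eventually.of_forall fun x => ?_)
  rw [norm_mul]
  exact mul_le_mul_of_nonneg_right (hMb _) (norm_nonneg _)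

theorem integrable_convForm (hM : Measurable M) (hMb : ∀ y, ‖M y‖ ≤ m) (hn : Integrable n)
    (hs : Integrable s) (hsm : Measurable s) : Integrable fun z => n z * ∫ x, M (x - z) * s x := by
  have h1 : StronglyMeasurable fun z => ∫ x, M (x - z) * s x := by
    have : Measurable fun q : ℂ × ℂ => M (q.2 - q.1) * s q.2 :=
      (hM.comp (measurable_snd.sub measurable_fst)).mul (hsm.comp measurable_snd)
    exact this.stronglyMeasurable.integral_prod_right
  exact hn.mul_bdd h1.aestronglyMeasurable
    (Eventually.of_forall (norm_convForm_inner_le hMb hs))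

theorem convForm_linear (hM : Measurable M) (hMb : ∀ y, ‖M y‖ ≤ m) (hM' : Measurable M')
    (hMb' : ∀ y, ‖M' y‖ ≤ m') (hn : Integrable n) (hs : Integrable s) (hsm : Measurable s) (a b : ℂ) :
    convForm n s (fun y => a * M y + b * M' y) = a * convForm n s M + b * convForm n s M' := by
  unfold convForm
  rw [← integral_const_mul, ← integral_const_mul, ← integral_add
    ((integrable_convForm hM hMb hn hs hsm).const_mul a)
    ((integrable_convForm hM' hMb' hn hs hsm).const_mul b)]
  refine integral_congr_ae (Eventually.of_forall fun z => ?_)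
  have h1 := (integrable_convForm_inner hM hMb hs z).const_mul a
  have h2 := (integrable_convForm_inner hM' hMb' hs z).const_mul b
  have h3 : ∫ x, (a * M (x - z) + b * M' (x - z)) * s x =
      a * (∫ x, M (x - z) * s x) + b * ∫ x, M' (x - z) * s x := by
    rw [← integral_const_mul, ← integral_const_mul, ← integral_add h1 h2]
    refine integral_congr_ae (Eventually.of_forall fun x => ?_)
    ring
  change n z * (∫ x, (a * M (x - z) + b * M' (x - z)) * s x) = _
  rw [h3]
  ring

/-- The growth `|x - z|^{1/2}` splits into `ρ^{1/2}` in each variable, so densities of order `ρ⁻³`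
are reduced to the integrable `ρ^{-5/2}`. -/
theorem norm_sub_rpow_half_le (x z : ℂ) :
    ‖x - z‖ ^ ((1 : ℝ) / 2) ≤ wt (-(1 / 2)) z * wt (-(1 / 2)) x := by
  have h1 : ‖x - z‖ ^ 2 ≤ rhoSq z * rhoSq x := by
    have h2 : ‖x - z‖ ≤ ‖x‖ + ‖z‖ := norm_sub_le _ _
    have h3 : ‖x - z‖ ^ 2 ≤ (‖x‖ + ‖z‖) ^ 2 := by gcongr
    unfold rhoSq
    nlinarith [sq_nonneg (‖x‖ * ‖z‖ - 1)]
  have h4 : ‖x - z‖ ^ ((1 : ℝ) / 2) = (‖x - z‖ ^ 2) ^ ((1 : ℝ) / 4) := by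
    rw [← Real.rpow_natCast, ← Real.rpow_mul (norm_nonneg _)]
    norm_num
  rw [h4]
  calc _ ≤ (rhoSq z * rhoSq x) ^ ((1 : ℝ) / 4) := by gcongr
    _ = _ := by
      rw [Real.mul_rpow (rhoSq_pos z).le (rhoSq_pos x).le, wt, wt]
      norm_num

theorem norm_convForm_le {c : ℝ} (hc : 0 ≤ c) (hMb : ∀ y, ‖M y‖ ≤ c * ‖y‖ ^ ((1 : ℝ) / 2))
    (hn : ∀ z, ‖n z‖ ≤ wt 3 z) (hs : ∀ z, ‖s z‖ ≤ wt 3 z) :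
    ‖convForm n s M‖ ≤ c * (∫ z, wt (5 / 2) z) ^ 2 := by
  have hi : Integrable (wt (5 / 2)) := integrable_wt (by norm_num)
  have hw : ∀ z, wt (-(1 / 2)) z * wt 3 z = wt (5 / 2) z := fun z => by rw [← wt_add]; norm_num
  have h1 : ∀ z, ‖∫ x, M (x - z) * s x‖ ≤ (c * ∫ x, wt (5 / 2) x) * wt (-(1 / 2)) z := fun z => by
    rw [mul_right_comm, ← integral_const_mul]
    refine norm_integral_le_of_norm_le (hi.const_mul _) (Eventually.of_forall fun x => ?_)
    rw [norm_mul]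
    calc _ ≤ (c * (wt (-(1 / 2)) z * wt (-(1 / 2)) x)) * wt 3 x :=
          mul_le_mul ((hMb _).trans (mul_le_mul_of_nonneg_left (norm_sub_rpow_half_le x z) hc)) (hs x)
            (norm_nonneg _) (mul_nonneg hc (mul_nonneg (wt_nonneg _ _) (wt_nonneg _ _)))
      _ = _ := by rw [← hw x]; ring
  have h0 : 0 ≤ ∫ x, wt (5 / 2) x := integral_nonneg fun x => wt_nonneg _ _
  rw [convForm, pow_two, ← mul_assoc, ← integral_const_mul]
  refine norm_integral_le_of_norm_le (hi.const_mul _) (Eventually.of_forall fun z => ?_)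
  rw [norm_mul]
  calc _ ≤ wt 3 z * ((c * ∫ x, wt (5 / 2) x) * wt (-(1 / 2)) z) :=
        mul_le_mul (hn z) (h1 z) (norm_nonneg _) (wt_nonneg _ _)
    _ = _ := by rw [← hw z]; ring

theorem convForm_conj_mul_inv_conj : convForm n s (fun y => conj y * (conj y)⁻¹) =
    (∫ z, n z) * ∫ x, s x := by
  have h : ∀ z, ∫ x, (fun y => conj y * (conj y)⁻¹) (x - z) * s x = ∫ x, s x := fun z => by
    refine integral_congr_ae ?_
    have hne : ∀ᵐ x : ℂ, x ≠ z := by simp [ae_iff, measure_singleton]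
    filter_upwards [hne] with x hx
    have : conj (x - z) ≠ 0 := (map_ne_zero _).mpr (sub_ne_zero.mpr hx)
    simp only [mul_inv_cancel₀ this, one_mul]
  simp only [convForm, h]
  rw [integral_mul_const]

theorem convForm_eq_zero_of_odd (hM : ∀ y, M (-y) = M y)
    (h : (∀ z, n (-z) = -n z) ∧ (∀ z, s (-z) = s z) ∨ (∀ z, n (-z) = n z) ∧ (∀ z, s (-z) = -s z)) :
    convForm n s M = 0 := by
  refine integral_odd_eq_zero fun z => ?_
  have e : ∫ x, M (x - -z) * s x = ∫ x, M (x - z) * s (-x) := by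
    rw [← integral_neg_eq_self]
    refine integral_congr_ae (Eventually.of_forall fun x => ?_)
    change M (-x - -z) * s (-x) = M (x - z) * s (-x)
    rw [← hM (x - z)]
    congr 2
    ring
  rcases h with ⟨h1, h2⟩ | ⟨h1, h2⟩
  · simp only [e, h1, h2, neg_mul]
  · simp only [e, h1, h2, mul_neg, integral_neg]

theorem integral_comp_I_mul (f : ℂ → ℂ) : ∫ z, f (Complex.I * z) = ∫ z, f z := by
  have h : MeasurePreserving (rotation (⟨Complex.I, by simp [Submonoid.unitSphere]⟩ : Circle)) volume volume :=
    LinearIsometryEquiv.measurePreserving _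
  exact h.integral_comp (rotation _).toHomeomorph.measurableEmbedding f

/-- The quarter turn changes the sign of `y/ȳ` and fixes radial densities; it covers the entry that
parity cannot detect. -/
theorem convForm_eq_zero_of_rotate (hM : ∀ y, M (Complex.I * y) = -M y)
    (hn : ∀ z, n (Complex.I * z) = n z) (hs : ∀ z, s (Complex.I * z) = s z) : convForm n s M = 0 := by
  have h1 : ∀ z, ∫ x, M (x - Complex.I * z) * s x = -∫ x, M (x - z) * s x := fun z => by
    rw [← integral_comp_I_mul, ← integral_neg]
    refine integral_congr_ae (Eventually.of_forall fun x => ?_)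
    simp only [hs, ← mul_sub, hM, neg_mul]
  have h2 : convForm n s M = -convForm n s M := by
    conv_lhs => rw [convForm, ← integral_comp_I_mul]
    simp only [h1, hn, mul_neg, integral_neg]
    rfl
  exact self_eq_neg.mp h2

end ConvForm

/-- The exponent `3/2` lies between the quadratic bound for small `θ` and the linear one for large
`θ`. A quadratic remainder would leave a kernel growing like `|y|`, too much for densities known
only to be `O(ρ⁻³)`. -/
theorem norm_exp_sub_one_sub_le (θ : ℝ) :
    ‖Complex.exp (Complex.I * θ) - 1 - Complex.I * θ‖ ≤ 2 * |θ| ^ ((3 : ℝ) / 2) := by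
  have hn : ‖Complex.I * (θ : ℂ)‖ = |θ| := by simp
  rcases le_total |θ| 1 with h | h
  · have h1 := Complex.norm_exp_sub_one_sub_id_le (x := Complex.I * θ) (by rw [hn]; exact h)
    rw [hn] at h1
    rcases (abs_nonneg θ).eq_or_lt with h0 | h0
    · rw [← h0] at h1 ⊢
      rw [Real.zero_rpow (by norm_num)]
      simpa using h1
    · have h2 : |θ| ^ 2 ≤ |θ| ^ ((3 : ℝ) / 2) := by
        rw [← Real.rpow_natCast]
        exact Real.rpow_le_rpow_of_exponent_ge h0 h (by norm_num)
      linarith [Real.rpow_nonneg (abs_nonneg θ) ((3 : ℝ) / 2)]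
  · have h1 := Real.norm_exp_I_mul_ofReal_sub_one_le (x := θ)
    rw [Real.norm_eq_abs] at h1
    have h2 : |θ| ≤ |θ| ^ ((3 : ℝ) / 2) := Real.self_le_rpow_of_one_le h (by norm_num)
    calc _ ≤ ‖Complex.exp (Complex.I * θ) - 1‖ + ‖Complex.I * (θ : ℂ)‖ := norm_sub_le _ _
      _ ≤ _ := by rw [hn]; linarith

/-- The first-order expansion of the oscillating kernel. -/
theorem norm_expo_kernel_sub_le (κ y : ℂ) :
    ‖(expo κ y - 1) * (conj y)⁻¹ - (Complex.I * κ * (y * (conj y)⁻¹) +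
      Complex.I * conj κ * (conj y * (conj y)⁻¹))‖ ≤ (8 * ‖κ‖ ^ ((3 : ℝ) / 2)) * ‖y‖ ^ ((1 : ℝ) / 2) := by
  rcases eq_or_ne y 0 with rfl | hy
  · simp
  have hy' : 0 < ‖y‖ := norm_pos_iff.mpr hy
  have h1 : κ * y + conj κ * conj y = ((2 * (κ * y).re : ℝ) : ℂ) := by
    rw [← map_mul, Complex.add_conj]
  have h2 : (expo κ y - 1) * (conj y)⁻¹ - (Complex.I * κ * (y * (conj y)⁻¹) +
      Complex.I * conj κ * (conj y * (conj y)⁻¹)) =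
      (Complex.exp (Complex.I * ((2 * (κ * y).re : ℝ) : ℂ)) - 1 -
        Complex.I * ((2 * (κ * y).re : ℝ) : ℂ)) * (conj y)⁻¹ := by
    rw [expo, ← h1]
    ring
  have h3 : |2 * (κ * y).re| ≤ 2 * (‖κ‖ * ‖y‖) := by
    rw [abs_mul, abs_two, ← norm_mul]
    gcongr
    exact Complex.abs_re_le_norm _
  rw [h2, norm_mul, norm_inv, RCLike.norm_conj, ← div_eq_mul_inv, div_le_iff₀ hy']
  have h5 : (2 : ℝ) ^ ((3 : ℝ) / 2) ≤ 4 := by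
    calc (2 : ℝ) ^ ((3 : ℝ) / 2) ≤ 2 ^ (2 : ℝ) :=
          Real.rpow_le_rpow_of_exponent_le one_le_two (by norm_num)
      _ = 4 := by norm_num
  calc _ ≤ 2 * |2 * (κ * y).re| ^ ((3 : ℝ) / 2) := norm_exp_sub_one_sub_le _
    _ ≤ 2 * (2 * (‖κ‖ * ‖y‖)) ^ ((3 : ℝ) / 2) := by gcongr
    _ = 2 * (2 ^ ((3 : ℝ) / 2) * (‖κ‖ ^ ((3 : ℝ) / 2) * ‖y‖ ^ ((3 : ℝ) / 2))) := by
      rw [Real.mul_rpow (by norm_num) (by positivity), Real.mul_rpow (norm_nonneg _) (norm_nonneg _)]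
    _ ≤ 2 * (4 * (‖κ‖ ^ ((3 : ℝ) / 2) * ‖y‖ ^ ((3 : ℝ) / 2))) := by gcongr
    _ = _ := by
      have : ‖y‖ ^ ((3 : ℝ) / 2) = ‖y‖ ^ ((1 : ℝ) / 2) * ‖y‖ := by
        rw [← Real.rpow_add_one hy'.ne']
        norm_num
      rw [this]
      ring

theorem integrable_inv_conj_sub_mul {F : ℂ → ℂ} (hF : AEStronglyMeasurable F volume) {c b : ℝ}
    (hb : 1 < b) (hFb : ∀ᵐ z, ‖F z‖ ≤ c * wt b z) (z : ℂ) :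
    Integrable fun x => (conj z - conj x)⁻¹ * F x := by
  refine (integrable_inv_sub_mul hF hb hFb z).mono ?_ (Eventually.of_forall fun x => le_of_eq ?_)
  · exact (by fun_prop : Measurable fun x : ℂ => (conj z - conj x)⁻¹).aestronglyMeasurable.mul hF
  · rw [norm_mul, norm_mul, norm_inv, norm_inv, ← map_sub, RCLike.norm_conj]

theorem norm_conj_mul_inv_rhoSq_sq_le (z : ℂ) : ‖conj z * ((rhoSq z : ℂ) ^ 2)⁻¹‖ ≤ wt 3 z := by
  rw [norm_mul, RCLike.norm_conj, norm_inv_rhoSq_sq]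
  have := norm_mul_wt_le 4 z
  norm_num at this
  exact this

theorem continuous_conj_mul_inv_rhoSq_sq : Continuous fun z => conj z * ((rhoSq z : ℂ) ^ 2)⁻¹ :=
  Complex.continuous_conj.mul continuous_inv_rhoSq_sq

theorem measurable_phase : Measurable fun y : ℂ => y * (conj y)⁻¹ := by fun_prop

theorem norm_phase_le (y : ℂ) : ‖y * (conj y)⁻¹‖ ≤ 1 := by
  rw [norm_mul, norm_inv, RCLike.norm_conj]
  exact mul_inv_le_one

/-- Writing `y = x - z` in the numerator splits the inner integral into `-πC̄[x a] + πz C̄[a]`. The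
transform `C̄[a] = -ρ⁻²` is explicit, and duality moves the other one onto `a`; each part
contributes `-π²/2`. -/
theorem convForm_phase : convForm (fun z => conj z * ((rhoSq z : ℂ) ^ 2)⁻¹)
    (fun z => conj z * ((rhoSq z : ℂ) ^ 2)⁻¹) (fun y => y * (conj y)⁻¹) = -(Real.pi : ℂ) ^ 2 := by
  have hpi : (Real.pi : ℂ) ≠ 0 := Complex.ofReal_ne_zero.mpr Real.pi_ne_zero
  set a : ℂ → ℂ := fun z => conj z * ((rhoSq z : ℂ) ^ 2)⁻¹ with ha
  have hac : Continuous a := continuous_conj_mul_inv_rhoSq_sq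
  have hab : ∀ᵐ z, ‖a z‖ ≤ 1 * wt 3 z := Eventually.of_forall fun z => by
    rw [one_mul]; exact norm_conj_mul_inv_rhoSq_sq_le z
  have hai : Integrable a := (integrable_wt (s := 3) (by norm_num)).mono' hac.aestronglyMeasurable
    (Eventually.of_forall norm_conj_mul_inv_rhoSq_sq_le)
  have hxc : Continuous fun x => x * a x := continuous_id.mul hac
  have hxb : ∀ᵐ z, ‖z * a z‖ ≤ 1 * wt 2 z := Eventually.of_forall fun z => by
    rw [norm_mul, one_mul]
    have h1 := norm_mul_wt_le 3 z
    norm_num at h1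
    exact (mul_le_mul_of_nonneg_left (norm_conj_mul_inv_rhoSq_sq_le z) (norm_nonneg z)).trans h1
  have hca : ∀ z, cauchyBar a z = -(rhoSq z : ℂ)⁻¹ := cauchyBar_conj_mul_inv_rhoSq_sq
  have hinner : ∀ z, ∫ x, (fun y => y * (conj y)⁻¹) (x - z) * a x =
      -(Real.pi * cauchyBar (fun x => x * a x) z) + Real.pi * (z * cauchyBar a z) := fun z => by
    have h1 := integrable_inv_conj_sub_mul hxc.aestronglyMeasurable one_lt_two hxb z
    have h2 := integrable_inv_conj_sub_mul hac.aestronglyMeasurable (by norm_num) hab z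
    rw [cauchyBar, cauchyBar, mul_inv_cancel_left₀ hpi, mul_left_comm z, mul_inv_cancel_left₀ hpi,
      ← integral_const_mul, ← integral_neg, ← integral_add h1.fun_neg (h2.const_mul z)]
    refine integral_congr_ae (Eventually.of_forall fun x => ?_)
    have h3 : (conj (x - z))⁻¹ = -(conj z - conj x)⁻¹ := by
      rw [map_sub, ← neg_sub, inv_neg]
    simp only [h3]
    ring
  have hval : ∀ z, z * a z * (rhoSq z : ℂ)⁻¹ = z * (conj z * ((rhoSq z : ℂ) ^ 3)⁻¹) := fun z => by
    rw [ha, pow_succ _ 2, mul_inv]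
    ring
  have hint : Integrable fun z => z * (conj z * ((rhoSq z : ℂ) ^ 3)⁻¹) := by
    by_contra h
    have := integral_norm_sq_mul_inv_rhoSq_cube
    rw [integral_undef h] at this
    exact div_ne_zero hpi two_ne_zero this.symm
  have hd := cauchyBar_duality hxc.aestronglyMeasurable one_lt_two hxb hai
  have hdi : Integrable fun z => cauchyBar (fun x => x * a x) z * a z := by
    obtain ⟨C, -, hC⟩ := exists_norm_cauchyBar_le (b := 2) (s := 0) le_rfl zero_le_one (by norm_num)
    have hC' : ∀ z, ‖cauchyBar (fun x => x * a x) z‖ ≤ C * 1 * wt 0 0 := fun z => by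
      simpa only [wt_zero] using hC _ 1 hxb z
    exact hai.bdd_mul (stronglyMeasurable_cauchyBar hxc.aestronglyMeasurable).aestronglyMeasurable
      (Eventually.of_forall hC')
  simp only [convForm, hinner, hca] at hd ⊢
  have h1 : ∀ z, a z * (-(Real.pi * cauchyBar (fun x => x * a x) z) + Real.pi * (z * -(rhoSq z : ℂ)⁻¹)) =
      -Real.pi * (cauchyBar (fun x => x * a x) z * a z) +
        -Real.pi * (z * (conj z * ((rhoSq z : ℂ) ^ 3)⁻¹)) := fun z => by
    rw [← hval]
    ring
  simp only [h1]
  rw [integral_add (hdi.const_mul _) (hint.const_mul _), integral_const_mul, integral_const_mul, hd]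
  simp only [mul_neg, hval, integral_neg]
  rw [integral_norm_sq_mul_inv_rhoSq_cube]
  ring

/-- The part of first order in `κ` of the reduced matrix. -/
noncomputable def kappaPart : Fin 2 → Fin 2 → ℂ → ℂ
  | 0, 1, κ => -2 * Complex.I * κ
  | 1, 0, κ => -2 * Complex.I * conj κ
  | 0, 0, _ => 0
  | 1, 1, _ => 0

theorem convForm_mul_left (c : ℂ) (n s M : ℂ → ℂ) :
    convForm (fun z => c * n z) s M = c * convForm n s M := by
  simp only [convForm, mul_assoc]
  rw [integral_const_mul]

theorem phase_neg (y : ℂ) : -y * (conj (-y))⁻¹ = y * (conj y)⁻¹ := by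
  rw [map_neg, inv_neg, neg_mul_neg]

theorem phase_I_mul (y : ℂ) : Complex.I * y * (conj (Complex.I * y))⁻¹ = -(y * (conj y)⁻¹) := by
  rw [map_mul, Complex.conj_I, mul_inv, inv_neg, Complex.inv_I]
  linear_combination (y * (conj y)⁻¹) * Complex.I_sq

theorem rhoSq_neg (z : ℂ) : rhoSq (-z) = rhoSq z := by simp [rhoSq]

theorem rhoSq_I_mul (z : ℂ) : rhoSq (Complex.I * z) = rhoSq z := by simp [rhoSq]

theorem inv_rhoSq_mul_dualPot (z : ℂ) :
    (rhoSq z : ℂ)⁻¹ * dualPot 0 z = (2 / Real.pi : ℂ) * (conj z * ((rhoSq z : ℂ) ^ 2)⁻¹) ∧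
    (rhoSq z : ℂ)⁻¹ * dualPot 1 z = (-(2 / Real.pi) : ℂ) * ((rhoSq z : ℂ) ^ 2)⁻¹ := by
  simp only [dualPot, pow_two, mul_inv]
  exact ⟨by ring, by ring⟩

theorem inv_rhoSq_mul_fixedFun (z : ℂ) :
    (rhoSq z : ℂ)⁻¹ * fixedFun 0 z = ((rhoSq z : ℂ) ^ 2)⁻¹ ∧
    (rhoSq z : ℂ)⁻¹ * fixedFun 1 z = conj z * ((rhoSq z : ℂ) ^ 2)⁻¹ := by
  simp only [fixedFun, pow_two, mul_inv]
  exact ⟨trivial, by ring⟩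

theorem integral_conj_mul_inv_rhoSq_sq : ∫ z, conj z * ((rhoSq z : ℂ) ^ 2)⁻¹ = 0 :=
  integral_odd_eq_zero fun z => by rw [rhoSq_neg, map_neg, neg_mul]

theorem norm_inv_rhoSq_mul_dualPot_le (i : Fin 2) (z : ℂ) : ‖(rhoSq z : ℂ)⁻¹ * dualPot i z‖ ≤ wt 3 z := by
  have h3 : wt 3 z = wt 2 z * wt 1 z := by rw [← wt_add]; norm_num
  rw [norm_mul, norm_inv_rhoSq, h3]
  exact mul_le_mul_of_nonneg_left (norm_dualPot_le i z) (wt_nonneg _ _)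

theorem norm_inv_rhoSq_mul_fixedFun_le (i : Fin 2) (z : ℂ) : ‖(rhoSq z : ℂ)⁻¹ * fixedFun i z‖ ≤ wt 3 z := by
  have h3 : wt 3 z = wt 2 z * wt 1 z := by rw [← wt_add]; norm_num
  rw [norm_mul, norm_inv_rhoSq, h3]
  exact mul_le_mul_of_nonneg_left (norm_fixedFun_le i z) (wt_nonneg _ _)

theorem continuous_inv_rhoSq_mul_dualPot (i : Fin 2) : Continuous fun z => (rhoSq z : ℂ)⁻¹ * dualPot i z :=
  continuous_inv_rhoSq.mul (continuous_dualPot i)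

theorem continuous_inv_rhoSq_mul_fixedFun (i : Fin 2) : Continuous fun z => (rhoSq z : ℂ)⁻¹ * fixedFun i z :=
  continuous_inv_rhoSq.mul (continuous_fixedFun i)

theorem integrable_of_norm_le_wt_three {f : ℂ → ℂ} (hf : Continuous f) (h : ∀ z, ‖f z‖ ≤ wt 3 z) :
    Integrable f :=
  (integrable_wt (s := 3) (by norm_num)).mono' hf.aestronglyMeasurable (Eventually.of_forall h)

/-- The kernel `y/ȳ` contributes only to entry `(0, 1)` and the constant kernel only to entry `(1,
0)`; all other pairings vanish by parity or the quarter turn. -/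
theorem convForm_phase_eq (i j : Fin 2) (κ : ℂ) : (Real.pi : ℂ)⁻¹ *
    convForm (fun z => (rhoSq z : ℂ)⁻¹ * dualPot i z) (fun z => (rhoSq z : ℂ)⁻¹ * fixedFun j z)
      (fun y => Complex.I * κ * (y * (conj y)⁻¹) + Complex.I * conj κ * (conj y * (conj y)⁻¹)) =
    kappaPart i j κ := by
  have hpi : (Real.pi : ℂ) ≠ 0 := Complex.ofReal_ne_zero.mpr Real.pi_ne_zero
  have hb : ∀ y : ℂ, ‖conj y * (conj y)⁻¹‖ ≤ 1 := fun y => by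
    rw [norm_mul, norm_inv]
    exact mul_inv_le_one
  rw [convForm_linear measurable_phase norm_phase_le (by fun_prop) hb
    (integrable_of_norm_le_wt_three (continuous_inv_rhoSq_mul_dualPot i) (norm_inv_rhoSq_mul_dualPot_le i))
    (integrable_of_norm_le_wt_three (continuous_inv_rhoSq_mul_fixedFun j) (norm_inv_rhoSq_mul_fixedFun_le j))
    (continuous_inv_rhoSq_mul_fixedFun j).measurable, convForm_conj_mul_inv_conj]
  have d0 : (fun z => (rhoSq z : ℂ)⁻¹ * dualPot 0 z) = _ := funext fun z => (inv_rhoSq_mul_dualPot z).1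
  have d1 : (fun z => (rhoSq z : ℂ)⁻¹ * dualPot 1 z) = _ := funext fun z => (inv_rhoSq_mul_dualPot z).2
  have f0 : (fun z => (rhoSq z : ℂ)⁻¹ * fixedFun 0 z) = _ := funext fun z => (inv_rhoSq_mul_fixedFun z).1
  have f1 : (fun z => (rhoSq z : ℂ)⁻¹ * fixedFun 1 z) = _ := funext fun z => (inv_rhoSq_mul_fixedFun z).2
  have e00 : convForm (fun z => conj z * ((rhoSq z : ℂ) ^ 2)⁻¹) (fun z => ((rhoSq z : ℂ) ^ 2)⁻¹)
      (fun y => y * (conj y)⁻¹) = 0 := convForm_eq_zero_of_odd phase_neg (Or.inl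
        ⟨fun z => by rw [rhoSq_neg, map_neg, neg_mul], fun z => by rw [rhoSq_neg]⟩)
  have e11 : convForm (fun z => ((rhoSq z : ℂ) ^ 2)⁻¹) (fun z => conj z * ((rhoSq z : ℂ) ^ 2)⁻¹)
      (fun y => y * (conj y)⁻¹) = 0 := convForm_eq_zero_of_odd phase_neg (Or.inr
        ⟨fun z => by rw [rhoSq_neg], fun z => by rw [rhoSq_neg, map_neg, neg_mul]⟩)
  have e10 : convForm (fun z => ((rhoSq z : ℂ) ^ 2)⁻¹) (fun z => ((rhoSq z : ℂ) ^ 2)⁻¹)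
      (fun y => y * (conj y)⁻¹) = 0 := convForm_eq_zero_of_rotate phase_I_mul
        (fun z => by rw [rhoSq_I_mul]) (fun z => by rw [rhoSq_I_mul])
  fin_cases i <;> fin_cases j <;>
    simp only [Fin.zero_eta, Fin.mk_one, Fin.isValue, d0, d1, f0, f1, convForm_mul_left, e00, e11, e10,
      convForm_phase, integral_const_mul, integral_conj_mul_inv_rhoSq_sq, integral_inv_rhoSq_sq, kappaPart]
  · ring
  · field_simp
    ring
  · field_simp
    ring
  · ring

theorem measurable_expo_kernel (κ : ℂ) : Measurable fun y : ℂ => (expo κ y - 1) * (conj y)⁻¹ := by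
  have := (continuous_expo κ).measurable
  fun_prop

theorem norm_expo_kernel_le (κ y : ℂ) : ‖(expo κ y - 1) * (conj y)⁻¹‖ ≤ 2 * ‖κ‖ := by
  have h0 : expo 0 y = 1 := by simp [expo]
  have h := norm_expo_sub_expo_le κ 0 y
  rw [h0, sub_zero] at h
  rw [norm_mul, norm_inv, RCLike.norm_conj]
  calc _ ≤ 2 * ‖κ‖ * ‖y‖ * ‖y‖⁻¹ := mul_le_mul_of_nonneg_right h (inv_nonneg.mpr (norm_nonneg _))
    _ ≤ 2 * ‖κ‖ := by
      rw [mul_assoc]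
      exact mul_le_of_le_one_right (by positivity) mul_inv_le_one

theorem barFun_sub_barFun_zero {h : ℂ → ℂ} (hh : Continuous fun x => (rhoSq x : ℂ)⁻¹ * h x)
    (hb : ∀ z, ‖(rhoSq z : ℂ)⁻¹ * h z‖ ≤ wt 3 z) (κ z : ℂ) :
    barFun κ (fun z => (rhoSq z : ℂ)⁻¹) h z - barFun 0 (fun z => (rhoSq z : ℂ)⁻¹) h z =
      -((Real.pi : ℂ)⁻¹ * ∫ x, (expo κ (x - z) - 1) * (conj (x - z))⁻¹ * ((rhoSq x : ℂ)⁻¹ * h x)) := by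
  have hi : ∀ κ, Integrable fun x => (conj z - conj x)⁻¹ * (expo κ (x - z) * ((rhoSq x : ℂ)⁻¹ * h x)) :=
    fun κ => by
      refine integrable_inv_conj_sub_mul (c := 1) (b := 3) (((continuous_expo κ).comp
        (continuous_id.sub continuous_const)).mul hh).aestronglyMeasurable (by norm_num)
        (Eventually.of_forall fun x => ?_) z
      change ‖expo κ (x - z) * ((rhoSq x : ℂ)⁻¹ * h x)‖ ≤ 1 * wt 3 x
      rw [norm_mul, norm_expo, one_mul, one_mul]
      exact hb x
  have e : ∀ κ, barFun κ (fun z => (rhoSq z : ℂ)⁻¹) h z = (Real.pi : ℂ)⁻¹ *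
      ∫ x, (conj z - conj x)⁻¹ * (expo κ (x - z) * ((rhoSq x : ℂ)⁻¹ * h x)) := fun κ => by
    rw [barFun_eq]
    congr 1
    refine integral_congr_ae (Eventually.of_forall fun x => ?_)
    ring
  rw [e, e, ← mul_sub, ← integral_sub (hi κ) (hi 0), ← mul_neg, ← integral_neg]
  congr 1
  refine integral_congr_ae (Eventually.of_forall fun x => ?_)
  have h0 : expo 0 (x - z) = 1 := by simp [expo]
  have h3 : (conj (x - z))⁻¹ = -(conj z - conj x)⁻¹ := by
    rw [map_sub, ← neg_sub, inv_neg]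
  simp only [h0, h3]
  ring

section

variable {p : ℝ≥0∞} [Fact (1 ≤ p)]

theorem dual_C₀_B₀_sub (hp : 2 < p) (hp' : p ≠ ⊤) {χ : ℂ → ℂ} (S : SolitonOps p χ)
    {l : Fin 2 → LpC p →L[ℂ] ℂ} (hl : ∀ i h, l i h = ∫ z, dualFun i z * h z) (i j : Fin 2) (κ : ℂ) :
    l i (S.C₀ ((S.B₀ κ - S.B₀ 0) (fixedVec hp hp' j))) = (Real.pi : ℂ)⁻¹ *
      convForm (fun z => (rhoSq z : ℂ)⁻¹ * dualPot i z) (fun z => (rhoSq z : ℂ)⁻¹ * fixedFun j z)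
        (fun y => (expo κ y - 1) * (conj y)⁻¹) := by
  rw [hl, integral_dualFun_mul_cauchyOp isWeight_inv_rhoSq S.isCauchyOp₀, convForm, ← integral_const_mul,
    ← integral_neg]
  refine integral_congr_ae ?_
  filter_upwards [Lp.coeFn_sub (S.B₀ κ (fixedVec hp hp' j)) (S.B₀ 0 (fixedVec hp hp' j)),
    S.isBarOp₀.apply_eq (coeFn_fixedVec hp hp' j) κ, S.isBarOp₀.apply_eq (coeFn_fixedVec hp hp' j) 0]
    with z h1 h2 h3
  change -((rhoSq z : ℂ)⁻¹ * ((S.B₀ κ (fixedVec hp hp' j) - S.B₀ 0 (fixedVec hp hp' j) : LpC ⊤) : ℂ → ℂ) z *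
    dualPot i z) = _
  rw [h1, Pi.sub_apply, h2, h3, barFun_sub_barFun_zero (continuous_inv_rhoSq_mul_fixedFun j)
    (norm_inv_rhoSq_mul_fixedFun_le j)]
  ring

/-- The expansion in `κ` of the reduced matrix of the soliton. -/
theorem norm_dual_C₀_B₀_sub_le (hp : 2 < p) (hp' : p ≠ ⊤) {χ : ℂ → ℂ} (S : SolitonOps p χ)
    {l : Fin 2 → LpC p →L[ℂ] ℂ} (hl : ∀ i h, l i h = ∫ z, dualFun i z * h z) (i j : Fin 2) (κ : ℂ) :
    ‖l i (S.C₀ ((S.B₀ κ - S.B₀ 0) (fixedVec hp hp' j))) - kappaPart i j κ‖ ≤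
      Real.pi⁻¹ * (8 * (∫ z, wt (5 / 2) z) ^ 2) * (‖κ‖ * ‖κ‖ ^ ((1 : ℝ) / 2)) := by
  have hn := integrable_of_norm_le_wt_three (continuous_inv_rhoSq_mul_dualPot i)
    (norm_inv_rhoSq_mul_dualPot_le i)
  have hs := integrable_of_norm_le_wt_three (continuous_inv_rhoSq_mul_fixedFun j)
    (norm_inv_rhoSq_mul_fixedFun_le j)
  have hL : ∀ y : ℂ, ‖Complex.I * κ * (y * (conj y)⁻¹) + Complex.I * conj κ * (conj y * (conj y)⁻¹)‖ ≤
      ‖κ‖ + ‖κ‖ := fun y => by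
    refine (norm_add_le _ _).trans (add_le_add ?_ ?_)
    · rw [norm_mul, norm_mul, Complex.norm_I, one_mul]
      exact mul_le_of_le_one_right (norm_nonneg _) (norm_phase_le y)
    · rw [norm_mul, norm_mul, Complex.norm_I, one_mul, RCLike.norm_conj]
      refine mul_le_of_le_one_right (norm_nonneg _) ?_
      rw [norm_mul, norm_inv]
      exact mul_inv_le_one
  have h := convForm_linear (measurable_expo_kernel κ) (norm_expo_kernel_le κ) (by fun_prop) hL hn hs
    (continuous_inv_rhoSq_mul_fixedFun j).measurable 1 (-1)
  have hpow : ‖κ‖ ^ ((3 : ℝ) / 2) = ‖κ‖ * ‖κ‖ ^ ((1 : ℝ) / 2) := by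
    rw [← Real.rpow_one_add' (norm_nonneg _) (by norm_num)]
    norm_num
  rw [dual_C₀_B₀_sub hp hp' S hl, ← convForm_phase_eq, ← mul_sub, ← one_mul (convForm _ _ fun y =>
    (expo κ y - 1) * (conj y)⁻¹), sub_eq_add_neg, ← neg_one_mul (convForm _ _ _), ← h, norm_mul, norm_inv,
    Complex.norm_real, Real.norm_of_nonneg Real.pi_pos.le, mul_assoc]
  refine mul_le_mul_of_nonneg_left ?_ (by positivity)
  refine (norm_convForm_le (c := 8 * ‖κ‖ ^ ((3 : ℝ) / 2)) (by positivity) (fun y => ?_)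
    (norm_inv_rhoSq_mul_dualPot_le i) (norm_inv_rhoSq_mul_fixedFun_le j)).trans (le_of_eq ?_)
  · rw [one_mul, neg_one_mul, ← sub_eq_add_neg]
    exact norm_expo_kernel_sub_le κ y
  · rw [hpow]
    ring

/-! ### The first-order term in `ε`. -/

theorem dual_C₁_B₀ (hp : 2 < p) (hp' : p ≠ ⊤) {χ : ℂ → ℂ} (hχ : IsTest χ) (S : SolitonOps p χ)
    {l : Fin 2 → LpC p →L[ℂ] ℂ} (hl : ∀ i h, l i h = ∫ z, dualFun i z * h z) (i j : Fin 2) :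
    l i (S.C₁ (S.B₀ 0 (fixedVec hp hp' j))) = -∫ z, fixedPot j z * dualPot i z * χ z := by
  rw [hl, integral_dualFun_mul_cauchyOp hχ.isWeight S.isCauchyOp₁]
  congr 1
  refine integral_congr_ae ?_
  filter_upwards [S.isBarOp₀.apply_eq (coeFn_fixedVec hp hp' j) 0] with z h
  rw [h, barFun_zero_fixedFun]
  ring

/-- The inner transform of `χ̄ψⱼ` is not explicit, so duality moves `C̄` onto the weighted dual
potential, whose transform is `-ρ²` times the dual density. -/
theorem dual_C₀_B₁ (hp : 2 < p) (hp' : p ≠ ⊤) {χ : ℂ → ℂ} (hχ : IsTest χ) (S : SolitonOps p χ)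
    {l : Fin 2 → LpC p →L[ℂ] ℂ} (hl : ∀ i h, l i h = ∫ z, dualFun i z * h z) (i j : Fin 2) :
    l i (S.C₀ (S.B₁ 0 (fixedVec hp hp' j))) =
      -∫ z, (rhoSq z : ℂ) * fixedFun j z * dualFun i z * conj (χ z) := by
  have hF : Continuous fun z => conj (χ z) * fixedFun j z := hχ.star.continuous.mul (continuous_fixedFun j)
  obtain ⟨c, hc⟩ := hχ.star.bound 1
  have hFb : ∀ z, ‖conj (χ z) * fixedFun j z‖ ≤ c * wt 2 z := fun z => by
    have e : wt 2 z = wt 1 z * wt 1 z := by rw [← wt_add]; norm_num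
    rw [norm_mul, e, ← mul_assoc]
    exact mul_le_mul (hc z) (norm_fixedFun_le j z) (norm_nonneg _) ((norm_nonneg _).trans (hc z))
  have h := cauchyBar_duality hF.aestronglyMeasurable one_lt_two (Eventually.of_forall hFb)
    (integrable_of_norm_le_wt_three (continuous_inv_rhoSq_mul_dualPot i) (norm_inv_rhoSq_mul_dualPot_le i))
  have e0 : ∀ z, expo 0 z = 1 := fun z => by simp [expo]
  rw [hl, integral_dualFun_mul_cauchyOp isWeight_inv_rhoSq S.isCauchyOp₀]
  have h1 : ∫ z, (rhoSq z : ℂ)⁻¹ * S.B₁ 0 (fixedVec hp hp' j) z * dualPot i z =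
      ∫ z, cauchyBar (fun x => conj (χ x) * fixedFun j x) z * ((rhoSq z : ℂ)⁻¹ * dualPot i z) := by
    refine integral_congr_ae ?_
    filter_upwards [S.isBarOp₁.apply_eq (coeFn_fixedVec hp hp' j) 0] with z hz
    rw [hz, barFun, neg_zero, e0, one_mul]
    simp only [e0, one_mul]
    ring
  rw [h1, h, neg_neg, ← integral_neg]
  refine integral_congr_ae (Eventually.of_forall fun z => ?_)
  have h2 := inv_rhoSq_mul_cauchyBar_dualPot i z
  have h3 : cauchyBar (fun x => (rhoSq x : ℂ)⁻¹ * dualPot i x) z = -((rhoSq z : ℂ) * dualFun i z) := by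
    rw [← mul_neg, ← h2, mul_inv_cancel_left₀ (rhoSq_ne_zero z)]
  simp only [h3]
  ring

end

/-- The part of first order in `ε` of the reduced matrix. -/
noncomputable def epsPart (k₀ : ℂ) (φ : ℂ → ℂ) : Fin 2 → Fin 2 → ℂ
  | 0, 0 => -2 * conj (alpha k₀ φ)
  | 0, 1 => 2 * conj (beta k₀ φ)
  | 1, 0 => -2 * beta k₀ φ
  | 1, 1 => -2 * alpha k₀ φ

/-- The factor `2` compensates the coefficient `1/2` of the `ε`-linear term in `sub_T_eq`. -/
theorem integral_eq_epsPart {k₀ : ℂ} {φ : ℂ → ℂ} (hχ : IsTest (chi k₀ φ)) (i j : Fin 2) :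
    (-∫ z, fixedPot j z * dualPot i z * chi k₀ φ z) +
      (-∫ z, (rhoSq z : ℂ) * fixedFun j z * dualFun i z * conj (chi k₀ φ z)) = 2 * epsPart k₀ φ i j := by
  have hpi : (Real.pi : ℂ) ≠ 0 := Complex.ofReal_ne_zero.mpr Real.pi_ne_zero
  have c1 : Continuous fun z => (rhoSq z : ℂ) := by unfold rhoSq; fun_prop
  have h1 : Integrable fun z => fixedPot j z * dualPot i z * chi k₀ φ z := by
    have hc : Continuous (fixedPot j) := by
      fin_cases j
      · exact continuous_id.mul continuous_inv_rhoSq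
      · exact continuous_inv_rhoSq.neg
    exact ((hc.mul (continuous_dualPot i)).mul hχ.continuous).integrable_of_hasCompactSupport hχ.2.mul_left
  have h2 : Integrable fun z => (rhoSq z : ℂ) * fixedFun j z * dualFun i z * conj (chi k₀ φ z) :=
    (((c1.mul (continuous_fixedFun j)).mul (continuous_dualFun i)).mul
      hχ.star.continuous).integrable_of_hasCompactSupport hχ.star.2.mul_left
  rw [← neg_add, ← integral_add h1 h2]
  have ha : conj (alpha k₀ φ) = (2 * Real.pi : ℂ)⁻¹ *
      ∫ z, (conj (chi k₀ φ z) + (‖z‖ : ℂ) ^ 2 * chi k₀ φ z) / (rhoSq z : ℂ) ^ 2 := by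
    rw [alpha, map_mul, ← integral_conj]
    simp [Complex.conj_ofNat]
  have hb : conj (beta k₀ φ) = -(2 * Real.pi : ℂ)⁻¹ *
      ∫ z, (conj (chi k₀ φ z) - chi k₀ φ z) * conj z / (rhoSq z : ℂ) ^ 2 := by
    rw [beta, map_mul, ← integral_conj]
    simp [Complex.conj_ofNat]
  have hz : ∀ z : ℂ, (‖z‖ : ℂ) ^ 2 = z * conj z := fun z => by rw [Complex.mul_conj']
  have key : ∀ {f g : ℂ → ℂ} {c : ℂ}, (∀ z, f z = c * g z) → ∫ z, f z = c * ∫ z, g z := fun {f g c} h => by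
    rw [← integral_const_mul]
    exact integral_congr_ae (Eventually.of_forall h)
  fin_cases i <;> fin_cases j <;>
    simp only [epsPart, fixedPot, dualPot, fixedFun, dualFun]
  · rw [ha, key (c := 2 / Real.pi) (g := fun z =>
      (conj (chi k₀ φ z) + (‖z‖ : ℂ) ^ 2 * chi k₀ φ z) / (rhoSq z : ℂ) ^ 2) ?_]
    · field_simp
    · intro z
      have h0 := rhoSq_ne_zero z
      rw [hz]
      field_simp
      ring
  · rw [hb, key (c := 2 / Real.pi) (g := fun z =>
      (conj (chi k₀ φ z) - chi k₀ φ z) * conj z / (rhoSq z : ℂ) ^ 2) ?_]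
    · field_simp
    · intro z
      have h0 := rhoSq_ne_zero z
      field_simp
      ring
  · rw [beta, key (c := -(2 / Real.pi)) (g := fun z =>
      (chi k₀ φ z - conj (chi k₀ φ z)) * z / (rhoSq z : ℂ) ^ 2) ?_]
    · field_simp
    · intro z
      have h0 := rhoSq_ne_zero z
      field_simp
      ring
  · rw [alpha, key (c := 2 / Real.pi) (g := fun z =>
      (chi k₀ φ z + (‖z‖ : ℂ) ^ 2 * conj (chi k₀ φ z)) / (rhoSq z : ℂ) ^ 2) ?_]
    · field_simp
    · intro z
      have h0 := rhoSq_ne_zero z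
      rw [hz]
      field_simp

/-! ### Expansion of the reduced determinant of the perturbed soliton. -/

section

variable {p : ℝ≥0∞} [Fact (1 ≤ p)]

theorem isBigO_fst : (fun x : ℂ × ℝ => ‖x.1‖) =O[𝓝 (0, 0)] fun x : ℂ × ℝ => |x.2| + ‖x.1‖ :=
  IsBigO.of_bound 1 (Eventually.of_forall fun x => by
    rw [norm_norm, one_mul, Real.norm_of_nonneg (by positivity)]
    linarith [abs_nonneg x.2])

theorem isBigO_snd : (fun x : ℂ × ℝ => (x.2 : ℂ)) =O[𝓝 (0, 0)] fun x : ℂ × ℝ => |x.2| + ‖x.1‖ :=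
  IsBigO.of_bound 1 (Eventually.of_forall fun x => by
    rw [Complex.norm_real, Real.norm_eq_abs, one_mul, Real.norm_of_nonneg (by positivity)]
    linarith [norm_nonneg x.1])

theorem SolitonOps.sub_T_eq {χ : ℂ → ℂ} (S : SolitonOps p χ) (κ : ℂ) (ε : ℝ) :
    S.T 0 0 - S.T κ ε = S.C₀ ∘L (S.B₀ κ - S.B₀ 0) + (ε : ℂ) • ((1 / 2 : ℂ) • (S.C₁ ∘L S.B₀ κ +
      S.C₀ ∘L S.B₁ κ) + (ε / 4 : ℂ) • (S.C₁ ∘L S.B₁ κ)) := by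
  rw [S.sub_T]
  module

theorem SolitonOps.continuous_epsCoeff {χ : ℂ → ℂ} (S : SolitonOps p χ) :
    Continuous fun x : ℂ × ℝ => (1 / 2 : ℂ) • (S.C₁ ∘L S.B₀ x.1 + S.C₀ ∘L S.B₁ x.1) +
      (x.2 / 4 : ℂ) • (S.C₁ ∘L S.B₁ x.1) := by
  have h0 := S.continuous_B₀
  have h1 := S.continuous_B₁
  have a : Continuous fun x : ℂ × ℝ => S.C₁ ∘L S.B₀ x.1 := continuous_const.clm_comp (by fun_prop)
  have b : Continuous fun x : ℂ × ℝ => S.C₀ ∘L S.B₁ x.1 := continuous_const.clm_comp (by fun_prop)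
  have c : Continuous fun x : ℂ × ℝ => S.C₁ ∘L S.B₁ x.1 := continuous_const.clm_comp (by fun_prop)
  fun_prop

theorem SolitonOps.T_sub_isBigO {χ : ℂ → ℂ} (S : SolitonOps p χ) :
    (fun x : ℂ × ℝ => S.T x.1 x.2 - S.T 0 0) =O[𝓝 (0, 0)] fun x : ℂ × ℝ => |x.2| + ‖x.1‖ := by
  obtain ⟨L, hL⟩ := S.isBarOp₀.lipschitz
  have h1 : (fun x : ℂ × ℝ => S.C₀ ∘L (S.B₀ x.1 - S.B₀ 0)) =O[𝓝 (0, 0)]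
      fun x : ℂ × ℝ => |x.2| + ‖x.1‖ := by
    refine IsBigO.trans (IsBigO.of_bound (‖S.C₀‖ * L) (Eventually.of_forall fun x => ?_)) isBigO_fst
    have := hL x.1 0
    rw [sub_zero] at this
    rw [norm_norm, mul_assoc]
    exact (ContinuousLinearMap.opNorm_comp_le _ _).trans (mul_le_mul_of_nonneg_left this
      (ContinuousLinearMap.opNorm_nonneg _))
  have h2 := isBigO_snd.smul ((S.continuous_epsCoeff.tendsto (0, 0)).isBigO_one ℝ)
  simp only [smul_eq_mul, mul_one] at h2
  refine (h1.add h2).neg_left.congr_left fun x => ?_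
  rw [← S.sub_T_eq, neg_sub]

/-- The coefficient of `ε` is continuous, so only its value at the origin matters. The `κ` part has
error `O(|κ|^{3/2})`. -/
theorem SolitonOps.reduced_matrix_isLittleO (hp : 2 < p) (hp' : p ≠ ⊤) {k₀ : ℂ} {φ : ℂ → ℂ}
    (hχ : IsTest (chi k₀ φ)) (S : SolitonOps p (chi k₀ φ)) {l : Fin 2 → LpC p →L[ℂ] ℂ}
    (hl : ∀ i h, l i h = ∫ z, dualFun i z * h z) (i j : Fin 2) :
    (fun x : ℂ × ℝ => l i ((S.T 0 0 - S.T x.1 x.2) (fixedVec hp hp' j)) -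
      (kappaPart i j x.1 + x.2 * epsPart k₀ φ i j)) =o[𝓝 (0, 0)] fun x : ℂ × ℝ => |x.2| + ‖x.1‖ := by
  have h1 : (fun x : ℂ × ℝ => l i (S.C₀ ((S.B₀ x.1 - S.B₀ 0) (fixedVec hp hp' j))) - kappaPart i j x.1)
      =o[𝓝 (0, 0)] fun x : ℂ × ℝ => |x.2| + ‖x.1‖ := by
    have h2 : (fun x : ℂ × ℝ => ‖x.1‖ ^ ((1 : ℝ) / 2)) =o[𝓝 (0, 0)] fun _ => (1 : ℝ) := by
      rw [isLittleO_one_iff]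
      have : Continuous fun x : ℂ × ℝ => ‖x.1‖ ^ ((1 : ℝ) / 2) :=
        (continuous_fst.norm).rpow_const fun _ => Or.inr (by norm_num)
      have := this.tendsto (0, 0)
      rwa [norm_zero, Real.zero_rpow (by norm_num)] at this
    have h3 := isBigO_fst.mul_isLittleO h2
    simp only [mul_one] at h3
    refine IsBigO.trans_isLittleO (IsBigO.of_bound (Real.pi⁻¹ * (8 * (∫ z, wt (5 / 2) z) ^ 2)) (Eventually.of_forall fun x => ?_)) h3
    rw [Real.norm_of_nonneg (by positivity : 0 ≤ ‖x.1‖ * ‖x.1‖ ^ ((1 : ℝ) / 2))]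
    exact norm_dual_C₀_B₀_sub_le hp hp' S hl i j x.1
  set G : ℂ × ℝ → LpC p →L[ℂ] LpC p := fun x => (1 / 2 : ℂ) • (S.C₁ ∘L S.B₀ x.1 + S.C₀ ∘L S.B₁ x.1) +
      (x.2 / 4 : ℂ) • (S.C₁ ∘L S.B₁ x.1) with hG
  have hGc : Continuous fun x => l i (G x (fixedVec hp hp' j)) :=
    (l i).continuous.comp (S.continuous_epsCoeff.clm_apply continuous_const)
  have hG0 : l i (G (0, 0) (fixedVec hp hp' j)) = epsPart k₀ φ i j := by
    have h := integral_eq_epsPart hχ i j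
    rw [← dual_C₁_B₀ hp hp' hχ S hl, ← dual_C₀_B₁ hp hp' hχ S hl] at h
    simp only [hG, Complex.ofReal_zero, zero_div, zero_smul, add_zero, smul_apply, add_apply, map_smul,
      map_add, ContinuousLinearMap.comp_apply, smul_eq_mul]
    linear_combination (1 / 2 : ℂ) * h
  have h4 : (fun x : ℂ × ℝ => l i (G x (fixedVec hp hp' j)) - epsPart k₀ φ i j) =o[𝓝 (0, 0)]
      fun _ => (1 : ℝ) := by
    rw [isLittleO_one_iff]
    have := (hGc.tendsto (0, 0)).sub_const (epsPart k₀ φ i j)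
    rwa [hG0, sub_self] at this
  have h5 := isBigO_snd.mul_isLittleO h4
  simp only [mul_one] at h5
  refine (h1.add h5).congr_left fun x => ?_
  rw [S.sub_T_eq]
  simp only [add_apply, smul_apply, map_add, map_smul, ContinuousLinearMap.comp_apply, smul_eq_mul, hG]
  ring

/-- With `w = iκ̄ + εβ` the off-diagonal entries are `2w̄` and `-2w`, the diagonal ones `-2εᾱ` and
`-2εα`, so the two products add up as squared moduli instead of cancelling. -/
theorem det_leading_eq (k₀ : ℂ) (φ : ℂ → ℂ) (κ : ℂ) (ε : ℝ) :
    (kappaPart 0 0 κ + ε * epsPart k₀ φ 0 0) * (kappaPart 1 1 κ + ε * epsPart k₀ φ 1 1) -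
      (kappaPart 0 1 κ + ε * epsPart k₀ φ 0 1) * (kappaPart 1 0 κ + ε * epsPart k₀ φ 1 0) =
    ((4 * (‖Complex.I * conj κ + (ε : ℂ) * beta k₀ φ‖ ^ 2 + ε ^ 2 * ‖alpha k₀ φ‖ ^ 2) : ℝ) : ℂ) := by
  have h1 := Complex.mul_conj' (Complex.I * conj κ + (ε : ℂ) * beta k₀ φ)
  have h2 := Complex.mul_conj' (alpha k₀ φ)
  simp only [map_add, map_mul, Complex.conj_I, Complex.conj_conj, Complex.conj_ofReal] at h1
  push_cast
  rw [← h1, ← h2]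
  simp only [kappaPart, epsPart]
  ring

theorem SolitonOps.det_reduced_isLittleO (hp : 2 < p) (hp' : p ≠ ⊤) {k₀ : ℂ} {φ : ℂ → ℂ}
    (hχ : IsTest (chi k₀ φ)) (S : SolitonOps p (chi k₀ φ)) {l : Fin 2 → LpC p →L[ℂ] ℂ}
    (hl : ∀ i h, l i h = ∫ z, dualFun i z * h z) {r : ℝ} (hr : Isolates r (S.T 0 0)) :
    (fun x : ℂ × ℝ => LinearMap.det (reduced r (S.T x.1 x.2)) -
        ((4 * (‖Complex.I * conj x.1 + (x.2 : ℂ) * beta k₀ φ‖ ^ 2 +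
          x.2 ^ 2 * ‖alpha k₀ φ‖ ^ 2) : ℝ) : ℂ))
      =o[𝓝 (0, 0)] (fun x : ℂ × ℝ => x.2 ^ 2 + |x.2| * ‖x.1‖ + ‖x.1‖ ^ 2) := by
  have hN : Tendsto (fun x : ℂ × ℝ => |x.2| + ‖x.1‖) (𝓝 (0, 0)) (𝓝 0) := by
    have : Continuous fun x : ℂ × ℝ => |x.2| + ‖x.1‖ := by fun_prop
    simpa using this.tendsto (0, 0)
  have h := (semisimpleAtOne hp hp' S hl).det_reduced_isLittleO hN S.T_sub_isBigO
    (M := fun i j x => kappaPart i j x.1 + x.2 * epsPart k₀ φ i j)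
    (S.reduced_matrix_isLittleO hp hp' hχ hl) hr
  simp only [det_leading_eq] at h
  refine h.trans_isBigO (IsBigO.of_bound 2 (Eventually.of_forall fun x => ?_))
  rw [Real.norm_of_nonneg (by positivity), Real.norm_of_nonneg (by positivity)]
  have h1 := sq_abs x.2
  nlinarith [sq_nonneg (|x.2|), sq_nonneg ‖x.1‖]

end

/-! ### Invertibility in the three ranges of `κ`. -/

namespace SolitonOps

variable {p : ℝ≥0∞} [Fact (1 ≤ p)]

/-- Near the origin the scattering operator has no fixed vector unless the leading part of the
reduced determinant is small. -/
theorem exists_isUnit_of_lt (hp : 2 < p) (hp' : p ≠ ⊤) {k₀ : ℂ} {φ : ℂ → ℂ}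
    (hχ : IsTest (chi k₀ φ)) (S : SolitonOps p (chi k₀ φ)) {l : Fin 2 → LpC p →L[ℂ] ℂ}
    (hl : ∀ i h, l i h = ∫ z, dualFun i z * h z) {c : ℝ} (hc : 0 < c) :
    ∃ δ > 0, ∀ (κ : ℂ) (ε : ℝ), ‖κ‖ < δ → |ε| < δ →
      c * (ε ^ 2 + |ε| * ‖κ‖ + ‖κ‖ ^ 2) <
        4 * (‖Complex.I * conj κ + (ε : ℂ) * beta k₀ φ‖ ^ 2 + ε ^ 2 * ‖alpha k₀ φ‖ ^ 2) →
      IsUnit (1 - S.T κ ε) := by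
  have hs := semisimpleAtOne hp hp' S hl
  obtain ⟨r, hr⟩ := hs.exists_isolates
  obtain ⟨h1, h2, -⟩ := hs.eventually_det_reduced (S.continuous_T.tendsto (0, 0)) hr
  have h3 := (S.det_reduced_isLittleO hp hp' hχ hl hr).def hc
  obtain ⟨δ, hδ, h⟩ := Metric.eventually_nhds_iff.mp (h1.and (h2.and h3))
  refine ⟨δ, hδ, fun κ ε hκ hε hlt => ?_⟩
  obtain ⟨g1, g2, g3⟩ := h (y := (κ, ε)) (by
    rw [Prod.dist_eq, dist_zero_right, dist_zero_right]
    exact max_lt hκ hε)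
  refine isUnit_of_det_reduced_ne_zero (S.isCompactOperator κ ε) hr.1 g1 (by rw [g2]; norm_num)
    fun h0 => ?_
  rw [h0, zero_sub, norm_neg, Complex.norm_real, Real.norm_of_nonneg (by positivity),
    Real.norm_of_nonneg (by positivity)] at g3
  exact absurd hlt (not_lt.mpr g3)

theorem eventually_isUnit (hp : 2 < p) (hp' : p ≠ ⊤) {χ : ℂ → ℂ} (S : SolitonOps p χ) {κ : ℂ}
    (hκ : κ ≠ 0) : ∀ᶠ x : ℝ × ℂ in 𝓝 (0, κ), IsUnit (1 - S.T x.2 x.1) := by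
  have hc : Tendsto (fun x : ℝ × ℂ => 1 - S.T x.2 x.1) (𝓝 (0, κ)) (𝓝 (1 - S.T κ 0)) :=
    (continuous_const.sub (S.continuous_T.comp continuous_swap)).tendsto (0, κ)
  exact hc.eventually_mem (Units.isOpen.mem_nhds (isUnit_one_sub_T_zero hp hp' S hκ))

/-- Away from `κ = 0` the operator `I - T(κ, ε)` is uniformly invertible for small `ε`. -/
theorem exists_isUnit_of_le_norm (hp : 2 < p) (hp' : p ≠ ⊤) {χ : ℂ → ℂ} (S : SolitonOps p χ)
    {δ : ℝ} (hδ : 0 < δ) : ∃ ε₀ > 0, ∀ (κ : ℂ) (ε : ℝ), |ε| < ε₀ → δ ≤ ‖κ‖ → IsUnit (1 - S.T κ ε) := by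
  obtain ⟨K, hK, hB⟩ := S.exists_norm_B_le
  have n0 : 0 ≤ ‖S.C₀‖ := ContinuousLinearMap.opNorm_nonneg _
  have n1 : 0 ≤ ‖S.C₁‖ := ContinuousLinearMap.opNorm_nonneg _
  set D : ℝ := ‖S.C₁‖ * K + ‖S.C₀‖ * K + ‖S.C₁‖ * K with hD
  have hD0 : 0 ≤ D := by positivity
  have hcomp : ∀ (A : LpC ⊤ →L[ℂ] LpC p) (B : LpC p →L[ℂ] LpC ⊤), ‖B‖ ≤ K → ‖A ∘L B‖ ≤ ‖A‖ * K :=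
    fun A B h => (ContinuousLinearMap.opNorm_comp_le _ _).trans
      (mul_le_mul_of_nonneg_left h (ContinuousLinearMap.opNorm_nonneg _))
  have hdec : ∀ᶠ κ in cocompact ℂ, ‖S.C₀ ∘L S.B₀ κ‖ < 1 / 2 := by
    have := S.decay.norm
    rw [norm_zero] at this
    exact this.eventually (gt_mem_nhds (by norm_num))
  obtain ⟨R, hR⟩ : ∃ R : ℝ, ∀ κ : ℂ, R < ‖κ‖ → ‖S.C₀ ∘L S.B₀ κ‖ < 1 / 2 := by
    rw [← Metric.cobounded_eq_cocompact, ← comap_norm_atTop, eventually_comap] at hdec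
    obtain ⟨R, hR⟩ := eventually_atTop.mp hdec
    exact ⟨R, fun κ hκ => hR _ hκ.le κ rfl⟩
  have hmid : ∀ᶠ ε : ℝ in 𝓝 0, ∀ κ ∈ Metric.closedBall (0 : ℂ) R ∩ (Metric.ball 0 δ)ᶜ,
      IsUnit (1 - S.T κ ε) := by
    -- On the compact annulus `δ ≤ |κ| ≤ R` invertibility at `ε = 0` is an open condition, hence
    -- holds for all small `ε` uniformly in `κ`.
    refine ((isCompact_closedBall 0 R).inter_right
      Metric.isOpen_ball.isClosed_compl).eventually_forall_of_forall_eventually fun κ hκ => ?_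
    have hκ0 : κ ≠ 0 := by
      rintro rfl
      exact hκ.2 (Metric.mem_ball_self hδ)
    exact S.eventually_isUnit hp hp' hκ0
  obtain ⟨η, hη, h⟩ := Metric.eventually_nhds_iff.mp hmid
  -- `η` serves the annulus. For `|κ| > R`, the bound `1` gives `ε² ≤ |ε|`, and the last one makes
  -- the `ε` terms smaller than `1/2`, which together with `‖C₀B₀(κ)‖ < 1/2` leaves `‖T‖ < 1`.
  refine ⟨min η (min 1 (1 / (2 * (D + 1)))), by positivity, fun κ ε hε hκ => ?_⟩
  obtain ⟨h1, h2⟩ := lt_min_iff.mp hε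
  obtain ⟨h2, h3⟩ := lt_min_iff.mp h2
  rcases le_or_gt ‖κ‖ R with hκR | hκR
  · refine h (by rwa [dist_zero_right]) κ ⟨?_, ?_⟩
    · rwa [mem_closedBall_zero_iff]
    · rw [Set.mem_compl_iff, mem_ball_zero_iff, not_lt]
      exact hκ
  · refine isUnit_one_sub_of_norm_lt_one ?_
    have hb1 : ‖(ε / 2 : ℂ) • (S.C₁ ∘L S.B₀ κ + S.C₀ ∘L S.B₁ κ)‖ ≤
        |ε| * (‖S.C₁‖ * K + ‖S.C₀‖ * K) := by
      rw [norm_smul, norm_div, Complex.norm_real, Real.norm_eq_abs, Complex.norm_ofNat]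
      refine mul_le_mul (by linarith [abs_nonneg ε]) ((norm_add_le _ _).trans (add_le_add
        (hcomp _ _ (hB κ).1) (hcomp _ _ (hB κ).2))) (norm_nonneg _) (abs_nonneg _)
    have hb2 : ‖(ε ^ 2 / 4 : ℂ) • (S.C₁ ∘L S.B₁ κ)‖ ≤ |ε| * (‖S.C₁‖ * K) := by
      rw [norm_smul, norm_div, norm_pow, Complex.norm_real, Real.norm_eq_abs, Complex.norm_ofNat]
      refine mul_le_mul ?_ (hcomp _ _ (hB κ).2) (norm_nonneg _) (abs_nonneg _)
      nlinarith [abs_nonneg ε]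
    have h4 : |ε| * (2 * (D + 1)) < 1 := by rwa [lt_div_iff₀ (by positivity)] at h3
    have h5 : |ε| * D = |ε| * (‖S.C₁‖ * K + ‖S.C₀‖ * K) + |ε| * (‖S.C₁‖ * K) := by rw [hD]; ring
    rw [S.T_eq]
    calc _ ≤ ‖-(S.C₀ ∘L S.B₀ κ)‖ + ‖(ε / 2 : ℂ) • (S.C₁ ∘L S.B₀ κ + S.C₀ ∘L S.B₁ κ)‖ +
          ‖(ε ^ 2 / 4 : ℂ) • (S.C₁ ∘L S.B₁ κ)‖ :=
            (norm_sub_le _ _).trans (add_le_add_left (norm_sub_le _ _) _)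
      _ < 1 := by
        rw [norm_neg]
        linarith [hR κ hκR, abs_nonneg ε]

theorem exists_isUnit_of_alpha_ne_zero (hp : 2 < p) (hp' : p ≠ ⊤) {k₀ : ℂ} {φ : ℂ → ℂ}
    (hχ : IsTest (chi k₀ φ)) (S : SolitonOps p (chi k₀ φ)) {l : Fin 2 → LpC p →L[ℂ] ℂ}
    (hl : ∀ i h, l i h = ∫ z, dualFun i z * h z) (hα : alpha k₀ φ ≠ 0) {C : ℝ} (hC : 0 < C) :
    ∃ ε₀ : ℝ, 0 < ε₀ ∧ ∀ ε : ℝ, ε ≠ 0 → |ε| < ε₀ → ∀ κ : ℂ, ‖κ‖ < C * |ε| → IsUnit (1 - S.T κ ε) := by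
  have ha : 0 < ‖alpha k₀ φ‖ ^ 2 := pow_pos (norm_pos_iff.mpr hα) 2
  have hD : 0 < 1 + C + C ^ 2 := by positivity
  -- For `|κ| < C|ε|` the error scale is at most `(1 + C + C²)ε²`, so this `c` bounds the error by
  -- `ε²|α|²`, a quarter of the `α` term alone.
  obtain ⟨δ, hδ, h⟩ := S.exists_isUnit_of_lt hp hp' hχ hl (c := ‖alpha k₀ φ‖ ^ 2 / (1 + C + C ^ 2))
    (by positivity)
  refine ⟨min δ (δ / C), by positivity, fun ε hε0 hε κ hκ => ?_⟩
  obtain ⟨h1, h2⟩ := lt_min_iff.mp hε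
  rw [lt_div_iff₀ hC] at h2
  refine h κ ε (by linarith) h1 ?_
  have he : 0 < ε ^ 2 := by positivity
  have h3 : |ε| * ‖κ‖ ≤ C * ε ^ 2 := by
    rw [← sq_abs ε]
    nlinarith [abs_nonneg ε]
  have h4 : ‖κ‖ ^ 2 ≤ C ^ 2 * ε ^ 2 := by
    rw [← sq_abs ε, ← mul_pow]
    gcongr
  calc _ ≤ ‖alpha k₀ φ‖ ^ 2 / (1 + C + C ^ 2) * ((1 + C + C ^ 2) * ε ^ 2) :=
        mul_le_mul_of_nonneg_left (by linarith) (by positivity)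
    _ = ε ^ 2 * ‖alpha k₀ φ‖ ^ 2 := by field_simp
    _ < _ := by
      have h5 := mul_pos he ha
      have h6 := sq_nonneg ‖Complex.I * conj κ + (ε : ℂ) * beta k₀ φ‖
      linarith

theorem exists_isUnit_of_lt_norm (hp : 2 < p) (hp' : p ≠ ⊤) {k₀ : ℂ} {φ : ℂ → ℂ}
    (hχ : IsTest (chi k₀ φ)) (S : SolitonOps p (chi k₀ φ)) {l : Fin 2 → LpC p →L[ℂ] ℂ}
    (hl : ∀ i h, l i h = ∫ z, dualFun i z * h z) :
    ∃ C : ℝ, 0 < C ∧ ∃ ε₀ : ℝ, 0 < ε₀ ∧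
      ∀ ε : ℝ, 0 < ε → ε < ε₀ → ∀ κ : ℂ, C * ε < ‖κ‖ → IsUnit (1 - S.T κ ε) := by
  -- Once `ε ≤ |κ|`, the error scale is at most `3|κ|²`, so `c = 1/6` gives an error at most
  -- `|κ|²/2`, below the lower bound `4(|κ|/2)²` for the leading term.
  obtain ⟨δ, hδ, h⟩ := S.exists_isUnit_of_lt hp hp' hχ hl (c := 1 / 6) (by norm_num)
  obtain ⟨ε₁, hε₁, h'⟩ := S.exists_isUnit_of_le_norm hp hp' hδ
  -- This constant yields both `ε ≤ |κ|` and `ε|β| ≤ |κ|/2`, so `β` cannot cancel more than half of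
  -- `iκ̄`.
  refine ⟨2 * ‖beta k₀ φ‖ + 1, by positivity, min δ ε₁, by positivity, fun ε hε hεlt κ hκ => ?_⟩
  obtain ⟨h1, h2⟩ := lt_min_iff.mp hεlt
  have habs : |ε| = ε := abs_of_pos hε
  rcases le_or_gt δ ‖κ‖ with hδκ | hδκ
  · exact h' κ ε (by rwa [habs]) hδκ
  refine h κ ε hδκ (by rwa [habs]) ?_
  have hb := norm_nonneg (beta k₀ φ)
  have hle : ε ≤ ‖κ‖ := by nlinarith
  have hpos : 0 < ‖κ‖ := hε.trans_le hle
  have h3 : ‖κ‖ / 2 ≤ ‖Complex.I * conj κ + (ε : ℂ) * beta k₀ φ‖ := by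
    have h4 := norm_sub_le_norm_add (Complex.I * conj κ) ((ε : ℂ) * beta k₀ φ)
    rw [norm_mul, norm_mul, Complex.norm_I, one_mul, RCLike.norm_conj, Complex.norm_real,
      Real.norm_eq_abs, habs] at h4
    nlinarith
  have h5 : (‖κ‖ / 2) ^ 2 ≤ ‖Complex.I * conj κ + (ε : ℂ) * beta k₀ φ‖ ^ 2 := by gcongr
  have h6 : 0 ≤ ε ^ 2 * ‖alpha k₀ φ‖ ^ 2 := by positivity
  rw [habs]
  nlinarith

end SolitonOps

theorem isTest_chi {φ : ℂ → ℂ} (hφ : ContDiff ℝ (⊤ : ℕ∞) φ) (hφc : HasCompactSupport φ) (k₀ : ℂ) :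
    IsTest (chi k₀ φ) :=
  IsTest.smooth_mul (contDiff_expo _) ⟨hφ, hφc⟩

end DSSoliton

theorem theorem4p1 (p : ℝ≥0∞) [Fact (1 ≤ p)] (hp : 2 < p) (hp' : p ≠ ⊤)
    (k₀ : ℂ) (φ : ℂ → ℂ) (hφ : ContDiff ℝ ∞ φ) (hφc : HasCompactSupport φ) :
    ∃ T : ℂ → ℝ → (DSSoliton.LpC p →L[ℂ] DSSoliton.LpC p),
      -- `T κ ε` is the scattering operator at `k = k₀ + κ` for the potential `u₀ + ε φ`
      (∀ (κ : ℂ) (ε : ℝ), DSSoliton.IsScatOp p (k₀ + κ)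
        (fun z => DSSoliton.soliton k₀ z + (ε : ℂ) * φ z) (T κ ε)) ∧
      -- (i) the rank-two reduction and the expansion of its determinant
      (∃ r : ℝ, DSSoliton.Isolates r (T 0 0)) ∧
      (∀ r : ℝ, DSSoliton.Isolates r (T 0 0) →
        (∀ᶠ x : ℂ × ℝ in 𝓝 (0, 0),
          Module.finrank ℂ (DSSoliton.rieszRange r (T x.1 x.2)) = 2) ∧
        (fun x : ℂ × ℝ => LinearMap.det (DSSoliton.reduced r (T x.1 x.2)) -
            ((4 * (‖Complex.I * conj x.1 + (x.2 : ℂ) * DSSoliton.beta k₀ φ‖ ^ 2 +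
              x.2 ^ 2 * ‖DSSoliton.alpha k₀ φ‖ ^ 2) : ℝ) : ℂ))
          =o[𝓝 (0, 0)] (fun x : ℂ × ℝ => x.2 ^ 2 + |x.2| * ‖x.1‖ + ‖x.1‖ ^ 2)) ∧
      -- (i) invertibility for small `κ`
      (DSSoliton.alpha k₀ φ ≠ 0 → ∀ C : ℝ, 0 < C → ∃ ε₀ : ℝ, 0 < ε₀ ∧
        ∀ ε : ℝ, ε ≠ 0 → |ε| < ε₀ → ∀ κ : ℂ, ‖κ‖ < C * |ε| → IsUnit (1 - T κ ε)) ∧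
      -- (ii) invertibility for all other `κ`
      (∃ C : ℝ, 0 < C ∧ ∃ ε₀ : ℝ, 0 < ε₀ ∧
        ∀ ε : ℝ, 0 < ε → ε < ε₀ → ∀ κ : ℂ, C * ε < ‖κ‖ → IsUnit (1 - T κ ε)) := by
  have hχ := DSSoliton.isTest_chi hφ hφc k₀
  obtain ⟨S⟩ := DSSoliton.exists_solitonOps hp hp' hχ
  choose l hl using fun i => (DSSoliton.exists_functional hp hp' (DSSoliton.isWeight_dualFun i)).1
  have hs := DSSoliton.semisimpleAtOne hp hp' S hl
  exact ⟨S.T, S.isScatOp hp hp' hχ, hs.exists_isolates, fun r hr =>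
    ⟨(hs.eventually_det_reduced (S.continuous_T.tendsto (0, 0)) hr).2.1,
      S.det_reduced_isLittleO hp hp' hχ hl hr⟩,
    fun hα C hC => S.exists_isUnit_of_alpha_ne_zero hp hp' hχ hl hα hC,
    S.exists_isUnit_of_lt_norm hp hp' hχ hl⟩
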